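/- Let $U\subseteq\mathbb{RP}^4$ be a connected (non-empty) open set, $V\subseteq S^4$ an open set, where $S^4$ is the unit sphere in $\mathbb R^5$, and let $f:U\to V$ be a real analytic diffeomorphism that takes every line segment lying in $U$ to an arc of a round circle in $S^4$. Then at least one of the following holds. (a) $f$ is a restriction of a classical projection. This means that there are an injective projective map $i:\mathbb{RP}^4\to\mathbb{RP}^5=\mathbb R^5\cup\mathbb{RP}^4_\infty$ whose image is not the hyperplane at infinity, a Euclidean sphere $S\subset\mathbb R^5$, a conformal diffeomorphism $j:S^4\to S$ and a point $p\in\mathbb R^5\setminus i(\mathbb{RP}^4)$ such that for every $x\in U$ the point $j(f(x))$ of $S$ is different from $p$ and lies on the projective line through $p$ and $i(x)$; in other words, $f=j^{-1}\circ\pi\circ i$ on $U$, where $\pi$ is (a branch of) the central projection from $p$ to $S$. Moreover, if $U$ is disjoint from some projective hyperplane in $\mathbb{RP}^4$, then $i$ can be chosen with $i(U)\subset\mathbb R^5$. (b) $f$ is a restriction of a left or right quaternionic Hopf fibration. This means that there are an injective projective map $i:\mathbb{RP}^4\to\mathbb{RP}^7$ and a conformal diffeomorphism $j:S^4\to S^4$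 such that $f=j^{-1}\circ\pi\circ i$ on $U$. Here $\mathbb{RP}^7$ is the real projectivization of $\mathbb H^2$, and $\pi:\mathbb{RP}^7\to S^4$ is the natural projection of $\mathbb{RP}^7$ to the left (respectively, right) quaternionic projective line, which is identified with $S^4=\mathbb H\cup\{\infty\}$ by taking $y^{-1}z$ (respectively, $zy^{-1}$) as the coordinate of the point with homogeneous coordinates $(y:z)$ and then the inverse of the stereographic projection. -/

import Mathlib

open Set Filter Topology
open scoped LinearAlgebra.Projectivization ContDiff Quaternion

noncomputable section

namespace LinesToCircles

/-- Euclidean 5-space. -/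
abbrev E5 : Type := EuclideanSpace ℝ (Fin 5)

/-- The unit sphere `S⁴` in `ℝ⁵`. -/
abbrev S4 : Type := Metric.sphere (0 : E5) 1

/-- The real projective space `ℝP⁴`: lines through the origin in `ℝ⁵`. -/
abbrev RP4 : Type := ℙ ℝ E5

/-- The real projective space `ℝP⁵`, seen as the projective completion of `ℝ⁵`. -/
abbrev RP5 : Type := ℙ ℝ (E5 × ℝ)

/-- The real projective space `ℝP⁷`: the real projectivization of `ℍ²`. -/
abbrev RP7 : Type := ℙ ℝ (ℍ[ℝ] × ℍ[ℝ])

/-- The quotient topology on `ℝP⁴`. -/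
instance : TopologicalSpace RP4 :=
  TopologicalSpace.coinduced (Projectivization.mk' ℝ) inferInstance

/-! ### Analytic diffeomorphisms between open sets of `ℝP⁴` and `S⁴` -/

/-- `f` is analytic on `U ⊆ ℝP⁴`: as a function of the homogeneous coordinates, it is real analytic
on the cone over `U`. -/
def AnalyticFromRP4 (f : RP4 → S4) (U : Set RP4) : Prop :=
  ∃ F : E5 → E5, ∀ (v : E5) (hv : v ≠ 0), Projectivization.mk ℝ v hv ∈ U →
    AnalyticAt ℝ F v ∧ F v = f (Projectivization.mk ℝ v hv)

/-- `g` is analytic on `V ⊆ S⁴`: near every point of `V`, homogeneous coordinates of `g` can be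
chosen as the restriction of a real analytic map of an open set of `ℝ⁵`. -/
def AnalyticToRP4 (g : S4 → RP4) (V : Set S4) : Prop :=
  ∀ y ∈ V, ∃ G : E5 → E5, AnalyticAt ℝ G y ∧
    ∀ᶠ z : S4 in 𝓝 y, ∃ h : G z ≠ 0, g z = Projectivization.mk ℝ (G z) h

/-- `f` restricts to an analytic diffeomorphism between the open sets `U ⊆ ℝP⁴` and `V ⊆ S⁴`. -/
structure IsAnalyticDiffeo (f : RP4 → S4) (U : Set RP4) (V : Set S4) : Prop where
  isOpen_source : IsOpen U
  isOpen_target : IsOpen V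
  mapsTo : MapsTo f U V
  analytic : AnalyticFromRP4 f U
  exists_inverse : ∃ g : S4 → RP4, MapsTo g V U ∧ InvOn g f U V ∧ AnalyticToRP4 g V

/-! ### Lines to circles -/

/-- The segment in `ℝP⁴` that is the image of the segment from `u` to `v` in `ℝ⁵`
(used for linearly independent `u` and `v`). -/
def projSegment (u v : E5) : Set RP4 :=
  {x | ∃ w ∈ segment ℝ u v, ∃ hw : w ≠ 0, x = Projectivization.mk ℝ w hw}

/-- Round circles in `S⁴`: sections by affine 2-planes that have more than one point. -/
def IsRoundCircle (C : Set S4) : Prop :=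
  C.Nontrivial ∧ ∃ P : AffineSubspace ℝ E5, Module.finrank ℝ P.direction = 2 ∧
    C = {y : S4 | (y : E5) ∈ P}

/-- Arcs of round circles: connected parts of round circles that have more than one point. -/
def IsArcOfRoundCircle (A : Set S4) : Prop :=
  A.Nontrivial ∧ IsConnected A ∧ ∃ C : Set S4, IsRoundCircle C ∧ A ⊆ C

/-- `f` takes all line segments lying in `U` to arcs of round circles. -/
def TakesLinesToCircles (f : RP4 → S4) (U : Set RP4) : Prop :=
  ∀ u v : E5, LinearIndependent ℝ ![u, v] → projSegment u v ⊆ U →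
    IsArcOfRoundCircle (f '' projSegment u v)

/-! ### Conformal identifications of spheres -/

/-- `j` is a conformal diffeomorphism of `S⁴` onto the sphere with center `c` and radius `r`:
a bijection that is the restriction of a map `J`, smooth near `S⁴`, whose differential at every
point `x ∈ S⁴` multiplies the lengths of all vectors tangent to `S⁴` by one positive factor. -/
def IsConformalIdentification (c : E5) (r : ℝ) (j : S4 → Metric.sphere c r) : Prop :=
  Function.Bijective j ∧ ∃ J : E5 → E5, ∀ x : S4,
    J x = j x ∧ ContDiffAt ℝ ∞ J x ∧
    ∃ k : ℝ, 0 < k ∧ ∀ v : E5, inner ℝ (x : E5) v = 0 → ‖fderiv ℝ J x v‖ = k * ‖v‖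

/-! ### Classical projections -/

/-- The point of `ℝP⁵` that corresponds to the point `q` of `ℝ⁵`. -/
def ofAffine (q : E5) : RP5 :=
  Projectivization.mk ℝ (q, (1 : ℝ)) (fun h => one_ne_zero (congrArg Prod.snd h))

/-- `y` is a central projection of the point `x` from the center `p ∈ ℝ⁵`: it is different from
`p` and it lies on the line that joins `p` and `x` (and `x` is not `p`). -/
def IsCentralProjection (p : E5) (x : RP5) (y : E5) : Prop :=
  x ≠ ofAffine p ∧ y ≠ p ∧
    (ofAffine y).submodule ≤ (ofAffine p).submodule ⊔ x.submodule

/-- On `U`, the map `f` is a restriction of a classical projection: there are a projective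
embedding `i` of `ℝP⁴` as the projective completion of a hyperplane in `ℝ⁵`, a Euclidean sphere
in `ℝ⁵`, a conformal identification `j` of `S⁴` with this sphere, and a center `p` outside the
hyperplane, such that `j ∘ f` is a central projection of `i` from `p`. If `U` misses some
hyperplane in `ℝP⁴`, then `i` takes all points of `U` to points of `ℝ⁵`. -/
def IsClassicalProjectionOn (f : RP4 → S4) (U : Set RP4) : Prop :=
  ∃ (i : E5 →ₗ[ℝ] E5 × ℝ) (hi : Function.Injective i)
    (c : E5) (r : ℝ) (j : S4 → Metric.sphere c r) (p : E5),
    0 < r ∧ IsConformalIdentification c r j ∧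
    (∃ x : RP4, Projectivization.map i hi x ∈ range ofAffine) ∧
    (∀ x : RP4, Projectivization.map i hi x ≠ ofAffine p) ∧
    (∀ x ∈ U, IsCentralProjection p (Projectivization.map i hi x) (j (f x))) ∧
    ((∃ H : Submodule ℝ E5, Module.finrank ℝ H = 4 ∧ ∀ x ∈ U, ¬ x.submodule ≤ H) →
      ∀ x ∈ U, Projectivization.map i hi x ∈ range ofAffine)

/-! ### Quaternionic Hopf fibrations -/

/-- The left quaternionic projective line. -/
abbrev LeftHP1 : Type := ℙ ℍ[ℝ] (ℍ[ℝ] × ℍ[ℝ])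

/-- The right quaternionic projective line. -/
abbrev RightHP1 : Type := ℙ ℍ[ℝ]ᵐᵒᵖ (ℍ[ℝ] × ℍ[ℝ])

/-- The projection of `ℝP⁷` to the left quaternionic projective line. -/
def toLeftHP1 : RP7 → LeftHP1 :=
  Projectivization.lift (fun v => Projectivization.mk ℍ[ℝ] v.1 v.2) (by
    rintro ⟨a, ha⟩ ⟨b, hb⟩ t h
    refine (Projectivization.mk_eq_mk_iff' _ _ _ _ _).2 ⟨(t : ℍ[ℝ]), ?_⟩
    have h' : a = t • b := h
    refine Eq.trans ?_ h'.symm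
    ext1 <;> simp [Quaternion.coe_mul_eq_smul])

/-- The projection of `ℝP⁷` to the right quaternionic projective line. -/
def toRightHP1 : RP7 → RightHP1 :=
  Projectivization.lift (fun v => Projectivization.mk ℍ[ℝ]ᵐᵒᵖ v.1 v.2) (by
    rintro ⟨a, ha⟩ ⟨b, hb⟩ t h
    refine (Projectivization.mk_eq_mk_iff' _ _ _ _ _).2 ⟨MulOpposite.op (t : ℍ[ℝ]), ?_⟩
    have h' : a = t • b := h
    refine Eq.trans ?_ h'.symm
    ext1 <;> simp [Quaternion.mul_coe_eq_smul])

open Classical in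
/-- The coordinate `y⁻¹ z` of the point `(y : z)` of the left quaternionic projective line. -/
def leftCoord : LeftHP1 → OnePoint ℍ[ℝ] :=
  Projectivization.lift
    (fun v => if v.1.1 = 0 then OnePoint.infty else ((v.1.1⁻¹ * v.1.2 : ℍ[ℝ]) : OnePoint ℍ[ℝ])) (by
    rintro ⟨⟨a, a'⟩, ha⟩ ⟨⟨b, b'⟩, hb⟩ t h
    obtain ⟨rfl, rfl⟩ : a = t * b ∧ a' = t * b' := by simpa [Prod.ext_iff] using h
    have ht : t ≠ 0 := by rintro rfl; simp at ha
    by_cases hb0 : b = 0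
    · simp [hb0]
    · simp [hb0, ht, mul_inv_rev, mul_assoc])

open Classical in
/-- The coordinate `z y⁻¹` of the point `(y : z)` of the right quaternionic projective line. -/
def rightCoord : RightHP1 → OnePoint ℍ[ℝ] :=
  Projectivization.lift
    (fun v => if v.1.1 = 0 then OnePoint.infty else ((v.1.2 * v.1.1⁻¹ : ℍ[ℝ]) : OnePoint ℍ[ℝ])) (by
    rintro ⟨⟨a, a'⟩, ha⟩ ⟨⟨b, b'⟩, hb⟩ t h
    obtain ⟨rfl, rfl⟩ : a = b * t.unop ∧ a' = b' * t.unop := by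
      simpa [Prod.ext_iff] using h
    have ht : t.unop ≠ 0 := by intro h0; simp [h0] at ha
    by_cases hb0 : b = 0
    · simp [hb0]
    · simp [hb0, ht, mul_inv_rev, mul_assoc])

/-- The inverse of the stereographic projection of `S⁴` from the north pole `(0, 0, 0, 0, 1)` to
the equatorial hyperplane, which is identified with `ℍ`. -/
def invStereo : OnePoint ℍ[ℝ] → S4
  | none => ⟨!₂[0, 0, 0, 0, 1], by simp [EuclideanSpace.norm_eq, Fin.sum_univ_five]⟩
  | some w => ⟨(1 + Quaternion.normSq w)⁻¹ •
      !₂[2 * w.re, 2 * w.imI, 2 * w.imJ, 2 * w.imK, Quaternion.normSq w - 1], by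
    have h0 : 0 < 1 + Quaternion.normSq w := by
      have := Quaternion.normSq_nonneg (a := w)
      linarith
    rw [mem_sphere_zero_iff_norm, norm_smul, norm_inv, Real.norm_of_nonneg h0.le,
      inv_mul_eq_one₀ h0.ne', eq_comm, EuclideanSpace.norm_eq, Real.sqrt_eq_iff_eq_sq (by positivity)
      h0.le]
    simp [Fin.sum_univ_five, Quaternion.normSq_def']
    ring⟩

/-- The left quaternionic Hopf fibration. -/
def leftHopf (x : RP7) : S4 := invStereo (leftCoord (toLeftHP1 x))

/-- The right quaternionic Hopf fibration. -/
def rightHopf (x : RP7) : S4 := invStereo (rightCoord (toRightHP1 x))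

/-- On `U`, the map `f` is a restriction of the fibration `π : ℝP⁷ → S⁴` to a projective
4-subspace: there are a projective embedding `i : ℝP⁴ → ℝP⁷` and a conformal identification `j`
of the spheres in the images such that `f = j⁻¹ ∘ π ∘ i` on `U`. -/
def IsRestrictionOfFibrationOn (π : RP7 → S4) (f : RP4 → S4) (U : Set RP4) : Prop :=
  ∃ (i : E5 →ₗ[ℝ] ℍ[ℝ] × ℍ[ℝ]) (hi : Function.Injective i) (j : S4 → S4),
    IsConformalIdentification 0 1 j ∧ ∀ x ∈ U, j (f x) = π (Projectivization.map i hi x)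

end LinesToCircles

end

noncomputable section

set_option maxSynthPendingDepth 3

namespace LinesToCircles

/-! In an affine chart of ℝP⁴ and after stereographic projection, `f` becomes a local diffeomorphism
g between open sets of ℍ. A curve γ on a circle satisfies a third-order equation: |γ'|²γ''' − 3⟨γ',
γ''⟩γ'' is a multiple of γ' (`circle_equation`). On the line x + tv the derivatives of g are forms
in v. With u = Dg(v) as the variable, the second and third derivatives become a quadratic map Γ(u)
and a cubic map C(u), and the equation is a statement about polynomials in four variables.

The form |u|² is a prime polynomial (`prime_sum_sq`), so one can argue modulo |u|² as in a domain.
It divides ⟨u, Γ⟩ and ⟨u, C⟩ (`circle_condition_dvd`) and, after one differentiation along the line,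
also |Γ|². Then it divides (Γu*)X(u*Γ) for every constant X, so it divides Γu* or u*Γ. This means
Γ(u) = A(u)u or Γ(u) = uA(u) with A linear (`exists_left_or_right_factor`). One of the two cases
holds on an open set, and conjugation reduces both to D²g(v,v) = A(v)Dg(v).

The symmetry of D³g and the circle equation determine 2DA(w,u) − A(w)A(u), an analogue of the
Schwarzian derivative, up to one real function σ (`LeftCircleMap.exists_schwarzian`). If σ vanishes
identically, A satisfies a Riccati equation along lines and g = y⁻¹z with y, z affine: a Hopf
fibration (`LeftCircleMap.quotient_of_affine`). If σ ≠ 0 at some point, the symmetry of D²A forces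
A(v) = ℓ(v) + b·Dg(v)* near it, with ℓ real, so g'' is a combination of g' and |g'|²b. Lift g to the
light cone of ℝ⁶ by Φ = (g, |g|², 1). There is a vector P whose direction does not change along
lines, and modulo P the vector Φ(x + v) is a scalar multiple of an affine function of v: a central
projection from P (`ClassicalMap.central_projection`).

In homogeneous coordinates both local forms are given by linear maps. They are equivalent to
analytic equations on the cone over `U`, so they propagate from a neighbourhood of one point to all
of the connected set `U` (`eq_zero_on_cone`). In the classical case two normalizations remain. A
center at infinity is made finite by an inversion of S⁴, which acts on ℝ⁶ as a Lorentz reflection.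
Adding multiples of P to the embedding does not change the lines through the center, and serves to
send a hyperplane disjoint from `U` to infinity. -/

/-! ### Polynomial functions on the quaternions -/

/-- The four real coordinates of a quaternion. -/
def coords (v : ℍ[ℝ]) : Fin 4 → ℝ := ![v.re, v.imI, v.imJ, v.imK]

/-- The quaternion with given coordinates. -/
def ofCoords (a b c d : ℝ) : ℍ[ℝ] := ⟨a, b, c, d⟩

@[simp] theorem ofCoords_re (a b c d : ℝ) : (ofCoords a b c d).re = a := rfl
@[simp] theorem ofCoords_imI (a b c d : ℝ) : (ofCoords a b c d).imI = b := rfl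
@[simp] theorem ofCoords_imJ (a b c d : ℝ) : (ofCoords a b c d).imJ = c := rfl
@[simp] theorem ofCoords_imK (a b c d : ℝ) : (ofCoords a b c d).imK = d := rfl

/-- Real polynomial functions on the quaternions. -/
def IsPoly (f : ℍ[ℝ] → ℝ) : Prop :=
  ∃ P : MvPolynomial (Fin 4) ℝ, ∀ v, f v = MvPolynomial.eval (coords v) P

theorem IsPoly.const (c : ℝ) : IsPoly fun _ => c := ⟨MvPolynomial.C c, by simp⟩

theorem IsPoly.re : IsPoly fun v => v.re := ⟨MvPolynomial.X 0, by simp [coords]⟩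

theorem IsPoly.imI : IsPoly fun v => v.imI := ⟨MvPolynomial.X 1, by simp [coords]⟩

theorem IsPoly.imJ : IsPoly fun v => v.imJ := ⟨MvPolynomial.X 2, by simp [coords]⟩

theorem IsPoly.imK : IsPoly fun v => v.imK := ⟨MvPolynomial.X 3, by simp [coords]⟩

theorem IsPoly.add {f g : ℍ[ℝ] → ℝ} (hf : IsPoly f) (hg : IsPoly g) :
    IsPoly fun v => f v + g v := by
  obtain ⟨P, hP⟩ := hf
  obtain ⟨Q, hQ⟩ := hg
  exact ⟨P + Q, by simp [hP, hQ]⟩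

theorem IsPoly.mul {f g : ℍ[ℝ] → ℝ} (hf : IsPoly f) (hg : IsPoly g) :
    IsPoly fun v => f v * g v := by
  obtain ⟨P, hP⟩ := hf
  obtain ⟨Q, hQ⟩ := hg
  exact ⟨P * Q, by simp [hP, hQ]⟩

theorem IsPoly.neg {f : ℍ[ℝ] → ℝ} (hf : IsPoly f) : IsPoly fun v => -f v := by
  obtain ⟨P, hP⟩ := hf
  exact ⟨-P, by simp [hP]⟩

theorem IsPoly.sub {f g : ℍ[ℝ] → ℝ} (hf : IsPoly f) (hg : IsPoly g) :
    IsPoly fun v => f v - g v := by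
  simpa only [sub_eq_add_neg] using hf.add hg.neg

theorem IsPoly.congr {f g : ℍ[ℝ] → ℝ} (hf : IsPoly f) (h : ∀ v, g v = f v) : IsPoly g := by
  rwa [show g = f from funext h]

/-- The restriction to the diagonal of a function that is linear in the first argument and
polynomial in the second one is polynomial. -/
theorem IsPoly.diag (T : ℍ[ℝ] → ℍ[ℝ] → ℝ)
    (hadd : ∀ a b v, T (a + b) v = T a v + T b v) (hsmul : ∀ (c : ℝ) a v, T (c • a) v = c * T a v)
    (h : ∀ e, IsPoly (T e)) : IsPoly fun v => T v v := by
  have key : ∀ v : ℍ[ℝ], T v v = v.re * T 1 v + v.imI * T (ofCoords 0 1 0 0) v +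
      v.imJ * T (ofCoords 0 0 1 0) v + v.imK * T (ofCoords 0 0 0 1) v := by
    intro v
    rw [← hsmul, ← hsmul, ← hsmul, ← hsmul, ← hadd, ← hadd, ← hadd]
    congr 1
    ext <;> simp
  exact ((((IsPoly.re.mul (h _)).add (IsPoly.imI.mul (h _))).add
    (IsPoly.imJ.mul (h _))).add (IsPoly.imK.mul (h _))).congr key

theorem IsPoly.of_linear (T : ℍ[ℝ] → ℝ)
    (hadd : ∀ a b, T (a + b) = T a + T b) (hsmul : ∀ (c : ℝ) a, T (c • a) = c * T a) :
    IsPoly T :=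
  IsPoly.diag (fun e _ => T e) (fun a b _ => hadd a b) (fun c a _ => hsmul c a)
    fun e => IsPoly.const (T e)

theorem IsPoly.differentiable {f : ℍ[ℝ] → ℝ} (hf : IsPoly f) : Differentiable ℝ f := by
  obtain ⟨P, hP⟩ := hf
  rw [show f = fun v => MvPolynomial.eval (coords v) P from funext hP]
  clear hP
  have hc : ∀ i, Differentiable ℝ fun v => coords v i := by
    have hl : ∀ φ : ℍ[ℝ] →ₗ[ℝ] ℝ, Differentiable ℝ fun v => φ v := fun φ =>
      (LinearMap.toContinuousLinearMap φ).differentiable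
    intro i
    fin_cases i
    · exact hl ⟨⟨fun v => v.re, fun _ _ => rfl⟩, fun _ _ => rfl⟩
    · exact hl ⟨⟨fun v => v.imI, fun _ _ => rfl⟩, fun _ _ => rfl⟩
    · exact hl ⟨⟨fun v => v.imJ, fun _ _ => rfl⟩, fun _ _ => rfl⟩
    · exact hl ⟨⟨fun v => v.imK, fun _ _ => rfl⟩, fun _ _ => rfl⟩
  induction P using MvPolynomial.induction_on with
  | C a => simp
  | add p q hp hq =>
    simp only [map_add]
    exact hp.add hq
  | mul_X p i hp =>
    simp only [map_mul, MvPolynomial.eval_X]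
    exact hp.mul (hc i)

/-- The sum of the squares of four variables is a prime polynomial. -/
theorem prime_sum_sq :
    Prime (MvPolynomial.X 0 ^ 2 + MvPolynomial.X 1 ^ 2 + MvPolynomial.X 2 ^ 2 +
      MvPolynomial.X 3 ^ 2 : MvPolynomial (Fin 4) ℝ) := by
  -- As a polynomial in the first variable this is X² + r with r = x² + y² + z². A factorization of
  -- this monic quadratic would give r = −c², and evaluation at (1, 0, 0) would make 1 the negative
  -- of a square.
  rw [← MulEquiv.prime_iff (MvPolynomial.finSuccEquiv ℝ 3)]
  set r : MvPolynomial (Fin 3) ℝ :=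
    MvPolynomial.X 0 ^ 2 + MvPolynomial.X 1 ^ 2 + MvPolynomial.X 2 ^ 2 with hr
  have h : MvPolynomial.finSuccEquiv ℝ 3 (MvPolynomial.X 0 ^ 2 + MvPolynomial.X 1 ^ 2 +
      MvPolynomial.X 2 ^ 2 + MvPolynomial.X 3 ^ 2) = Polynomial.X ^ 2 + Polynomial.C r := by
    have h1 := MvPolynomial.finSuccEquiv_X_succ (R := ℝ) (n := 3) (j := 0)
    have h2 := MvPolynomial.finSuccEquiv_X_succ (R := ℝ) (n := 3) (j := 1)
    have h3 := MvPolynomial.finSuccEquiv_X_succ (R := ℝ) (n := 3) (j := 2)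
    simp only [Fin.succ_zero_eq_one, Fin.succ_one_eq_two] at h1 h2
    rw [show Fin.succ (2 : Fin 3) = 3 from rfl] at h3
    simp only [map_add, map_pow, MvPolynomial.finSuccEquiv_X_zero, h1, h2, h3, hr]
    ring
  rw [h]
  refine Irreducible.prime ?_
  have hm : (Polynomial.X ^ 2 + Polynomial.C r).Monic :=
    Polynomial.monic_X_pow_add_C r two_ne_zero
  have hd : (Polynomial.X ^ 2 + Polynomial.C r).natDegree = 2 := Polynomial.natDegree_X_pow_add_C
  by_contra hirr
  obtain ⟨c₁, c₂, h0, h1⟩ := (hm.not_irreducible_iff_exists_add_mul_eq_coeff hd).1 hirr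
  simp [Polynomial.coeff_C] at h0 h1
  have h2 : c₂ = -c₁ := by linear_combination -h1
  have h3 := congrArg (MvPolynomial.eval ![(1 : ℝ), 0, 0]) h0
  rw [h2, hr] at h3
  simp at h3
  nlinarith [mul_self_nonneg (MvPolynomial.eval ![(1 : ℝ), 0, 0] c₁)]

/-- The square of the norm divides a factor of a product of polynomial functions if it divides the
product. -/
theorem IsPoly.dvd_or_dvd {f g h : ℍ[ℝ] → ℝ} (hf : IsPoly f) (hg : IsPoly g) (hh : IsPoly h)
    (H : ∀ v, f v * g v = Quaternion.normSq v * h v) :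
    (∃ k, IsPoly k ∧ ∀ v, f v = Quaternion.normSq v * k v) ∨
      ∃ k, IsPoly k ∧ ∀ v, g v = Quaternion.normSq v * k v := by
  obtain ⟨P, hP⟩ := hf
  obtain ⟨Q, hQ⟩ := hg
  obtain ⟨R, hR⟩ := hh
  have hq : ∀ v, Quaternion.normSq v = MvPolynomial.eval (coords v)
      (MvPolynomial.X 0 ^ 2 + MvPolynomial.X 1 ^ 2 + MvPolynomial.X 2 ^ 2 +
      MvPolynomial.X 3 ^ 2 : MvPolynomial (Fin 4) ℝ) := by
    intro v
    simp [Quaternion.normSq_def', coords]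
  have hPQ : P * Q = (MvPolynomial.X 0 ^ 2 + MvPolynomial.X 1 ^ 2 + MvPolynomial.X 2 ^ 2 +
      MvPolynomial.X 3 ^ 2) * R := by
    refine MvPolynomial.funext fun x => ?_
    have hx : x = coords (ofCoords (x 0) (x 1) (x 2) (x 3)) := by
      ext i
      fin_cases i <;> rfl
    rw [hx, map_mul, map_mul, ← hP, ← hQ, ← hR, ← hq, H]
  rcases prime_sum_sq.dvd_or_dvd (Dvd.intro _ hPQ.symm) with ⟨K, hK⟩ | ⟨K, hK⟩
  · exact Or.inl ⟨fun v => MvPolynomial.eval (coords v) K, ⟨K, fun _ => rfl⟩, fun v => by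
      rw [hP, hK, map_mul, hq]⟩
  · exact Or.inr ⟨fun v => MvPolynomial.eval (coords v) K, ⟨K, fun _ => rfl⟩, fun v => by
      rw [hQ, hK, map_mul, hq]⟩

/-- A linear form that is divisible by the square of the norm vanishes. -/
theorem not_normSq_dvd_linear {T k : ℍ[ℝ] → ℝ} (hk : IsPoly k)
    (hsmul : ∀ (c : ℝ) a, T (c • a) = c * T a) (H : ∀ v, T v = Quaternion.normSq v * k v)
    (v : ℍ[ℝ]) : T v = 0 := by
  -- Degrees are compared by scaling: the left side has degree one and the right side at least two,
  -- so letting c tend to 0 leaves nothing.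
  have h1 : ∀ c : ℝ, c ≠ 0 → T v = c * (Quaternion.normSq v * k (c • v)) := by
    intro c hc
    have := H (c • v)
    rw [hsmul, Quaternion.normSq_smul] at this
    have h2 : c * T v = c * (c * (Quaternion.normSq v * k (c • v))) := by rw [this]; ring
    exact mul_left_cancel₀ hc h2
  have h2 : Tendsto (fun c : ℝ => c * (Quaternion.normSq v * k (c • v))) (𝓝[≠] 0) (𝓝 0) := by
    have hc : Continuous fun c : ℝ => c * (Quaternion.normSq v * k (c • v)) := by
      have := hk.differentiable.continuous
      fun_prop
    have := hc.tendsto 0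
    simp only [zero_mul] at this
    exact this.mono_left nhdsWithin_le_nhds
  have h3 : Tendsto (fun c : ℝ => c * (Quaternion.normSq v * k (c • v))) (𝓝[≠] 0) (𝓝 (T v)) := by
    refine Tendsto.congr' ?_ tendsto_const_nhds
    filter_upwards [self_mem_nhdsWithin] with c hc using h1 c hc
  exact tendsto_nhds_unique h3 h2

/-- Maps of the quaternions to themselves with polynomial components. -/
structure IsPolyMap (F : ℍ[ℝ] → ℍ[ℝ]) : Prop where
  re : IsPoly fun v => (F v).re
  imI : IsPoly fun v => (F v).imI
  imJ : IsPoly fun v => (F v).imJ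
  imK : IsPoly fun v => (F v).imK

theorem IsPolyMap.id : IsPolyMap fun v => v := ⟨IsPoly.re, IsPoly.imI, IsPoly.imJ, IsPoly.imK⟩

theorem IsPolyMap.star {F : ℍ[ℝ] → ℍ[ℝ]} (h : IsPolyMap F) : IsPolyMap fun v => star (F v) :=
  ⟨h.re.congr (by simp), h.imI.neg.congr (by simp), h.imJ.neg.congr (by simp),
    h.imK.neg.congr (by simp)⟩

theorem IsPolyMap.mul {F G : ℍ[ℝ] → ℍ[ℝ]} (hF : IsPolyMap F) (hG : IsPolyMap G) :
    IsPolyMap fun v => F v * G v :=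
  ⟨((((hF.re.mul hG.re).sub (hF.imI.mul hG.imI)).sub (hF.imJ.mul hG.imJ)).sub
      (hF.imK.mul hG.imK)).congr (by simp),
    ((((hF.re.mul hG.imI).add (hF.imI.mul hG.re)).add (hF.imJ.mul hG.imK)).sub
      (hF.imK.mul hG.imJ)).congr (by simp),
    ((((hF.re.mul hG.imJ).sub (hF.imI.mul hG.imK)).add (hF.imJ.mul hG.re)).add
      (hF.imK.mul hG.imI)).congr (by simp),
    ((((hF.re.mul hG.imK).add (hF.imI.mul hG.imJ)).sub (hF.imJ.mul hG.imI)).add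
      (hF.imK.mul hG.re)).congr (by simp)⟩

theorem IsPolyMap.smul {f : ℍ[ℝ] → ℝ} {F : ℍ[ℝ] → ℍ[ℝ]} (hf : IsPoly f) (hF : IsPolyMap F) :
    IsPolyMap fun v => f v • F v :=
  ⟨(hf.mul hF.re).congr (by simp), (hf.mul hF.imI).congr (by simp),
    (hf.mul hF.imJ).congr (by simp), (hf.mul hF.imK).congr (by simp)⟩

theorem IsPolyMap.sub {F G : ℍ[ℝ] → ℍ[ℝ]} (hF : IsPolyMap F) (hG : IsPolyMap G) :
    IsPolyMap fun v => F v - G v :=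
  ⟨(hF.re.sub hG.re).congr (by simp), (hF.imI.sub hG.imI).congr (by simp),
    (hF.imJ.sub hG.imJ).congr (by simp), (hF.imK.sub hG.imK).congr (by simp)⟩

theorem IsPolyMap.diag (T : ℍ[ℝ] → ℍ[ℝ] → ℍ[ℝ])
    (hadd : ∀ a b v, T (a + b) v = T a v + T b v) (hsmul : ∀ (c : ℝ) a v, T (c • a) v = c • T a v)
    (h : ∀ e, IsPolyMap (T e)) : IsPolyMap fun v => T v v :=
  ⟨IsPoly.diag (fun e v => (T e v).re) (by simp [hadd]) (by simp [hsmul]) fun e => (h e).re,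
    IsPoly.diag (fun e v => (T e v).imI) (by simp [hadd]) (by simp [hsmul]) fun e => (h e).imI,
    IsPoly.diag (fun e v => (T e v).imJ) (by simp [hadd]) (by simp [hsmul]) fun e => (h e).imJ,
    IsPoly.diag (fun e v => (T e v).imK) (by simp [hadd]) (by simp [hsmul]) fun e => (h e).imK⟩

theorem IsPolyMap.of_linear (T : ℍ[ℝ] →L[ℝ] ℍ[ℝ]) : IsPolyMap T :=
  IsPolyMap.diag (fun e _ => T e) (by simp) (by simp) fun e =>
    ⟨IsPoly.const _, IsPoly.const _, IsPoly.const _, IsPoly.const _⟩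

/-- The inner product of two quaternions. -/
def dot (a b : ℍ[ℝ]) : ℝ := a.re * b.re + a.imI * b.imI + a.imJ * b.imJ + a.imK * b.imK

theorem isPoly_dot {F G : ℍ[ℝ] → ℍ[ℝ]} (hF : IsPolyMap F) (hG : IsPolyMap G) :
    IsPoly fun v => dot (F v) (G v) :=
  (((hF.re.mul hG.re).add (hF.imI.mul hG.imI)).add (hF.imJ.mul hG.imJ)).add (hF.imK.mul hG.imK)

/-- A function that is homogeneous of degree one and differentiable at the origin is linear. -/
theorem exists_linear_of_homogeneous {E : Type*} [NormedAddCommGroup E] [NormedSpace ℝ E]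
    {k : ℍ[ℝ] → E} (hk : Differentiable ℝ k)
    (hom : ∀ (c : ℝ) v, c ≠ 0 → v ≠ 0 → k (c • v) = c • k v) : ∃ A : ℍ[ℝ] →L[ℝ] E, ∀ v, k v = A v := by
  have h0 : k 0 = 0 := by
    have h1 : Tendsto (fun c : ℝ => k (c • (1 : ℍ[ℝ]))) (𝓝[≠] 0) (𝓝 (k 0)) := by
      have hc : Continuous fun c : ℝ => k (c • (1 : ℍ[ℝ])) := by
        have := hk.continuous
        fun_prop
      have := hc.tendsto 0
      simp only [zero_smul] at this
      exact this.mono_left nhdsWithin_le_nhds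
    have h2 : Tendsto (fun c : ℝ => k (c • (1 : ℍ[ℝ]))) (𝓝[≠] 0) (𝓝 0) := by
      have hc : Continuous fun c : ℝ => c • k (1 : ℍ[ℝ]) := by fun_prop
      have := hc.tendsto 0
      simp only [zero_smul] at this
      refine Tendsto.congr' ?_ (this.mono_left nhdsWithin_le_nhds)
      filter_upwards [self_mem_nhdsWithin] with c hc using (hom c 1 hc one_ne_zero).symm
    exact tendsto_nhds_unique h1 h2
  -- On the line through v the function is c ↦ c • k v, whose derivative at 0 is k v; by the chain
  -- rule it is also Dk(0)v.
  refine ⟨fderiv ℝ k 0, fun v => ?_⟩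
  rcases eq_or_ne v 0 with rfl | hv
  · simp [h0]
  have h1 : HasDerivAt (fun c : ℝ => k (c • v)) (fderiv ℝ k 0 v) 0 := by
    have := (hk 0).hasFDerivAt
    rw [← zero_smul ℝ v] at this
    have h2 := this.comp_hasDerivAt (0 : ℝ) ((hasDerivAt_id (0 : ℝ)).smul_const v)
    simpa [Function.comp_def] using h2
  have h2 : HasDerivAt (fun c : ℝ => k (c • v)) (k v) 0 := by
    have h3 : (fun c : ℝ => k (c • v)) = fun c : ℝ => c • k v := by
      ext1 c
      rcases eq_or_ne c 0 with rfl | hc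
      · simp [h0]
      · exact hom c v hc hv
    rw [h3]
    simpa using (hasDerivAt_id (0 : ℝ)).smul_const (k v)
  exact h2.unique h1

/-! ### Quadratic maps satisfying the circle condition -/

theorem dot_self (a : ℍ[ℝ]) : dot a a = Quaternion.normSq a := by
  rw [Quaternion.normSq_def', dot]
  ring

theorem dot_comm (a b : ℍ[ℝ]) : dot a b = dot b a := by
  simp only [dot]
  ring

theorem dot_add_left (a b c : ℍ[ℝ]) : dot (a + b) c = dot a c + dot b c := by
  simp [dot]
  ring

theorem dot_smul_left (r : ℝ) (a b : ℍ[ℝ]) : dot (r • a) b = r * dot a b := by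
  simp [dot]
  ring

theorem dot_add_right (a b c : ℍ[ℝ]) : dot a (b + c) = dot a b + dot a c := by
  simp [dot]
  ring

theorem dot_smul_right (r : ℝ) (a b : ℍ[ℝ]) : dot a (r • b) = r * dot a b := by
  simp [dot]
  ring

/-- The third order condition for circles makes the tangential part of the second derivative a
multiple of the square of the speed. -/
theorem circle_condition_dvd {Γ C : ℍ[ℝ] → ℍ[ℝ]} (hΓ : IsPolyMap Γ) (hC : IsPolyMap C)
    (H : ∀ u, ∃ κ : ℝ, Quaternion.normSq u • C u - (3 * dot u (Γ u)) • Γ u = κ • u) :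
    (∃ k, IsPoly k ∧ ∀ u, dot u (Γ u) = Quaternion.normSq u * k u) ∧
      ∃ k, IsPoly k ∧ ∀ u, dot u (C u) = Quaternion.normSq u * k u := by
  have hre : ¬ ∃ k, IsPoly k ∧ ∀ u : ℍ[ℝ], u.re = Quaternion.normSq u * k u := by
    rintro ⟨k, hk, h⟩
    simpa using not_normSq_dvd_linear hk (by simp) h 1
  have h1 : ∃ k, IsPoly k ∧ ∀ u, dot u (Γ u) = Quaternion.normSq u * k u := by
    by_contra hcon
    -- Taking the exterior product of the hypothesis with u removes κ: 3⟨u, Γ⟩ (u ∧ Γ) = |u|² (u ∧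
    -- C). If |u|² does not divide ⟨u, Γ⟩, it divides the components of u ∧ Γ, and these generate
    -- (re u)⟨u, Γ⟩ modulo |u|².
    have aux : ∀ D : ℍ[ℝ] → ℝ, IsPoly D → ∀ E, IsPoly E →
        (∀ u, 3 * dot u (Γ u) * D u = Quaternion.normSq u * E u) →
        ∃ k, IsPoly k ∧ ∀ u, D u = Quaternion.normSq u * k u := by
      intro D hD E hE h
      rcases (((IsPoly.const 3).mul (isPoly_dot IsPolyMap.id hΓ)).dvd_or_dvd hD hE h) with
        ⟨k, hk, h⟩ | h
      · refine absurd ⟨fun u => (1 / 3) * k u, (IsPoly.const _).mul hk, fun u => ?_⟩ hcon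
        linear_combination (1 / 3) * h u
      · exact h
    obtain ⟨k1, hk1, h1⟩ := aux (fun u => u.re * (Γ u).imI - u.imI * (Γ u).re)
      ((IsPoly.re.mul hΓ.imI).sub (IsPoly.imI.mul hΓ.re))
      (fun u => u.re * (C u).imI - u.imI * (C u).re)
      ((IsPoly.re.mul hC.imI).sub (IsPoly.imI.mul hC.re)) (by
        intro u
        obtain ⟨κ, h⟩ := H u
        have e0 := congrArg (fun x : ℍ[ℝ] => x.re) h
        have e1 := congrArg (fun x : ℍ[ℝ] => x.imI) h
        simp at e0 e1
        linear_combination u.imI * e0 - u.re * e1)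
    obtain ⟨k2, hk2, h2⟩ := aux (fun u => u.re * (Γ u).imJ - u.imJ * (Γ u).re)
      ((IsPoly.re.mul hΓ.imJ).sub (IsPoly.imJ.mul hΓ.re))
      (fun u => u.re * (C u).imJ - u.imJ * (C u).re)
      ((IsPoly.re.mul hC.imJ).sub (IsPoly.imJ.mul hC.re)) (by
        intro u
        obtain ⟨κ, h⟩ := H u
        have e0 := congrArg (fun x : ℍ[ℝ] => x.re) h
        have e1 := congrArg (fun x : ℍ[ℝ] => x.imJ) h
        simp at e0 e1
        linear_combination u.imJ * e0 - u.re * e1)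
    obtain ⟨k3, hk3, h3⟩ := aux (fun u => u.re * (Γ u).imK - u.imK * (Γ u).re)
      ((IsPoly.re.mul hΓ.imK).sub (IsPoly.imK.mul hΓ.re))
      (fun u => u.re * (C u).imK - u.imK * (C u).re)
      ((IsPoly.re.mul hC.imK).sub (IsPoly.imK.mul hC.re)) (by
        intro u
        obtain ⟨κ, h⟩ := H u
        have e0 := congrArg (fun x : ℍ[ℝ] => x.re) h
        have e1 := congrArg (fun x : ℍ[ℝ] => x.imK) h
        simp at e0 e1
        linear_combination u.imK * e0 - u.re * e1)
    -- `re u * ⟨u, Γ u⟩ = |u|² re (Γ u) + Σ u_i (re u Γ_i - u_i re Γ)`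
    rcases IsPoly.re.dvd_or_dvd (isPoly_dot IsPolyMap.id hΓ)
      (((hΓ.re.add (IsPoly.imI.mul hk1)).add (IsPoly.imJ.mul hk2)).add (IsPoly.imK.mul hk3)) (by
        intro u
        have := Quaternion.normSq_def' (a := u)
        simp only [dot]
        linear_combination u.imI * h1 u + u.imJ * h2 u + u.imK * h3 u - (Γ u).re * this)
      with h | h
    · exact hre h
    · exact hcon h
  refine ⟨h1, ?_⟩
  obtain ⟨k, hk, h1⟩ := h1
  have hQ : IsPolyMap fun u => C u - (3 * k u) • Γ u :=
    hC.sub (IsPolyMap.smul ((IsPoly.const 3).mul hk) hΓ)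
  have hκ : IsPoly fun u => dot u (C u) - 3 * k u * dot u (Γ u) :=
    (isPoly_dot IsPolyMap.id hC).sub
      (((IsPoly.const 3).mul hk).mul (isPoly_dot IsPolyMap.id hΓ))
  -- With ⟨u, Γ⟩ = |u|²k the hypothesis reads |u|²(C − 3kΓ) = κu. Pairing with u gives κ = ⟨u, C⟩ −
  -- 3k⟨u, Γ⟩, a polynomial; the real component then shows that |u|² divides (re u)κ, hence κ.
  have h2 : ∃ m, IsPoly m ∧ ∀ u, dot u (C u) - 3 * k u * dot u (Γ u) =
      Quaternion.normSq u * m u := by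
    rcases IsPoly.re.dvd_or_dvd hκ hQ.re (by
      intro u
      obtain ⟨κ, h⟩ := H u
      rcases eq_or_ne u 0 with rfl | hu
      · simp
      have hq : Quaternion.normSq u ≠ 0 := by simpa using hu
      have e0 := congrArg (fun x : ℍ[ℝ] => x.re) h
      have e := congrArg (fun x : ℍ[ℝ] => dot u x) h
      rw [sub_eq_add_neg, ← neg_smul, dot_add_right, dot_smul_right, dot_smul_right,
        dot_smul_right, dot_self] at e
      simp only [Quaternion.re_sub, Quaternion.re_smul, smul_eq_mul] at e0 ⊢
      have hk := h1 u
      refine mul_left_cancel₀ hq ?_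
      linear_combination u.re * e - Quaternion.normSq u * e0 +
        3 * (dot u (Γ u) * u.re - Quaternion.normSq u * (Γ u).re) * hk) with h | h
    · exact absurd h hre
    · exact h
  obtain ⟨m, hm, h2⟩ := h2
  refine ⟨fun u => m u + 3 * k u * k u,
    hm.add (((IsPoly.const 3).mul hk).mul hk), fun u => ?_⟩
  linear_combination h2 u + 3 * k u * h1 u

/-- A cubic map divided by a quadratic form is homogeneous of degree one; the quotient is
polynomial, hence differentiable at 0, hence linear. -/
theorem exists_linear_of_normSq_dvd {M : ℍ[ℝ] → ℍ[ℝ]}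
    (hom : ∀ (c : ℝ) u, M (c • u) = c ^ 3 • M u)
    (h0 : ∃ k, IsPoly k ∧ ∀ u, (M u).re = Quaternion.normSq u * k u)
    (h1 : ∃ k, IsPoly k ∧ ∀ u, (M u).imI = Quaternion.normSq u * k u)
    (h2 : ∃ k, IsPoly k ∧ ∀ u, (M u).imJ = Quaternion.normSq u * k u)
    (h3 : ∃ k, IsPoly k ∧ ∀ u, (M u).imK = Quaternion.normSq u * k u) :
    ∃ A : ℍ[ℝ] →L[ℝ] ℍ[ℝ], ∀ u, M u = Quaternion.normSq u • A u := by
  obtain ⟨k0, hk0, h0⟩ := h0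
  obtain ⟨k1, hk1, h1⟩ := h1
  obtain ⟨k2, hk2, h2⟩ := h2
  obtain ⟨k3, hk3, h3⟩ := h3
  have hM : ∀ u, M u = Quaternion.normSq u • ofCoords (k0 u) (k1 u) (k2 u) (k3 u) := by
    intro u
    ext <;> simp [h0, h1, h2, h3]
  have hd : Differentiable ℝ fun u => ofCoords (k0 u) (k1 u) (k2 u) (k3 u) := by
    have : (fun u => ofCoords (k0 u) (k1 u) (k2 u) (k3 u)) = fun u =>
        k0 u • (1 : ℍ[ℝ]) + k1 u • ofCoords 0 1 0 0 + k2 u • ofCoords 0 0 1 0 +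
          k3 u • ofCoords 0 0 0 1 := by
      ext u <;> simp
    rw [this]
    have := hk0.differentiable
    have := hk1.differentiable
    have := hk2.differentiable
    have := hk3.differentiable
    fun_prop
  obtain ⟨A, hA⟩ := exists_linear_of_homogeneous hd (by
    intro c u hc hu
    have e := hom c u
    rw [hM, hM, Quaternion.normSq_smul, smul_smul] at e
    have hq : c ^ 2 * Quaternion.normSq u ≠ 0 := mul_ne_zero (pow_ne_zero _ hc) (by simpa using hu)
    refine smul_right_injective _ hq ?_
    simp only
    rw [e, smul_smul]
    congr 1
    ring)
  exact ⟨A, fun u => by rw [hM, hA]⟩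

/-- A quadratic map `Γ` with `⟨u, Γ u⟩` and `⟨Γ u, Γ u⟩` divisible by `|u|²` is left or right
multiplication by a linear map. -/
theorem exists_left_or_right_factor {Γ : ℍ[ℝ] → ℍ[ℝ]} (hΓ : IsPolyMap Γ)
    (hom : ∀ (c : ℝ) u, Γ (c • u) = c ^ 2 • Γ u)
    (h1 : ∃ k, IsPoly k ∧ ∀ u, dot u (Γ u) = Quaternion.normSq u * k u)
    (h2 : ∃ k, IsPoly k ∧ ∀ u, dot (Γ u) (Γ u) = Quaternion.normSq u * k u) :
    (∃ A : ℍ[ℝ] →L[ℝ] ℍ[ℝ], ∀ u, Γ u = A u * u) ∨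
      ∃ A : ℍ[ℝ] →L[ℝ] ℍ[ℝ], ∀ u, Γ u = u * A u := by
  obtain ⟨k1, hk1, h1⟩ := h1
  obtain ⟨k2, hk2, h2⟩ := h2
  set m : ℍ[ℝ] → ℍ[ℝ] := fun u => Γ u * star u with hm
  set n : ℍ[ℝ] → ℍ[ℝ] := fun u => star u * Γ u with hn
  have pm : IsPolyMap m := hΓ.mul IsPolyMap.id.star
  have pn : IsPolyMap n := IsPolyMap.id.star.mul hΓ
  -- Modulo |u|² one has u*Xu* ≡ 2⟨u, X⟩u*, so mXn ≡ 2⟨u, X⟩Γu*Γ, while Γu*Γ = 2⟨u, Γ⟩Γ − |Γ|²u ≡ 0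
  -- by the two hypotheses.
  have key : ∀ X : ℍ[ℝ], ∃ R, IsPolyMap R ∧ ∀ u, m u * X * n u = Quaternion.normSq u • R u := by
    intro X
    have hX : IsPolyMap fun _ : ℍ[ℝ] => X :=
      ⟨IsPoly.const _, IsPoly.const _, IsPoly.const _, IsPoly.const _⟩
    refine ⟨fun u => (2 * dot u X) • ((2 * k1 u) • Γ u - k2 u • u) - Γ u * star X * Γ u,
      (IsPolyMap.smul ((IsPoly.const 2).mul (isPoly_dot IsPolyMap.id hX))
        ((IsPolyMap.smul ((IsPoly.const 2).mul hk1) hΓ).sub (IsPolyMap.smul hk2 IsPolyMap.id))).sub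
        ((hΓ.mul hX.star).mul hΓ), fun u => ?_⟩
    have e1 : star u * X * star u =
        (2 * dot u X) • star u - Quaternion.normSq u • star X := by
      rw [Quaternion.normSq_def']
      ext <;> simp [dot] <;> ring
    have e2 : Γ u * star u * Γ u = (2 * dot u (Γ u)) • Γ u - dot (Γ u) (Γ u) • u := by
      ext <;> simp [dot] <;> ring
    calc m u * X * n u = Γ u * (star u * X * star u) * Γ u := by simp only [hm, hn, mul_assoc]
      _ = (2 * dot u X) • (Γ u * star u * Γ u) -
          Quaternion.normSq u • (Γ u * star X * Γ u) := by
        rw [e1]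
        simp only [mul_sub, sub_mul, mul_smul_comm, smul_mul_assoc]
      _ = _ := by
        rw [e2, h1, h2]
        simp only [smul_sub, smul_smul]
        congr 2
        · congr 1
          ring
        · congr 1
          ring
  -- the trace form recovers `m ⊗ n` from the maps `X ↦ m X n`
  have tensor : ∀ Y : ℍ[ℝ], ∃ S : ℍ[ℝ] → ℍ[ℝ], IsPolyMap S ∧
      ∀ u, (m u * Y).re • n u = Quaternion.normSq u • S u := by
    intro Y
    have hY : ∀ Z : ℍ[ℝ], IsPolyMap fun _ : ℍ[ℝ] => Z := fun Z =>
      ⟨IsPoly.const _, IsPoly.const _, IsPoly.const _, IsPoly.const _⟩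
    obtain ⟨T0, q0, f0⟩ := key Y
    obtain ⟨T1, q1, f1⟩ := key (Y * ofCoords 0 1 0 0)
    obtain ⟨T2, q2, f2⟩ := key (Y * ofCoords 0 0 1 0)
    obtain ⟨T3, q3, f3⟩ := key (Y * ofCoords 0 0 0 1)
    refine ⟨fun u => (1 / 4 : ℝ) • (T0 u - ofCoords 0 1 0 0 * T1 u - ofCoords 0 0 1 0 * T2 u -
      ofCoords 0 0 0 1 * T3 u), IsPolyMap.smul (IsPoly.const _)
        (((q0.sub ((hY _).mul q1)).sub ((hY _).mul q2)).sub ((hY _).mul q3)), fun u => ?_⟩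
    have e : ∀ a b : ℍ[ℝ], a.re • b = (1 / 4 : ℝ) • (a * b - ofCoords 0 1 0 0 * (a *
        ofCoords 0 1 0 0 * b) - ofCoords 0 0 1 0 * (a * ofCoords 0 0 1 0 * b) -
        ofCoords 0 0 0 1 * (a * ofCoords 0 0 0 1 * b)) := by
      intro a b
      ext <;> simp <;> ring
    rw [e, show m u * Y * n u = Quaternion.normSq u • T0 u from f0 u,
      show m u * Y * ofCoords 0 1 0 0 * n u = Quaternion.normSq u • T1 u by rw [← f1, mul_assoc (m u)],
      show m u * Y * ofCoords 0 0 1 0 * n u = Quaternion.normSq u • T2 u by rw [← f2, mul_assoc (m u)],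
      show m u * Y * ofCoords 0 0 0 1 * n u = Quaternion.normSq u • T3 u by rw [← f3, mul_assoc (m u)]]
    simp only [mul_smul_comm, ← smul_sub]
    rw [smul_comm]
  -- All products of a component of m with a component of n are divisible by a prime. So either
  -- every component of n is divisible, or every component of m is, the latter being read off from Y
  -- = 1, i, j, k.
  have comp : ∀ Y : ℍ[ℝ], (∃ k, IsPoly k ∧ ∀ u, (m u * Y).re = Quaternion.normSq u * k u) ∨
      ((∃ k, IsPoly k ∧ ∀ u, (n u).re = Quaternion.normSq u * k u) ∧
      (∃ k, IsPoly k ∧ ∀ u, (n u).imI = Quaternion.normSq u * k u) ∧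
      (∃ k, IsPoly k ∧ ∀ u, (n u).imJ = Quaternion.normSq u * k u) ∧
      ∃ k, IsPoly k ∧ ∀ u, (n u).imK = Quaternion.normSq u * k u) := by
    intro Y
    obtain ⟨S, hS, h⟩ := tensor Y
    have hY : IsPolyMap fun _ : ℍ[ℝ] => Y :=
      ⟨IsPoly.const _, IsPoly.const _, IsPoly.const _, IsPoly.const _⟩
    have pmY := (pm.mul hY).re
    rcases pmY.dvd_or_dvd pn.re hS.re (fun u => by simpa using congrArg (fun x : ℍ[ℝ] => x.re) (h u))
      with h' | a0
    · exact Or.inl h'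
    rcases pmY.dvd_or_dvd pn.imI hS.imI
      (fun u => by simpa using congrArg (fun x : ℍ[ℝ] => x.imI) (h u)) with h' | a1
    · exact Or.inl h'
    rcases pmY.dvd_or_dvd pn.imJ hS.imJ
      (fun u => by simpa using congrArg (fun x : ℍ[ℝ] => x.imJ) (h u)) with h' | a2
    · exact Or.inl h'
    rcases pmY.dvd_or_dvd pn.imK hS.imK
      (fun u => by simpa using congrArg (fun x : ℍ[ℝ] => x.imK) (h u)) with h' | a3
    · exact Or.inl h'
    exact Or.inr ⟨a0, a1, a2, a3⟩
  have right : ((∃ k, IsPoly k ∧ ∀ u, (n u).re = Quaternion.normSq u * k u) ∧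
      (∃ k, IsPoly k ∧ ∀ u, (n u).imI = Quaternion.normSq u * k u) ∧
      (∃ k, IsPoly k ∧ ∀ u, (n u).imJ = Quaternion.normSq u * k u) ∧
      ∃ k, IsPoly k ∧ ∀ u, (n u).imK = Quaternion.normSq u * k u) →
      ∃ A : ℍ[ℝ] →L[ℝ] ℍ[ℝ], ∀ u, Γ u = u * A u := by
    rintro ⟨a0, a1, a2, a3⟩
    obtain ⟨A, hA⟩ := exists_linear_of_normSq_dvd (M := n) (by
      intro c u
      simp only [hn, hom, Quaternion.star_smul, smul_mul_assoc, mul_smul_comm, smul_smul]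
      congr 1) a0 a1 a2 a3
    refine ⟨A, fun u => ?_⟩
    rcases eq_or_ne u 0 with rfl | hu
    · simpa using hom 0 0
    · have hq : Quaternion.normSq u ≠ 0 := by simpa using hu
      refine smul_right_injective _ hq ?_
      simp only
      rw [← mul_smul_comm, ← hA, hn]
      simp only
      rw [← mul_assoc, Quaternion.self_mul_star, Quaternion.coe_mul_eq_smul]
  rcases comp 1 with b0 | h
  · rcases comp (ofCoords 0 1 0 0) with b1 | h
    · rcases comp (ofCoords 0 0 1 0) with b2 | h
      · rcases comp (ofCoords 0 0 0 1) with b3 | h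
        · left
          have neg : ∀ {f : ℍ[ℝ] → ℝ}, (∃ k, IsPoly k ∧ ∀ u, -f u = Quaternion.normSq u * k u) →
              ∃ k, IsPoly k ∧ ∀ u, f u = Quaternion.normSq u * k u := by
            rintro f ⟨k, hk, h⟩
            exact ⟨fun u => -k u, hk.neg, fun u => by linear_combination -h u⟩
          obtain ⟨A, hA⟩ := exists_linear_of_normSq_dvd (M := m) (by
            intro c u
            simp only [hm, hom, Quaternion.star_smul, smul_mul_assoc, mul_smul_comm, smul_smul]
            congr 1
            ring) (by simpa only [mul_one] using b0)
              (neg (by simpa using b1)) (neg (by simpa using b2)) (neg (by simpa using b3))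
          refine ⟨A, fun u => ?_⟩
          rcases eq_or_ne u 0 with rfl | hu
          · simpa using hom 0 0
          · have hq : Quaternion.normSq u ≠ 0 := by simpa using hu
            refine smul_right_injective _ hq ?_
            simp only
            rw [← smul_mul_assoc, ← hA, hm]
            simp only
            rw [mul_assoc, Quaternion.star_mul_self, Quaternion.mul_coe_eq_smul]
        · exact Or.inr (right h)
      · exact Or.inr (right h)
    · exact Or.inr (right h)
  · exact Or.inr (right h)

/-! ### Derivatives along lines -/

section Lines

variable {D E F : Type*} [NormedAddCommGroup D] [NormedSpace ℝ D] [NormedAddCommGroup E]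
  [NormedSpace ℝ E] [NormedAddCommGroup F] [NormedSpace ℝ F]

theorem hasDerivAt_line {G : D → E} {x z : D} {t : ℝ}
    (h : DifferentiableAt ℝ G (x + t • z)) :
    HasDerivAt (fun t : ℝ => G (x + t • z)) (fderiv ℝ G (x + t • z) z) t := by
  have h1 : HasDerivAt (fun t : ℝ => x + t • z) z t := by
    simpa using ((hasDerivAt_id t).smul_const z).const_add x
  exact h.hasFDerivAt.comp_hasDerivAt t h1

theorem hasDerivAt_line_zero {G : D → E} {x : D} (h : DifferentiableAt ℝ G x) (z : D) :
    HasDerivAt (fun t : ℝ => G (x + t • z)) (fderiv ℝ G x z) 0 := by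
  have := hasDerivAt_line (G := G) (x := x) (z := z) (t := 0) (by simpa using h)
  simpa using this

theorem hasDerivAt_line_apply {G : D → E →L[ℝ] F} {x z : D} {t : ℝ}
    (h : DifferentiableAt ℝ G (x + t • z)) (w : E) :
    HasDerivAt (fun t : ℝ => G (x + t • z) w) (fderiv ℝ G (x + t • z) z w) t := by
  simpa using (hasDerivAt_line h).clm_apply (hasDerivAt_const t w)

theorem hasDerivAt_line_apply_zero {G : D → E →L[ℝ] F} {x : D} (h : DifferentiableAt ℝ G x)
    (z : D) (w : E) :
    HasDerivAt (fun t : ℝ => G (x + t • z) w) (fderiv ℝ G x z w) 0 := by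
  simpa using (hasDerivAt_line_zero h z).clm_apply (hasDerivAt_const (0 : ℝ) w)

theorem eventually_line {p : D → Prop} {x : D} (h : ∀ᶠ y in 𝓝 x, p y) (z : D) :
    ∀ᶠ t : ℝ in 𝓝 0, p (x + t • z) := by
  have hc : Continuous fun t : ℝ => x + t • z := by fun_prop
  have := hc.tendsto 0
  simp only [zero_smul, add_zero] at this
  exact this.eventually h

end Lines

theorem dot_eq_inner (a b : ℍ[ℝ]) : dot a b = inner ℝ a b := by
  rw [Quaternion.inner_def]
  simp [dot]

theorem hasDerivAt_dot {a b : ℝ → ℍ[ℝ]} {a' b' : ℍ[ℝ]} {t : ℝ} (ha : HasDerivAt a a' t)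
    (hb : HasDerivAt b b' t) :
    HasDerivAt (fun t => dot (a t) (b t)) (dot a' (b t) + dot (a t) b') t := by
  simp only [dot_eq_inner]
  rw [add_comm]
  exact ha.inner ℝ hb

/-- The difference quotients lie in `W`, and a finite-dimensional subspace is closed. -/
theorem hasDerivAt_mem {V : Type*} [NormedAddCommGroup V] [NormedSpace ℝ V]
    [FiniteDimensional ℝ V] {W : Submodule ℝ V} {c : ℝ → V} {c' : V} {t : ℝ}
    (h : HasDerivAt c c' t) (hW : ∀ᶠ s in 𝓝 t, c s ∈ W) : c' ∈ W := by
  refine W.closed_of_finiteDimensional.mem_of_tendsto (hasDerivAt_iff_tendsto_slope.1 h) ?_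
  filter_upwards [hW.filter_mono nhdsWithin_le_nhds] with s hs
  exact W.smul_mem _ (W.sub_mem hs hW.self_of_nhds)

/-! ### The differential equation of circles -/

/-- The point of the light cone over the point `q` of the four-dimensional Euclidean space. -/
def lightLift (q : ℍ[ℝ]) : ℍ[ℝ] × ℝ × ℝ := (q, dot q q, 1)

/-- On the light cone of ℝ⁶ a circle is a section by a three-dimensional subspace. The lift of γ and
its first three derivatives lie in it, and four vectors there are linearly dependent. -/
theorem circle_equation {γ γ1 γ2 : ℝ → ℍ[ℝ]} {c3 : ℍ[ℝ]}
    (h1 : ∀ᶠ t in 𝓝 0, HasDerivAt γ (γ1 t) t) (h2 : ∀ᶠ t in 𝓝 0, HasDerivAt γ1 (γ2 t) t)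
    (h3 : HasDerivAt γ2 c3 0) (W : Submodule ℝ (ℍ[ℝ] × ℝ × ℝ)) (hW : Module.finrank ℝ W ≤ 3)
    (hγ : ∀ᶠ t in 𝓝 (0 : ℝ), lightLift (γ t) ∈ W) :
    ∃ κ : ℝ, Quaternion.normSq (γ1 0) • c3 - (3 * dot (γ1 0) (γ2 0)) • γ2 0 = κ • γ1 0 := by
  have m1 : ∀ᶠ t in 𝓝 (0 : ℝ), ((γ1 t, 2 * dot (γ t) (γ1 t), 0) : ℍ[ℝ] × ℝ × ℝ) ∈ W := by
    filter_upwards [h1, hγ.eventually_nhds] with t ht hm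
    have hd : HasDerivAt (fun t => lightLift (γ t)) (γ1 t, 2 * dot (γ t) (γ1 t), 0) t := by
      have := hasDerivAt_dot ht ht
      rw [dot_comm, ← two_mul] at this
      exact ht.prodMk (this.prodMk (hasDerivAt_const t 1))
    exact hasDerivAt_mem hd hm
  have m2 : ∀ᶠ t in 𝓝 (0 : ℝ), ((γ2 t, 2 * (dot (γ1 t) (γ1 t) + dot (γ t) (γ2 t)), 0) :
      ℍ[ℝ] × ℝ × ℝ) ∈ W := by
    filter_upwards [h1, h2, m1.eventually_nhds] with t ht ht2 hm
    exact hasDerivAt_mem (ht2.prodMk (((hasDerivAt_dot ht ht2).const_mul 2).prodMk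
      (hasDerivAt_const t 0))) hm
  have m3 : ((c3, 2 * (dot (γ2 0) (γ1 0) + dot (γ1 0) (γ2 0) + (dot (γ1 0) (γ2 0) + dot (γ 0) c3)),
      0) : ℍ[ℝ] × ℝ × ℝ) ∈ W := by
    have ht := h1.self_of_nhds
    have ht2 := h2.self_of_nhds
    exact hasDerivAt_mem (h3.prodMk ((((hasDerivAt_dot ht2 ht2).add
      (hasDerivAt_dot ht h3)).const_mul 2).prodMk (hasDerivAt_const 0 0))) m2
  have hdep : ¬ LinearIndependent ℝ (![⟨_, hγ.self_of_nhds⟩, ⟨_, m1.self_of_nhds⟩,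
      ⟨_, m2.self_of_nhds⟩, ⟨_, m3⟩] : Fin 4 → W) := by
    intro hli
    have := hli.fintype_card_le_finrank
    simp at this
    omega
  rw [Fintype.not_linearIndependent_iff] at hdep
  obtain ⟨c, hc, hne⟩ := hdep
  simp only [Fin.sum_univ_four, Subtype.ext_iff] at hc
  simp [lightLift] at hc
  obtain ⟨e1, e2, e3⟩ := hc
  rw [e3, zero_smul, zero_add] at e1
  rw [e3, zero_mul, zero_add] at e2
  have e4 := congrArg (dot (γ 0)) e1
  simp only [dot_add_right, dot_smul_right] at e4
  rw [show dot (γ 0) 0 = 0 by simp [dot]] at e4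
  have hsym : dot (γ2 0) (γ1 0) = dot (γ1 0) (γ2 0) := dot_comm _ _
  -- The last coordinate has already given c 0 = 0. Subtracting 2⟨γ, ·⟩ of the quaternionic relation
  -- from the relation for |γ|² cancels all terms containing γ itself.
  have e5 : c 2 * dot (γ1 0) (γ1 0) + 3 * c 3 * dot (γ1 0) (γ2 0) = 0 := by
    rw [hsym] at e2
    linear_combination (1 / 2) * e2 - e4
  by_cases hz : γ1 0 = 0
  · exact ⟨0, by simp [hz, dot]⟩
  have hq : Quaternion.normSq (γ1 0) ≠ 0 := by simpa using hz
  rw [dot_self] at e5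
  have h3' : c 3 ≠ 0 := by
    intro h
    rw [h] at e5 e1
    have h2' : c 2 = 0 := by
      have : c 2 * Quaternion.normSq (γ1 0) = 0 := by linear_combination e5
      exact (mul_eq_zero.1 this).resolve_right hq
    rw [h2'] at e1
    have h1' : c 1 = 0 := by simpa [hz] using e1
    obtain ⟨i, hi⟩ := hne
    fin_cases i <;> simp_all
  refine ⟨-(c 1 * Quaternion.normSq (γ1 0) / c 3), ?_⟩
  have e6 : 3 * dot (γ1 0) (γ2 0) = -(c 2 * Quaternion.normSq (γ1 0) / c 3) := by
    field_simp
    linear_combination e5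
  have e7 : c3 = -((c 1 / c 3) • γ1 0 + (c 2 / c 3) • γ2 0) := by
    have := congrArg (fun x => (c 3)⁻¹ • x) e1
    simp only [smul_add, smul_smul, smul_zero, inv_mul_cancel₀ h3', one_smul] at this
    rw [eq_neg_iff_add_eq_zero, ← this]
    simp only [div_eq_inv_mul]
    abel
  rw [e6, e7]
  module

/-! ### The second derivative is a left or right multiplication -/

/-- The linear map that interpolates given values at the vectors of a basis of the quaternions. -/
def interpolate {E : Type*} [NormedAddCommGroup E] [NormedSpace ℝ E] (a : ℍ[ℝ] → E) :
    ℍ[ℝ] →L[ℝ] E :=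
  ∑ i, ContinuousLinearMap.smulRightL ℝ ℍ[ℝ] E (LinearMap.toContinuousLinearMap
    ((Module.finBasis ℝ ℍ[ℝ]).coord i)) (a (Module.finBasis ℝ ℍ[ℝ] i))

section

variable {E : Type*} [NormedAddCommGroup E] [NormedSpace ℝ E]

/-- Linear coefficients appear below as quotients with a denominator that vanishes at v = 0. Their
values on a basis, where the quotient makes sense, recover the linear map by a formula whose smooth
dependence on the base point is visible (`contDiffAt_interpolate`). -/
theorem interpolate_eq {a : ℍ[ℝ] → E} {L : ℍ[ℝ] →L[ℝ] E} (h : ∀ v, v ≠ 0 → a v = L v) :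
    interpolate a = L := by
  ext1 v
  conv_rhs => rw [← (Module.finBasis ℝ ℍ[ℝ]).sum_repr v]
  simp only [interpolate, _root_.sum_apply, map_sum, map_smul]
  refine Finset.sum_congr rfl fun i _ => ?_
  rw [h _ ((Module.finBasis ℝ ℍ[ℝ]).ne_zero i)]
  rfl

theorem contDiffAt_interpolate {D : Type*} [NormedAddCommGroup D] [NormedSpace ℝ D]
    {a : D → ℍ[ℝ] → E} {x : D} {n : ℕ∞ω}
    (h : ∀ v, v ≠ 0 → ContDiffAt ℝ n (fun y => a y v) x) :
    ContDiffAt ℝ n (fun y => interpolate (a y)) x := by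
  refine ContDiffAt.sum fun i _ => ?_
  exact (ContinuousLinearMap.contDiff _).contDiffAt.comp x
    (h _ ((Module.finBasis ℝ ℍ[ℝ]).ne_zero i))

end

theorem two_le_smoothness : minSmoothness ℝ 2 ≤ ∞ := by
  rw [minSmoothness_of_isRCLikeNormedField]
  exact WithTop.coe_le_coe.2 (le_top : (2 : ℕ∞) ≤ ⊤)

/-- Conjugation of quaternions as a continuous linear map. -/
def starL : ℍ[ℝ] →L[ℝ] ℍ[ℝ] :=
  LinearMap.toContinuousLinearMap ⟨⟨fun v => star v, star_add⟩, fun c v => by simp⟩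

@[simp] theorem starL_apply (v : ℍ[ℝ]) : starL v = star v := rfl

theorem contDiffAt_quaternion_inv {D : Type*} [NormedAddCommGroup D] [NormedSpace ℝ D]
    {G : D → ℍ[ℝ]} {x : D} {n : ℕ∞ω} (h : ContDiffAt ℝ n G x) (h0 : G x ≠ 0) :
    ContDiffAt ℝ n (fun y => (G y)⁻¹) x := by
  have e : (fun y => (G y)⁻¹) = fun y => (inner ℝ (G y) (G y))⁻¹ • starL (G y) := by
    ext1 y
    rw [Quaternion.inner_self]
    rfl
  rw [e]
  exact ((h.inner ℝ h).inv (by simpa [Quaternion.inner_self] using h0)).smul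
    (starL.contDiff.contDiffAt.comp x h)

/-- Smooth local diffeomorphisms satisfying the differential equation of circles along all
lines. -/
structure CircleMap (g : ℍ[ℝ] → ℍ[ℝ]) (Ω : Set ℍ[ℝ]) : Prop where
  isOpen : IsOpen Ω
  smooth : ∀ x ∈ Ω, ContDiffAt ℝ ∞ g x
  inj : ∀ x ∈ Ω, Function.Injective (fderiv ℝ g x)
  circle : ∀ x ∈ Ω, ∀ v, ∃ κ : ℝ, Quaternion.normSq (fderiv ℝ g x v) •
    fderiv ℝ (fderiv ℝ (fderiv ℝ g)) x v v v -
      (3 * dot (fderiv ℝ g x v) (fderiv ℝ (fderiv ℝ g) x v v)) • fderiv ℝ (fderiv ℝ g) x v v =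
      κ • fderiv ℝ g x v

namespace CircleMap

variable {g : ℍ[ℝ] → ℍ[ℝ]} {Ω : Set ℍ[ℝ]}

theorem mono (h : CircleMap g Ω) {Ω' : Set ℍ[ℝ]} (hΩ : IsOpen Ω') (hs : Ω' ⊆ Ω) :
    CircleMap g Ω' :=
  ⟨hΩ, fun x hx => h.smooth x (hs hx), fun x hx => h.inj x (hs hx),
    fun x hx => h.circle x (hs hx)⟩

theorem smooth1 (h : CircleMap g Ω) {x : ℍ[ℝ]} (hx : x ∈ Ω) : ContDiffAt ℝ ∞ (fderiv ℝ g) x :=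
  (h.smooth x hx).fderiv_right (by simp)

theorem smooth2 (h : CircleMap g Ω) {x : ℍ[ℝ]} (hx : x ∈ Ω) :
    ContDiffAt ℝ ∞ (fderiv ℝ (fderiv ℝ g)) x :=
  (h.smooth1 hx).fderiv_right (by simp)

theorem eventually (h : CircleMap g Ω) {x : ℍ[ℝ]} (hx : x ∈ Ω) : ∀ᶠ y in 𝓝 x, y ∈ Ω :=
  h.isOpen.mem_nhds hx

theorem hasDerivAt_g1 (h : CircleMap g Ω) {x : ℍ[ℝ]} (hx : x ∈ Ω) (z v : ℍ[ℝ]) :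
    HasDerivAt (fun t : ℝ => fderiv ℝ g (x + t • z) v) (fderiv ℝ (fderiv ℝ g) x z v) 0 :=
  hasDerivAt_line_apply_zero ((h.smooth1 hx).differentiableAt (by simp)) z v

theorem hasDerivAt_g2 (h : CircleMap g Ω) {x : ℍ[ℝ]} (hx : x ∈ Ω) (z v w : ℍ[ℝ]) :
    HasDerivAt (fun t : ℝ => fderiv ℝ (fderiv ℝ g) (x + t • z) v w)
      (fderiv ℝ (fderiv ℝ (fderiv ℝ g)) x z v w) 0 := by
  simpa using (hasDerivAt_line_apply_zero ((h.smooth2 hx).differentiableAt (by simp)) z v).clm_apply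
    (hasDerivAt_const (0 : ℝ) w)

theorem symm2 (h : CircleMap g Ω) {x : ℍ[ℝ]} (hx : x ∈ Ω) (v w : ℍ[ℝ]) :
    fderiv ℝ (fderiv ℝ g) x v w = fderiv ℝ (fderiv ℝ g) x w v :=
  (h.smooth x hx).isSymmSndFDerivAt two_le_smoothness v w

theorem symm3 (h : CircleMap g Ω) {x : ℍ[ℝ]} (hx : x ∈ Ω) (u v w : ℍ[ℝ]) :
    fderiv ℝ (fderiv ℝ (fderiv ℝ g)) x u v w = fderiv ℝ (fderiv ℝ (fderiv ℝ g)) x v u w :=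
  congrArg (fun L : ℍ[ℝ] →L[ℝ] ℍ[ℝ] => L w) ((h.smooth1 hx).isSymmSndFDerivAt
    two_le_smoothness u v)

/-- The derivative as a linear isomorphism. -/
theorem exists_equiv (h : CircleMap g Ω) {x : ℍ[ℝ]} (hx : x ∈ Ω) :
    ∃ e : ℍ[ℝ] ≃L[ℝ] ℍ[ℝ], ∀ v, e v = fderiv ℝ g x v :=
  ⟨(LinearEquiv.ofInjectiveEndo (fderiv ℝ g x : ℍ[ℝ] →ₗ[ℝ] ℍ[ℝ])
    (h.inj x hx)).toContinuousLinearEquiv, fun _ => rfl⟩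

theorem fderiv_ne_zero (h : CircleMap g Ω) {x : ℍ[ℝ]} (hx : x ∈ Ω) {v : ℍ[ℝ]} (hv : v ≠ 0) :
    fderiv ℝ g x v ≠ 0 := fun h0 => hv (h.inj x hx (by rw [h0, map_zero]))

/-- The variable is changed from v to u = Dg(v), so that the speed in the circle equation becomes
the standard form |u|² and `circle_condition_dvd` applies. -/
theorem dvd (h : CircleMap g Ω) {x : ℍ[ℝ]} (hx : x ∈ Ω) (e : ℍ[ℝ] ≃L[ℝ] ℍ[ℝ])
    (he : ∀ v, e v = fderiv ℝ g x v) :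
    (∃ k, IsPoly k ∧ ∀ u, dot u (fderiv ℝ (fderiv ℝ g) x (e.symm u) (e.symm u)) =
      Quaternion.normSq u * k u) ∧
    ∃ k, IsPoly k ∧ ∀ u, dot u (fderiv ℝ (fderiv ℝ (fderiv ℝ g)) x (e.symm u) (e.symm u)
      (e.symm u)) = Quaternion.normSq u * k u := by
  have hes : ∀ u, fderiv ℝ g x (e.symm u) = u := fun u => by rw [← he, e.apply_symm_apply]
  refine circle_condition_dvd ?_ ?_ fun u => ?_
  · exact IsPolyMap.diag (fun a b => fderiv ℝ (fderiv ℝ g) x (e.symm a) (e.symm b))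
      (by simp) (by simp) fun a => IsPolyMap.of_linear
        ((fderiv ℝ (fderiv ℝ g) x (e.symm a)).comp (e.symm : ℍ[ℝ] →L[ℝ] ℍ[ℝ]))
  · refine IsPolyMap.diag (fun a b => fderiv ℝ (fderiv ℝ (fderiv ℝ g)) x (e.symm a) (e.symm b)
      (e.symm b)) (by simp) (by simp) fun a => ?_
    exact IsPolyMap.diag (fun c b => fderiv ℝ (fderiv ℝ (fderiv ℝ g)) x (e.symm a) (e.symm c)
      (e.symm b)) (by simp) (by simp) fun c => IsPolyMap.of_linear
        ((fderiv ℝ (fderiv ℝ (fderiv ℝ g)) x (e.symm a) (e.symm c)).comp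
          (e.symm : ℍ[ℝ] →L[ℝ] ℍ[ℝ]))
  · simpa only [hes] using h.circle x hx (e.symm u)

/-- The tangential part of the second derivative is a linear form, and this form is smooth. -/
theorem exists_tangential_form (h : CircleMap g Ω) : ∃ Λ : ℍ[ℝ] → ℍ[ℝ] →L[ℝ] ℝ,
    (∀ x ∈ Ω, ContDiffAt ℝ ∞ Λ x) ∧ ∀ x ∈ Ω, ∀ v,
      dot (fderiv ℝ g x v) (fderiv ℝ (fderiv ℝ g) x v v) =
        Λ x v * dot (fderiv ℝ g x v) (fderiv ℝ g x v) := by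
  set a : ℍ[ℝ] → ℍ[ℝ] → ℝ := fun x v => dot (fderiv ℝ g x v) (fderiv ℝ (fderiv ℝ g) x v v) /
    dot (fderiv ℝ g x v) (fderiv ℝ g x v) with ha
  have hq : ∀ x ∈ Ω, ∀ v, v ≠ 0 → dot (fderiv ℝ g x v) (fderiv ℝ g x v) ≠ 0 := by
    intro x hx v hv
    rw [dot_self]
    simpa using h.fderiv_ne_zero hx hv
  refine ⟨fun x => interpolate (a x), fun x hx => contDiffAt_interpolate fun v hv => ?_, ?_⟩
  · have s1 : ContDiffAt ℝ ∞ (fun y => fderiv ℝ g y v) x := (h.smooth1 hx).clm_apply contDiffAt_const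
    have s2 : ContDiffAt ℝ ∞ (fun y => fderiv ℝ (fderiv ℝ g) y v v) x :=
      ((h.smooth2 hx).clm_apply contDiffAt_const).clm_apply contDiffAt_const
    simp only [ha, dot_eq_inner]
    refine (s1.inner ℝ s2).div (s1.inner ℝ s1) ?_
    rw [← dot_eq_inner]
    exact hq x hx v hv
  · intro x hx
    obtain ⟨e, he⟩ := h.exists_equiv hx
    obtain ⟨⟨k, hk, h1⟩, -⟩ := h.dvd hx e he
    obtain ⟨L, hL⟩ := exists_linear_of_homogeneous hk.differentiable (by
      intro c u hc hu
      have h2 := h1 (c • u)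
      simp only [map_smul, _root_.smul_apply, dot_smul_left, dot_smul_right, h1,
        Quaternion.normSq_smul] at h2
      have h3 : c ^ 2 * Quaternion.normSq u ≠ 0 :=
        mul_ne_zero (pow_ne_zero _ hc) (by simpa using hu)
      refine mul_left_cancel₀ h3 ?_
      rw [smul_eq_mul]
      linear_combination -h2)
    have h4 : ∀ v, dot (fderiv ℝ g x v) (fderiv ℝ (fderiv ℝ g) x v v) =
        (L.comp (e : ℍ[ℝ] →L[ℝ] ℍ[ℝ])) v * dot (fderiv ℝ g x v) (fderiv ℝ g x v) := by
      intro v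
      have := h1 (e v)
      rw [e.symm_apply_apply, hL, he, ← dot_self] at this
      rw [this, mul_comm]
      simp [he]
    intro v
    change _ = interpolate (a x) v * _
    rw [interpolate_eq (L := L.comp (e : ℍ[ℝ] →L[ℝ] ℍ[ℝ])) fun v hv => by
      simp only [ha]
      rw [h4 v, mul_div_assoc, div_self (hq x hx v hv), mul_one]]
    exact h4 v

/-- Differentiating ⟨g', g''⟩ = Λ|g'|² along the line expresses |g''|² + ⟨g', g'''⟩ through
multiples of |g'|² and of ⟨g', g''⟩. Since |u|² divides ⟨u, Γ⟩ and ⟨u, C⟩, it divides |Γ|², which is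
what the factorization still needs. -/
theorem left_or_right_at (h : CircleMap g Ω) {x : ℍ[ℝ]} (hx : x ∈ Ω) :
    (∃ A : ℍ[ℝ] →L[ℝ] ℍ[ℝ], ∀ v, fderiv ℝ (fderiv ℝ g) x v v = A v * fderiv ℝ g x v) ∨
      ∃ A : ℍ[ℝ] →L[ℝ] ℍ[ℝ], ∀ v, fderiv ℝ (fderiv ℝ g) x v v = fderiv ℝ g x v * A v := by
  obtain ⟨e, he⟩ := h.exists_equiv hx
  obtain ⟨⟨k, hk, h1⟩, m, hm, h2⟩ := h.dvd hx e he
  obtain ⟨Λ, hΛ, h3⟩ := h.exists_tangential_form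
  have hes : ∀ u, fderiv ℝ g x (e.symm u) = u := fun u => by rw [← he, e.apply_symm_apply]
  have h4 : ∀ v, dot (fderiv ℝ (fderiv ℝ g) x v v) (fderiv ℝ (fderiv ℝ g) x v v) +
      dot (fderiv ℝ g x v) (fderiv ℝ (fderiv ℝ (fderiv ℝ g)) x v v v) =
      fderiv ℝ Λ x v v * dot (fderiv ℝ g x v) (fderiv ℝ g x v) +
        Λ x v * (2 * dot (fderiv ℝ g x v) (fderiv ℝ (fderiv ℝ g) x v v)) := by
    intro v
    have d1 := hasDerivAt_dot (h.hasDerivAt_g1 hx v v) (h.hasDerivAt_g2 hx v v v)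
    have d2 := (hasDerivAt_line_apply_zero ((hΛ x hx).differentiableAt (by simp)) v v).mul
      (hasDerivAt_dot (h.hasDerivAt_g1 hx v v) (h.hasDerivAt_g1 hx v v))
    have d3 := d1.congr_of_eventuallyEq (f₁ := fun t : ℝ => Λ (x + t • v) v *
      dot (fderiv ℝ g (x + t • v) v) (fderiv ℝ g (x + t • v) v)) (by
        filter_upwards [eventually_line (h.eventually hx) v] with t ht
        exact (h3 _ ht v).symm)
    have := d3.unique d2
    simp only [zero_smul, add_zero] at this
    rw [this, dot_comm (fderiv ℝ (fderiv ℝ g) x v v)]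
    ring
  have hpoly : IsPolyMap fun u => fderiv ℝ (fderiv ℝ g) x (e.symm u) (e.symm u) :=
    IsPolyMap.diag (fun a b => fderiv ℝ (fderiv ℝ g) x (e.symm a) (e.symm b))
      (by simp) (by simp) fun a => IsPolyMap.of_linear
        ((fderiv ℝ (fderiv ℝ g) x (e.symm a)).comp (e.symm : ℍ[ℝ] →L[ℝ] ℍ[ℝ]))
  have hΛ1 : IsPoly fun u => Λ x (e.symm u) := IsPoly.of_linear _ (by simp) (by simp)
  have hΛ2 : IsPoly fun u => fderiv ℝ Λ x (e.symm u) (e.symm u) :=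
    IsPoly.diag (fun a b => fderiv ℝ Λ x (e.symm a) (e.symm b)) (by simp) (by simp) fun a =>
      IsPoly.of_linear _ (by simp) (by simp)
  rcases exists_left_or_right_factor hpoly (by
    intro c u
    simp only [map_smul, _root_.smul_apply, smul_smul, sq]) ⟨k, hk, h1⟩
    ⟨fun u => fderiv ℝ Λ x (e.symm u) (e.symm u) + 2 * Λ x (e.symm u) * k u - m u,
      (hΛ2.add (((IsPoly.const 2).mul hΛ1).mul hk)).sub hm, fun u => by
        have := h4 (e.symm u)
        rw [hes, h1, h2, dot_self u] at this
        linear_combination this⟩ with ⟨A, hA⟩ | ⟨A, hA⟩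
  · refine Or.inl ⟨A.comp (e : ℍ[ℝ] →L[ℝ] ℍ[ℝ]), fun v => ?_⟩
    have := hA (e v)
    rw [e.symm_apply_apply] at this
    rw [this, ← he]
    rfl
  · refine Or.inr ⟨A.comp (e : ℍ[ℝ] →L[ℝ] ℍ[ℝ]), fun v => ?_⟩
    have := hA (e v)
    rw [e.symm_apply_apply] at this
    rw [this, ← he]
    rfl

end CircleMap

/-- Circle maps with second derivative given by left multiplications. -/
structure LeftCircleMap (g : ℍ[ℝ] → ℍ[ℝ]) (A : ℍ[ℝ] → ℍ[ℝ] →L[ℝ] ℍ[ℝ]) (Ω : Set ℍ[ℝ]) : Prop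
    extends CircleMap g Ω where
  smoothA : ∀ x ∈ Ω, ContDiffAt ℝ ∞ A x
  left : ∀ x ∈ Ω, ∀ v, fderiv ℝ (fderiv ℝ g) x v v = A x v * fderiv ℝ g x v

namespace CircleMap

variable {g : ℍ[ℝ] → ℍ[ℝ]} {Ω : Set ℍ[ℝ]}

theorem fderiv_star_comp {D : Type*} [NormedAddCommGroup D] [NormedSpace ℝ D] {G : D → ℍ[ℝ]} {x : D}
    (h : DifferentiableAt ℝ G x) :
    fderiv ℝ (fun y => star (G y)) x = starL.comp (fderiv ℝ G x) :=
  (starL.hasFDerivAt.comp x h.hasFDerivAt).fderiv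

theorem star_fderiv1 (h : CircleMap g Ω) {x : ℍ[ℝ]} (hx : x ∈ Ω) :
    fderiv ℝ (fun y => star (g y)) x = starL.comp (fderiv ℝ g x) :=
  fderiv_star_comp ((h.smooth x hx).differentiableAt (by simp))

theorem star_fderiv2 (h : CircleMap g Ω) {x : ℍ[ℝ]} (hx : x ∈ Ω) (u v : ℍ[ℝ]) :
    fderiv ℝ (fderiv ℝ (fun y => star (g y))) x u v = star (fderiv ℝ (fderiv ℝ g) x u v) := by
  have e : fderiv ℝ (fun y => star (g y)) =ᶠ[𝓝 x]
      fun y => ContinuousLinearMap.compL ℝ ℍ[ℝ] ℍ[ℝ] ℍ[ℝ] starL (fderiv ℝ g y) := by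
    filter_upwards [h.eventually hx] with y hy using h.star_fderiv1 hy
  have hd : HasFDerivAt (fun y => ContinuousLinearMap.compL ℝ ℍ[ℝ] ℍ[ℝ] ℍ[ℝ] starL (fderiv ℝ g y))
      ((ContinuousLinearMap.compL ℝ ℍ[ℝ] ℍ[ℝ] ℍ[ℝ] starL).comp (fderiv ℝ (fderiv ℝ g) x)) x :=
    (ContinuousLinearMap.hasFDerivAt _).comp x
      ((h.smooth1 hx).differentiableAt (by simp)).hasFDerivAt
  rw [e.fderiv_eq, hd.fderiv]
  rfl

theorem star_fderiv3 (h : CircleMap g Ω) {x : ℍ[ℝ]} (hx : x ∈ Ω) (u v w : ℍ[ℝ]) :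
    fderiv ℝ (fderiv ℝ (fderiv ℝ (fun y => star (g y)))) x u v w =
      star (fderiv ℝ (fderiv ℝ (fderiv ℝ g)) x u v w) := by
  have e : fderiv ℝ (fderiv ℝ (fun y => star (g y))) =ᶠ[𝓝 x]
      fun y => ContinuousLinearMap.compL ℝ ℍ[ℝ] (ℍ[ℝ] →L[ℝ] ℍ[ℝ]) (ℍ[ℝ] →L[ℝ] ℍ[ℝ])
        (ContinuousLinearMap.compL ℝ ℍ[ℝ] ℍ[ℝ] ℍ[ℝ] starL) (fderiv ℝ (fderiv ℝ g) y) := by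
    filter_upwards [h.eventually hx] with y hy
    ext1 u
    ext1 v
    exact h.star_fderiv2 hy u v
  have hd : HasFDerivAt (fun y => ContinuousLinearMap.compL ℝ ℍ[ℝ] (ℍ[ℝ] →L[ℝ] ℍ[ℝ])
      (ℍ[ℝ] →L[ℝ] ℍ[ℝ]) (ContinuousLinearMap.compL ℝ ℍ[ℝ] ℍ[ℝ] ℍ[ℝ] starL)
        (fderiv ℝ (fderiv ℝ g) y))
      ((ContinuousLinearMap.compL ℝ ℍ[ℝ] (ℍ[ℝ] →L[ℝ] ℍ[ℝ]) (ℍ[ℝ] →L[ℝ] ℍ[ℝ])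
        (ContinuousLinearMap.compL ℝ ℍ[ℝ] ℍ[ℝ] ℍ[ℝ] starL)).comp
          (fderiv ℝ (fderiv ℝ (fderiv ℝ g)) x)) x :=
    (ContinuousLinearMap.hasFDerivAt _).comp x
      ((h.smooth2 hx).differentiableAt (by simp)).hasFDerivAt
  rw [e.fderiv_eq, hd.fderiv]
  rfl

/-- Conjugation is a linear isometry, so it respects the circle equation; it reverses products and
thus exchanges left and right factors. -/
theorem star (h : CircleMap g Ω) : CircleMap (fun y => star (g y)) Ω := by
  refine ⟨h.isOpen, fun x hx => starL.contDiff.contDiffAt.comp x (h.smooth x hx), ?_, ?_⟩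
  · intro x hx
    rw [h.star_fderiv1 hx]
    exact star_injective.comp (h.inj x hx)
  · intro x hx v
    obtain ⟨κ, hκ⟩ := h.circle x hx v
    refine ⟨κ, ?_⟩
    rw [h.star_fderiv1 hx, h.star_fderiv2 hx, h.star_fderiv3 hx]
    have hd : ∀ a b : ℍ[ℝ], dot (Star.star a) (Star.star b) = dot a b := by
      intro a b
      simp [dot]
    have := congrArg (fun q : ℍ[ℝ] => Star.star q) hκ
    simpa only [ContinuousLinearMap.comp_apply, starL_apply, hd, star_sub, Quaternion.star_smul,
      Quaternion.normSq_star] using this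

/-- The only candidate for a left factor, g''(g')⁻¹, is smooth after interpolation, so failure of
the left equation is an open condition. Either it never fails, or it fails on a non-empty open set,
where the factor must then be on the right at every point. -/
theorem left_or_right (h : CircleMap g Ω) (hne : Ω.Nonempty) :
    ∃ Ω' ⊆ Ω, Ω'.Nonempty ∧ ∃ A, LeftCircleMap g A Ω' ∨
      LeftCircleMap (fun y => Star.star (g y)) A Ω' := by
  set a : ℍ[ℝ] → ℍ[ℝ] → ℍ[ℝ] := fun x v =>
    fderiv ℝ (fderiv ℝ g) x v v * (fderiv ℝ g x v)⁻¹ with ha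
  set b : ℍ[ℝ] → ℍ[ℝ] → ℍ[ℝ] := fun x v =>
    Star.star ((fderiv ℝ g x v)⁻¹ * fderiv ℝ (fderiv ℝ g) x v v) with hb
  have s1 : ∀ x ∈ Ω, ∀ v, ContDiffAt ℝ ∞ (fun y => fderiv ℝ g y v) x :=
    fun x hx v => (h.smooth1 hx).clm_apply contDiffAt_const
  have s2 : ∀ x ∈ Ω, ∀ v, ContDiffAt ℝ ∞ (fun y => fderiv ℝ (fderiv ℝ g) y v v) x :=
    fun x hx v => ((h.smooth2 hx).clm_apply contDiffAt_const).clm_apply contDiffAt_const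
  have sA : ∀ x ∈ Ω, ContDiffAt ℝ ∞ (fun y => interpolate (a y)) x := fun x hx =>
    contDiffAt_interpolate fun v hv => (s2 x hx v).mul
      (contDiffAt_quaternion_inv (s1 x hx v) (h.fderiv_ne_zero hx hv))
  have sB : ∀ x ∈ Ω, ContDiffAt ℝ ∞ (fun y => interpolate (b y)) x := fun x hx =>
    contDiffAt_interpolate fun v hv => starL.contDiff.contDiffAt.comp x
      ((contDiffAt_quaternion_inv (s1 x hx v) (h.fderiv_ne_zero hx hv)).mul (s2 x hx v))
  by_cases hall : ∀ x ∈ Ω, ∀ v, fderiv ℝ (fderiv ℝ g) x v v = interpolate (a x) v * fderiv ℝ g x v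
  · exact ⟨Ω, Subset.rfl, hne, fun y => interpolate (a y), Or.inl ⟨h, sA, hall⟩⟩
  push Not at hall
  obtain ⟨x0, hx0, v, hv⟩ := hall
  have hev : ∀ᶠ x in 𝓝 x0, x ∈ Ω ∧
      fderiv ℝ (fderiv ℝ g) x v v ≠ interpolate (a x) v * fderiv ℝ g x v := by
    refine (h.eventually hx0).and (ContinuousAt.eventually_ne (g := fun x =>
      fderiv ℝ (fderiv ℝ g) x v v - interpolate (a x) v * fderiv ℝ g x v) ?_
      (sub_ne_zero.2 hv) |>.mono fun x hx => sub_ne_zero.1 hx)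
    exact ((s2 x0 hx0 v).sub (((sA x0 hx0).clm_apply contDiffAt_const).mul
      (s1 x0 hx0 v))).continuousAt
  obtain ⟨Ω', hΩ', ho, hm⟩ := eventually_nhds_iff.1 hev
  have hsub : Ω' ⊆ Ω := fun x hx => (hΩ' x hx).1
  refine ⟨Ω', hsub, ⟨x0, hm⟩, fun y => interpolate (b y), Or.inr
    ⟨h.star.mono ho hsub, fun x hx => sB x (hsub hx), fun x hx w => ?_⟩⟩
  have hxΩ := hsub hx
  rcases h.left_or_right_at hxΩ with ⟨A, hA⟩ | ⟨A, hA⟩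
  · refine absurd ?_ (hΩ' x hx).2
    rw [interpolate_eq (L := A) fun v hv => ?_, hA]
    simp only [ha]
    rw [hA, mul_assoc, mul_inv_cancel₀ (h.fderiv_ne_zero hxΩ hv), mul_one]
  · rw [interpolate_eq (L := starL.comp A) fun v hv => ?_, h.star_fderiv2 hxΩ,
      h.star_fderiv1 hxΩ, hA]
    · simp
    · simp only [hb]
      rw [hA, ← mul_assoc, inv_mul_cancel₀ (h.fderiv_ne_zero hxΩ hv), one_mul]
      rfl

end CircleMap

/-! ### Integrability conditions -/

/-- A quaternion that is a real number. -/
def IsRealQuat (a : ℍ[ℝ]) : Prop := a.imI = 0 ∧ a.imJ = 0 ∧ a.imK = 0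

/-- The solutions of the linear equation for the Schwarzian derivative. -/
theorem exists_schwarzian_coefficient {T : ℍ[ℝ] → ℍ[ℝ] → ℍ[ℝ]}
    (add_left : ∀ a b c, T (a + b) c = T a c + T b c)
    (add_right : ∀ a b c, T a (b + c) = T a b + T a c)
    (smul_left : ∀ (r : ℝ) a b, T (r • a) b = r • T a b)
    (smul_right : ∀ (r : ℝ) a b, T a (r • b) = r • T a b)
    (symm : ∀ u v w, T w v * u + T w u * v = T v w * u + T v u * w)
    (real : ∀ v, IsRealQuat (T v v)) :
    ∃ σ : ℝ, ∀ w u, T w u = σ • (2 * (w * star u) + u * star w) := by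
  have hR : ∀ v w, IsRealQuat (T v w + T w v) := by
    intro v w
    have h := real (v + w)
    have h1 := real v
    have h2 := real w
    simp only [IsRealQuat, add_left, add_right, Quaternion.imI_add, Quaternion.imJ_add,
      Quaternion.imK_add] at *
    obtain ⟨a, b, c⟩ := h
    obtain ⟨a1, b1, c1⟩ := h1
    obtain ⟨a2, b2, c2⟩ := h2
    exact ⟨by linear_combination a - a1 - a2, by linear_combination b - b1 - b2,
      by linear_combination c - c1 - c2⟩
  -- The symmetry relation with u = w gives 3T(v,w)w = T(w,w)v + (T(v,w) + T(w,v))w, where T(w,w)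
  -- and the sum in parentheses are real. Multiplication by w* on the right finishes.
  have key : ∀ v w, (3 * Quaternion.normSq w) • T v w =
      (T w w).re • (v * star w) + (Quaternion.normSq w * (T v w + T w v).re) • (1 : ℍ[ℝ]) := by
    intro v w
    have h := symm w v w
    have e1 : T w w = (T w w).re • (1 : ℍ[ℝ]) := by
      obtain ⟨a, b, c⟩ := real w
      ext <;> simp [a, b, c]
    have e2 : T v w + T w v = (T v w + T w v).re • (1 : ℍ[ℝ]) := by
      obtain ⟨a, b, c⟩ := hR v w
      ext
      · simp
      · rw [a]
        simp
      · rw [b]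
        simp
      · rw [c]
        simp
    have h3 : T v w * w + T v w * w + T v w * w = T w w * v + (T v w + T w v) * w := by
      rw [eq_sub_of_add_eq' h, add_mul]
      abel
    have h4 := congrArg (fun q => q * star w) h3
    have hw : w * star w = Quaternion.normSq w • (1 : ℍ[ℝ]) := by
      rw [Quaternion.self_mul_star, ← mul_one ((Quaternion.normSq w : ℝ) : ℍ[ℝ]),
        Quaternion.coe_mul_eq_smul]
    rw [e1, e2] at h4
    simp only [add_mul, mul_assoc, hw] at h4
    simp only [mul_smul_comm, smul_mul_assoc, mul_one, one_mul] at h4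
    rw [mul_smul, mul_smul, ← h4]
    module
  -- For non-real w the relation `key` is applied to (1, w) and to (w, 1). The imaginary parts of
  -- T(1,w) and T(w,1) cancel, which leaves (|w|²T(1,1) − T(w,w)) Im w = 0.
  have key1 : ∀ w, (T w w).re = (T 1 1).re * Quaternion.normSq w := by
    intro w
    by_cases hw : IsRealQuat w
    · obtain ⟨a, b, c⟩ := hw
      have : w = w.re • (1 : ℍ[ℝ]) := by ext <;> simp [a, b, c]
      have hq : Quaternion.normSq w = w.re * w.re := by
        rw [Quaternion.normSq_def', a, b, c]
        ring
      rw [hq]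
      conv_lhs => rw [this, smul_left, smul_right]
      simp
      ring
    · have h1 := key 1 w
      have h2 := key w 1
      have h3 : (Quaternion.normSq w * (T 1 1).re - (T w w).re) • w =
          (Quaternion.normSq w * (T 1 1).re - (T w w).re) • (w.re • (1 : ℍ[ℝ])) := by
        have e0 := congrArg (fun q : ℍ[ℝ] => q.imI) h1
        have e1 := congrArg (fun q : ℍ[ℝ] => q.imJ) h1
        have e2 := congrArg (fun q : ℍ[ℝ] => q.imK) h1
        have f0 := congrArg (fun q : ℍ[ℝ] => q.imI) h2
        have f1 := congrArg (fun q : ℍ[ℝ] => q.imJ) h2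
        have f2 := congrArg (fun q : ℍ[ℝ] => q.imK) h2
        obtain ⟨r0, r1, r2⟩ := hR 1 w
        simp at e0 e1 e2 f0 f1 f2 r0 r1 r2
        ext
        · simp
        · simp only [Quaternion.imI_smul, Quaternion.imI_one, smul_eq_mul]
          linear_combination -e0 - Quaternion.normSq w * f0 + 3 * Quaternion.normSq w * r0
        · simp only [Quaternion.imJ_smul, Quaternion.imJ_one, smul_eq_mul]
          linear_combination -e1 - Quaternion.normSq w * f1 + 3 * Quaternion.normSq w * r1
        · simp only [Quaternion.imK_smul, Quaternion.imK_one, smul_eq_mul]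
          linear_combination -e2 - Quaternion.normSq w * f2 + 3 * Quaternion.normSq w * r2
      by_contra hne
      have h4 := smul_right_injective ℍ[ℝ] (r := Quaternion.normSq w * (T 1 1).re - (T w w).re)
        (fun h => hne (by linear_combination -h)) h3
      refine hw ?_
      rw [h4]
      simp [IsRealQuat]
  -- The bracket equals 3 at w = u = 1. Polarizing `key1` determines T(v,w) + T(w,v), the last
  -- unknown in `key`.
  refine ⟨(T 1 1).re / 3, fun v w => ?_⟩
  rcases eq_or_ne w 0 with rfl | hw
  · have := smul_right 0 v 0
    simp only [zero_smul] at this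
    simp [this]
  have hq : 3 * Quaternion.normSq w ≠ 0 := by simpa using hw
  refine smul_right_injective _ hq ?_
  simp only
  have hdot : (T v w + T w v).re = 2 * (T 1 1).re * dot v w := by
    have h1 := key1 (v + w)
    rw [add_left, add_right, add_right] at h1
    simp only [Quaternion.re_add, key1 v, key1 w] at h1 ⊢
    rw [← dot_self, ← dot_self, ← dot_self, dot_add_left, dot_add_right, dot_add_right,
      dot_comm w v] at h1
    linear_combination h1
  rw [key, hdot, key1 w]
  ext <;> simp [dot, two_mul] <;> ring

namespace LeftCircleMap

variable {g : ℍ[ℝ] → ℍ[ℝ]} {A : ℍ[ℝ] → ℍ[ℝ] →L[ℝ] ℍ[ℝ]} {Ω : Set ℍ[ℝ]}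

theorem mono (h : LeftCircleMap g A Ω) {Ω' : Set ℍ[ℝ]} (hΩ : IsOpen Ω') (hs : Ω' ⊆ Ω) :
    LeftCircleMap g A Ω' :=
  ⟨h.toCircleMap.mono hΩ hs, fun x hx => h.smoothA x (hs hx), fun x hx => h.left x (hs hx)⟩

theorem hasDerivAt_A (h : LeftCircleMap g A Ω) {x : ℍ[ℝ]} (hx : x ∈ Ω) (z u : ℍ[ℝ]) :
    HasDerivAt (fun t : ℝ => A (x + t • z) u) (fderiv ℝ A x z u) 0 :=
  hasDerivAt_line_apply_zero ((h.smoothA x hx).differentiableAt (by simp)) z u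

theorem polar (h : LeftCircleMap g A Ω) {x : ℍ[ℝ]} (hx : x ∈ Ω) (u v : ℍ[ℝ]) :
    2 * fderiv ℝ (fderiv ℝ g) x u v = A x u * fderiv ℝ g x v + A x v * fderiv ℝ g x u := by
  have h1 := h.left x hx (u + v)
  have h2 := h.left x hx u
  have h3 := h.left x hx v
  have h4 := h.symm2 hx u v
  simp only [map_add, _root_.add_apply] at h1
  linear_combination (norm := noncomm_ring) h1 - h2 - h3 + h4

theorem third (h : LeftCircleMap g A Ω) {x : ℍ[ℝ]} (hx : x ∈ Ω) (w u v : ℍ[ℝ]) :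
    2 * fderiv ℝ (fderiv ℝ (fderiv ℝ g)) x w u v =
      fderiv ℝ A x w u * fderiv ℝ g x v + A x u * fderiv ℝ (fderiv ℝ g) x w v +
      (fderiv ℝ A x w v * fderiv ℝ g x u + A x v * fderiv ℝ (fderiv ℝ g) x w u) := by
  have d1 := (h.hasDerivAt_g2 hx w u v).const_mul 2
  have d2 := ((h.hasDerivAt_A hx w u).mul (h.hasDerivAt_g1 hx w v)).add
    ((h.hasDerivAt_A hx w v).mul (h.hasDerivAt_g1 hx w u))
  have d3 := d2.congr_of_eventuallyEq (f₁ := fun t : ℝ =>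
    2 * fderiv ℝ (fderiv ℝ g) (x + t • w) u v) (by
      filter_upwards [eventually_line (h.eventually hx) w] with t ht
      exact h.polar ht u v)
  simpa only [zero_smul, add_zero] using d1.unique d3

/-- This is the symmetry of D³g in v and w. The products of values of A come from eliminating D²g
with `polar`. -/
theorem schwarzian_symm (h : LeftCircleMap g A Ω) {x : ℍ[ℝ]} (hx : x ∈ Ω) (u v w : ℍ[ℝ]) :
    (2 * fderiv ℝ A x w v - A x w * A x v) * fderiv ℝ g x u +
      (2 * fderiv ℝ A x w u - A x w * A x u) * fderiv ℝ g x v =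
    (2 * fderiv ℝ A x v w - A x v * A x w) * fderiv ℝ g x u +
      (2 * fderiv ℝ A x v u - A x v * A x u) * fderiv ℝ g x w := by
  have h1 := h.third hx w v u
  have h2 := h.third hx v w u
  rw [h.symm3 hx v w u] at h2
  have h3 := h.polar hx w u
  have h4 := h.polar hx v u
  have h5 := h.symm2 hx v w
  have h6 := congrArg (fun q => A x v * q) h3
  have h7 := congrArg (fun q => A x w * q) h4
  have h8 := congrArg (fun q => A x u * q) h5
  linear_combination (norm := noncomm_ring) 2 * h2 - 2 * h1 - h6 + h7 + 2 * h8

/-- With p = g' and a = A(v), one has g'' = ap and g''' = (a' + a²)p, so the circle equation says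
that a' + a² − 3 Re(a)a is real. Since a² − 2 Re(a)a is real, this is a' − a²/2 up to a real number.
-/
theorem schwarzian_real (h : LeftCircleMap g A Ω) {x : ℍ[ℝ]} (hx : x ∈ Ω) (v : ℍ[ℝ]) :
    IsRealQuat (2 * fderiv ℝ A x v v - A x v * A x v) := by
  rcases eq_or_ne v 0 with rfl | hv
  · simp [IsRealQuat]
  have hp := h.fderiv_ne_zero hx hv
  obtain ⟨κ, hκ⟩ := h.circle x hx v
  have h3 := h.third hx v v v
  set p := fderiv ℝ g x v
  set a := A x v
  set a' := fderiv ℝ A x v v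
  have hq : Quaternion.normSq p ≠ 0 := by simpa using hp
  have h4 : fderiv ℝ (fderiv ℝ (fderiv ℝ g)) x v v v = (a' + a * a) * p := by
    rw [h.left x hx v] at h3
    refine smul_right_injective _ (two_ne_zero : (2 : ℝ) ≠ 0) ?_
    simp only [two_smul]
    rw [← two_mul, h3]
    noncomm_ring
  have hd : dot p (a * p) = a.re * Quaternion.normSq p := by
    rw [Quaternion.normSq_def']
    simp [dot]
    ring
  have h5 : fderiv ℝ (fderiv ℝ g) x v v = a * p := h.left x hx v
  rw [h4, h5, hd] at hκ
  have h6 : (Quaternion.normSq p • (a' + a * a) - (3 * (a.re * Quaternion.normSq p)) • a -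
      κ • (1 : ℍ[ℝ])) * p = 0 := by
    simp only [sub_mul, smul_mul_assoc, one_mul, ← hκ]
    simp
  have h7 := (mul_eq_zero.1 h6).resolve_right hp
  have e0 := congrArg (fun q : ℍ[ℝ] => q.imI) h7
  have e1 := congrArg (fun q : ℍ[ℝ] => q.imJ) h7
  have e2 := congrArg (fun q : ℍ[ℝ] => q.imK) h7
  simp at e0 e1 e2
  refine ⟨mul_left_cancel₀ hq ?_, mul_left_cancel₀ hq ?_, mul_left_cancel₀ hq ?_⟩
  · rw [two_mul, mul_zero]
    simp only [Quaternion.imI_sub, Quaternion.imI_add, Quaternion.imI_mul]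
    linear_combination 2 * e0
  · rw [two_mul, mul_zero]
    simp only [Quaternion.imJ_sub, Quaternion.imJ_add, Quaternion.imJ_mul]
    linear_combination 2 * e1
  · rw [two_mul, mul_zero]
    simp only [Quaternion.imK_sub, Quaternion.imK_add, Quaternion.imK_mul]
    linear_combination 2 * e2

/-- The Schwarzian derivative of a left circle map is given by one real function. -/
theorem exists_schwarzian (h : LeftCircleMap g A Ω) : ∃ σ : ℍ[ℝ] → ℝ,
    (∀ x ∈ Ω, ContDiffAt ℝ ∞ σ x) ∧ ∀ x ∈ Ω, ∀ w u,
      2 * fderiv ℝ A x w u - A x w * A x u =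
        σ x • (2 * (fderiv ℝ g x w * star (fderiv ℝ g x u)) +
          fderiv ℝ g x u * star (fderiv ℝ g x w)) := by
  -- The equation is solved for σ at w = u = 1, where the bracket is 3|Dg(1)|²; the formula shows
  -- that σ is smooth.
  refine ⟨fun x => inner ℝ (2 * fderiv ℝ A x 1 1 - A x 1 * A x 1) (1 : ℍ[ℝ]) /
    (3 * inner ℝ (fderiv ℝ g x 1) (fderiv ℝ g x 1)), fun x hx => ?_, fun x hx => ?_⟩
  · have s1 : ContDiffAt ℝ ∞ (fun y => fderiv ℝ g y 1) x := (h.smooth1 hx).clm_apply contDiffAt_const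
    have s2 : ContDiffAt ℝ ∞ (fun y => A y 1) x := (h.smoothA x hx).clm_apply contDiffAt_const
    have s3 : ContDiffAt ℝ ∞ (fun y => fderiv ℝ A y 1 1) x :=
      (((h.smoothA x hx).fderiv_right (by simp)).clm_apply contDiffAt_const).clm_apply
        contDiffAt_const
    refine ((((contDiffAt_const.mul s3).sub (s2.mul s2)).inner ℝ contDiffAt_const)).div
      (contDiffAt_const.mul (s1.inner ℝ s1)) ?_
    simpa [Quaternion.inner_self] using h.fderiv_ne_zero hx one_ne_zero
  · obtain ⟨e, he⟩ := h.exists_equiv hx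
    have hes : ∀ u, fderiv ℝ g x (e.symm u) = u := fun u => by rw [← he, e.apply_symm_apply]
    obtain ⟨σ, hσ⟩ := exists_schwarzian_coefficient (T := fun w u =>
      2 * fderiv ℝ A x (e.symm w) (e.symm u) - A x (e.symm w) * A x (e.symm u))
      (fun a b c => by simp only [map_add, _root_.add_apply]; noncomm_ring)
      (fun a b c => by simp only [map_add]; noncomm_ring)
      (fun r a b => by simp [smul_sub])
      (fun r a b => by simp [smul_sub])
      (fun u v w => by simpa only [hes] using h.schwarzian_symm hx (e.symm u) (e.symm v) (e.symm w))
      (fun v => h.schwarzian_real hx (e.symm v))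
    have h1 : ∀ w u, 2 * fderiv ℝ A x w u - A x w * A x u =
        σ • (2 * (fderiv ℝ g x w * star (fderiv ℝ g x u)) +
          fderiv ℝ g x u * star (fderiv ℝ g x w)) := by
      intro w u
      have := hσ (e w) (e u)
      simp only [e.symm_apply_apply] at this
      simpa only [he] using this
    have h2 : inner ℝ (2 * fderiv ℝ A x 1 1 - A x 1 * A x 1) (1 : ℍ[ℝ]) /
        (3 * inner ℝ (fderiv ℝ g x 1) (fderiv ℝ g x 1)) = σ := by
      have h3 : inner ℝ (fderiv ℝ g x 1) (fderiv ℝ g x 1) ≠ (0 : ℝ) := by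
        simpa [Quaternion.inner_self] using h.fderiv_ne_zero hx one_ne_zero
      rw [h1, div_eq_iff (by simpa using h3), ← dot_eq_inner, ← dot_eq_inner]
      simp [dot, two_mul]
      ring
    simp only [h2]
    exact h1

end LeftCircleMap

/-! ### Linear differential equations on the unit interval -/

/-- Grönwall's inequality with zero initial value. With K = 0 it says that a function with zero
derivative is constant. -/
theorem eq_zero_of_norm_deriv_le {E : Type*} [NormedAddCommGroup E] [NormedSpace ℝ E]
    {f f' : ℝ → E} {K : ℝ} (hf : ∀ t ∈ Icc (0 : ℝ) 1, HasDerivAt f (f' t) t)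
    (hK : ∀ t ∈ Icc (0 : ℝ) 1, ‖f' t‖ ≤ K * ‖f t‖) (h0 : f 0 = 0) :
    ∀ t ∈ Icc (0 : ℝ) 1, f t = 0 := by
  intro t ht
  have h := norm_le_gronwallBound_of_norm_deriv_right_le (f := f) (f' := f') (δ := 0) (K := K)
    (ε := 0) (a := 0) (b := 1) (fun t ht => (hf t ht).continuousAt.continuousWithinAt)
    (fun t ht => (hf t (Ico_subset_Icc_self ht)).hasDerivWithinAt) (by simp [h0])
    (fun t ht => by simpa using hK t (Ico_subset_Icc_self ht)) t ht
  rw [gronwallBound_ε0_δ0] at h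
  simpa using h

/-- A solution of a scalar linear differential equation stays on a line. -/
theorem exists_smul_of_scalar_ode {E : Type*} [NormedAddCommGroup E] [NormedSpace ℝ E]
    {X : ℝ → E} {c : ℝ → ℝ} (hc : ContinuousOn c (Icc 0 1))
    (hX : ∀ t ∈ Icc (0 : ℝ) 1, HasDerivAt X (c t • X t) t) :
    ∀ t ∈ Icc (0 : ℝ) 1, ∃ μ : ℝ, X t = μ • X 0 := by
  -- The coefficient is extended continuously beyond the interval, so that its primitive is
  -- differentiable at the endpoints too. C is the integrating factor, and C • X is constant.
  set d : ℝ → ℝ := Set.IccExtend zero_le_one ((Icc (0 : ℝ) 1).domRestrict c) with hd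
  have hdc : Continuous d := (continuousOn_iff_continuous_domRestrict.1 hc).Icc_extend'
  have hde : ∀ t ∈ Icc (0 : ℝ) 1, d t = c t := fun t ht => Set.IccExtend_of_mem _ _ ht
  set C : ℝ → ℝ := fun t => Real.exp (-∫ s in (0 : ℝ)..t, d s) with hC
  have hCd : ∀ t, HasDerivAt C (-d t * C t) t := by
    intro t
    have h1 : HasDerivAt (fun t => ∫ s in (0 : ℝ)..t, d s) (d t) t :=
      (hdc.integral_hasStrictDerivAt 0 t).hasDerivAt
    have := h1.neg.exp
    rwa [mul_comm] at this
  have h0 := eq_zero_of_norm_deriv_le (f := fun t => C t • X t - X 0) (f' := fun _ => 0) (K := 0)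
    (fun t ht => by
      have h2 := ((hCd t).smul (hX t ht)).sub_const (X 0)
      refine h2.congr_deriv ?_
      rw [hde t ht]
      module) (by simp) (by simp [hC])
  intro t ht
  refine ⟨(C t)⁻¹, ?_⟩
  have hne : C t ≠ 0 := (Real.exp_pos _).ne'
  rw [← sub_eq_zero.1 (h0 t ht), smul_smul, inv_mul_cancel₀ hne, one_smul]

/-! ### Hopf fibrations -/

namespace LeftCircleMap

variable {g : ℍ[ℝ] → ℍ[ℝ]} {A : ℍ[ℝ] → ℍ[ℝ] →L[ℝ] ℍ[ℝ]} {Ω : Set ℍ[ℝ]}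

/-- A left circle map with vanishing Schwarzian derivative is a quotient of affine maps. -/
theorem quotient_of_affine (h : LeftCircleMap g A Ω)
    (hS : ∀ x ∈ Ω, ∀ w, 2 * fderiv ℝ A x w w = A x w * A x w) {x v : ℍ[ℝ]}
    (hv : ∀ t ∈ Icc (0 : ℝ) 1, x + t • v ∈ Ω) :
    (1 - (1 / 2 : ℝ) • A x v) * g (x + v) =
      g x + (fderiv ℝ g x v - (1 / 2 : ℝ) • (A x v * g x)) := by
  set a : ℝ → ℍ[ℝ] := fun t => A (x + t • v) v with ha
  set p : ℝ → ℍ[ℝ] := fun t => fderiv ℝ g (x + t • v) v with hp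
  set Y : ℝ → ℍ[ℝ] := fun t => 1 - t • (1 / 2 : ℝ) • A x v with hY
  have a0 : a 0 = A x v := by simp [ha]
  have da : ∀ t ∈ Icc (0 : ℝ) 1, HasDerivAt a ((1 / 2 : ℝ) • (a t * a t)) t := by
    intro t ht
    have h1 := hasDerivAt_line_apply ((h.smoothA _ (hv t ht)).differentiableAt (by simp)) v
    refine h1.congr_deriv ?_
    simp only [ha]
    rw [← hS _ (hv t ht) v, two_mul, ← two_smul ℝ, smul_smul]
    norm_num
  have dp : ∀ t ∈ Icc (0 : ℝ) 1, HasDerivAt p (a t * p t) t := by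
    intro t ht
    have h1 := hasDerivAt_line_apply ((h.smooth1 (hv t ht)).differentiableAt (by simp)) v
    rwa [h.left _ (hv t ht)] at h1
  have dg : ∀ t ∈ Icc (0 : ℝ) 1, HasDerivAt (fun t : ℝ => g (x + t • v)) (p t) t := fun t ht =>
    hasDerivAt_line ((h.smooth _ (hv t ht)).differentiableAt (by simp))
  have dY : ∀ t, HasDerivAt Y (-(1 / 2 : ℝ) • A x v) t := by
    intro t
    refine (((hasDerivAt_id t).smul_const ((1 / 2 : ℝ) • A x v)).const_sub 1).congr_deriv ?_
    module
  have ca : ContinuousOn a (Icc 0 1) := fun t ht => (da t ht).continuousAt.continuousWithinAt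
  obtain ⟨K, hK⟩ := isCompact_Icc.exists_bound_of_continuousOn ca
  -- The Riccati equation a' = a²/2 has the solution a = Y⁻¹A(v) with Y = 1 − tA(v)/2. It is proved
  -- in the form Ya = A(v), because Y is not known to be invertible.
  have E := eq_zero_of_norm_deriv_le (f := fun t => Y t * a t - A x v) (K := K)
    (f' := fun t => (1 / 2 : ℝ) • ((Y t * a t - A x v) * a t)) (fun t ht => by
      have h1 := ((dY t).mul (da t ht)).sub_const (A x v)
      refine h1.congr_deriv ?_
      simp only [sub_mul, smul_mul_assoc, mul_smul_comm, mul_assoc]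
      module) (fun t ht => by
      rw [norm_smul, norm_mul, mul_comm ‖Y t * a t - A x v‖, ← mul_assoc]
      have h1 := hK t ht
      have h2 := norm_nonneg (a t)
      refine mul_le_mul_of_nonneg_right ?_ (norm_nonneg _)
      norm_num
      linarith) (by simp [hY, a0])
  -- The function here is (Yg)' minus its initial value. Since (Yg)'' = 2Y'p + Yap = −A(v)p + A(v)p
  -- = 0, the product Yg is affine in t.
  have M := eq_zero_of_norm_deriv_le (K := 0) (f := fun t => -(1 / 2 : ℝ) • A x v * g (x + t • v) +
    Y t * p t - (fderiv ℝ g x v - (1 / 2 : ℝ) • (A x v * g x))) (f' := fun _ => 0)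
    (fun t ht => by
      have h1 := (((dg t ht).const_mul (-(1 / 2 : ℝ) • A x v)).add
        ((dY t).mul (dp t ht))).sub_const (fderiv ℝ g x v - (1 / 2 : ℝ) • (A x v * g x))
      refine h1.congr_deriv ?_
      rw [← mul_assoc, sub_eq_zero.1 (E t ht)]
      simp only [smul_mul_assoc]
      module) (by simp) (by
      simp only [hY, hp, zero_smul, add_zero, sub_zero, one_mul, smul_mul_assoc]
      module)
  have N := eq_zero_of_norm_deriv_le (K := 0) (f := fun t : ℝ => Y t * g (x + t • v) - g x -
    t • (fderiv ℝ g x v - (1 / 2 : ℝ) • (A x v * g x))) (f' := fun _ => 0) (fun t ht => by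
      have h1 := (((dY t).mul (dg t ht)).sub_const (g x)).sub
        ((hasDerivAt_id t).smul_const (fderiv ℝ g x v - (1 / 2 : ℝ) • (A x v * g x)))
      refine h1.congr_deriv ?_
      rw [one_smul]
      exact M t ht) (by simp) (by simp [hY]) 1 (by simp)
  simp only [hY, one_smul] at N
  rw [← sub_eq_zero, ← N]
  abel

end LeftCircleMap

/-! ### Non-vanishing Schwarzian derivative -/

theorem eq_zero_of_mul_star_real {X : ℍ[ℝ]} (h : ∀ U, IsRealQuat (X * star U)) : X = 0 := by
  obtain ⟨a, b, c⟩ := h 1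
  obtain ⟨d, -, -⟩ := h (ofCoords 0 1 0 0)
  simp at a b c d
  ext <;> simp [a, b, c, d]

theorem hasDerivAt_star {a : ℝ → ℍ[ℝ]} {a' : ℍ[ℝ]} {t : ℝ} (ha : HasDerivAt a a' t) :
    HasDerivAt (fun t => star (a t)) (star a') t :=
  starL.hasFDerivAt.comp_hasDerivAt t ha

/-- The symmetry of the second derivatives of `A` determines the imaginary part of `A`. -/
theorem real_of_second_order {a c W : ℍ[ℝ]} {σ σz σw : ℝ} (hσ : σ ≠ 0)
    (h : (1 / 2 : ℝ) • (a * c + σ • (2 * star W + W)) * a +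
        c * ((1 / 2 : ℝ) • (a * a + (3 * σ) • 1)) + (σz • (2 * W + star W) +
        σ • (2 * ((1 / 2 : ℝ) • (a * W + c) + W * star a) + (a * star W +
          star ((1 / 2 : ℝ) • (a * W + c))))) =
      (1 / 2 : ℝ) • (c * a + σ • (2 * W + star W)) * a +
        a * ((1 / 2 : ℝ) • (c * a + σ • (2 * W + star W))) + ((3 * σw) • 1 +
        (3 * σ) • ((1 / 2 : ℝ) • (a * W + c) + star ((1 / 2 : ℝ) • (a * W + c))))) :
    IsRealQuat (c - ofCoords (σz / (2 * σ)) a.imI a.imJ a.imK * star W) := by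
  -- In the application a = A(z), c = A(w), Dg(z) = 1, Dg(w) = W, and σz, σw are derivatives of σ.
  -- The term with σw is real, so the imaginary parts involve σz only.
  have e1 := congrArg (fun q : ℍ[ℝ] => q.imI) h
  have e2 := congrArg (fun q : ℍ[ℝ] => q.imJ) h
  have e3 := congrArg (fun q : ℍ[ℝ] => q.imK) h
  simp [two_mul] at e1 e2 e3
  refine ⟨?_, ?_, ?_⟩
  · simp
    field_simp
    linear_combination e1
  · simp
    field_simp
    linear_combination e2
  · simp
    field_simp
    linear_combination e3

/-- Circle maps of the form of central projections, to the second order. -/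
structure ClassicalMap (g b : ℍ[ℝ] → ℍ[ℝ]) (ℓ : ℍ[ℝ] → ℍ[ℝ] →L[ℝ] ℝ) (k : ℍ[ℝ] → ℝ)
    (Ω : Set ℍ[ℝ]) : Prop extends CircleMap g Ω where
  smoothb : ∀ x ∈ Ω, ContDiffAt ℝ ∞ b x
  smoothl : ∀ x ∈ Ω, ContDiffAt ℝ ∞ ℓ x
  smoothk : ∀ x ∈ Ω, ContDiffAt ℝ ∞ k x
  second : ∀ x ∈ Ω, ∀ v w, (2 : ℝ) • fderiv ℝ (fderiv ℝ g) x v w =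
    ℓ x v • fderiv ℝ g x w + ℓ x w • fderiv ℝ g x v +
      (2 * dot (fderiv ℝ g x v) (fderiv ℝ g x w)) • b x
  deriv_b : ∀ x ∈ Ω, ∀ w, fderiv ℝ b x w =
    dot (b x) (fderiv ℝ g x w) • b x - k x • fderiv ℝ g x w
  deriv_l : ∀ x ∈ Ω, ∀ w u, fderiv ℝ ℓ x w u =
    (1 / 2) * ℓ x w * ℓ x u - 2 * k x * dot (fderiv ℝ g x w) (fderiv ℝ g x u)

namespace LeftCircleMap

variable {g : ℍ[ℝ] → ℍ[ℝ]} {A : ℍ[ℝ] → ℍ[ℝ] →L[ℝ] ℍ[ℝ]} {Ω : Set ℍ[ℝ]}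

/-- Differentiating the Schwarzian equation once more and using the symmetry of D²A gives a
first-order condition on σ and A. Where σ ≠ 0 it can be solved for the imaginary part of A(w). -/
theorem exists_real_translate (h : LeftCircleMap g A Ω) {σ : ℍ[ℝ] → ℝ}
    (hs : ∀ x ∈ Ω, ContDiffAt ℝ ∞ σ x)
    (hS : ∀ x ∈ Ω, ∀ w u, 2 * fderiv ℝ A x w u - A x w * A x u =
        σ x • (2 * (fderiv ℝ g x w * star (fderiv ℝ g x u)) +
          fderiv ℝ g x u * star (fderiv ℝ g x w)))
    {x : ℍ[ℝ]} (hx : x ∈ Ω) (hne : σ x ≠ 0) :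
    ∃ b : ℍ[ℝ], ∀ w, IsRealQuat (A x w - b * star (fderiv ℝ g x w)) := by
  have two_mul_eq : ∀ q r : ℍ[ℝ], 2 * q = r → q = (1 / 2 : ℝ) • r := by
    intro q r hqr
    rw [← hqr, two_mul, ← two_smul ℝ q, smul_smul]
    norm_num
  have dA : ∀ z w u, 2 * fderiv ℝ (fderiv ℝ A) x z w u =
      fderiv ℝ A x z w * A x u + A x w * fderiv ℝ A x z u +
      (fderiv ℝ σ x z • (2 * (fderiv ℝ g x w * star (fderiv ℝ g x u)) +
          fderiv ℝ g x u * star (fderiv ℝ g x w)) +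
        σ x • (2 * (fderiv ℝ (fderiv ℝ g) x z w * star (fderiv ℝ g x u) +
          fderiv ℝ g x w * star (fderiv ℝ (fderiv ℝ g) x z u)) +
          (fderiv ℝ (fderiv ℝ g) x z u * star (fderiv ℝ g x w) +
          fderiv ℝ g x u * star (fderiv ℝ (fderiv ℝ g) x z w)))) := by
    intro z w u
    have d1 : HasDerivAt (fun t : ℝ => fderiv ℝ A (x + t • z) w u)
        (fderiv ℝ (fderiv ℝ A) x z w u) 0 := by
      simpa using (hasDerivAt_line_apply_zero (((h.smoothA x hx).fderiv_right (m := ∞)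
        (by simp)).differentiableAt (by simp)) z w).clm_apply (hasDerivAt_const (0 : ℝ) u)
    have d2 := (h.hasDerivAt_A hx z w).mul (h.hasDerivAt_A hx z u)
    have d3 := hasDerivAt_line_zero ((hs x hx).differentiableAt (by simp)) z
    have d4 := ((h.hasDerivAt_g1 hx z w).mul (hasDerivAt_star (h.hasDerivAt_g1 hx z u)))
    have d5 := ((h.hasDerivAt_g1 hx z u).mul (hasDerivAt_star (h.hasDerivAt_g1 hx z w)))
    have d6 := d2.add (d3.smul ((d4.const_mul 2).add d5))
    have d7 := d6.congr_of_eventuallyEq (f₁ := fun t : ℝ => 2 * fderiv ℝ A (x + t • z) w u) (by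
      filter_upwards [eventually_line (h.eventually hx) z] with t ht
      exact eq_add_of_sub_eq' (hS _ ht w u))
    have := (d1.const_mul 2).unique d7
    simp only [zero_smul, add_zero, Pi.add_apply, Pi.mul_apply] at this
    rw [this]
    abel
  obtain ⟨e, he⟩ := h.exists_equiv hx
  have hes : ∀ u, fderiv ℝ g x (e.symm u) = u := fun u => by rw [← he, e.apply_symm_apply]
  set z := e.symm 1 with hz
  have pz : fderiv ℝ g x z = 1 := hes 1
  -- The case w = z, where Dg(z) = 1, forces the imaginary part of b to be that of A(z). The real
  -- part is read off from the compatibility condition.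
  refine ⟨ofCoords (fderiv ℝ σ x z / (2 * σ x)) (A x z).imI (A x z).imJ (A x z).imK, fun w => ?_⟩
  refine real_of_second_order (σw := fderiv ℝ σ x w) hne ?_
  have e1 := dA z w z
  have e2 := dA w z z
  rw [show fderiv ℝ (fderiv ℝ A) x z w z = fderiv ℝ (fderiv ℝ A) x w z z from
    congrArg (fun L : ℍ[ℝ] →L[ℝ] ℍ[ℝ] => L z)
      ((h.smoothA x hx).isSymmSndFDerivAt two_le_smoothness z w), e2] at e1
  have s1 := two_mul_eq _ _ (eq_add_of_sub_eq' (hS x hx z w))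
  have s2 := two_mul_eq _ _ (eq_add_of_sub_eq' (hS x hx w z))
  have s3 := two_mul_eq _ _ (eq_add_of_sub_eq' (hS x hx z z))
  have s4 := two_mul_eq _ _ (h.polar hx z w)
  have s5 : fderiv ℝ (fderiv ℝ g) x z z = A x z := by rw [h.left x hx, pz, mul_one]
  have s6 : fderiv ℝ (fderiv ℝ g) x w z = fderiv ℝ (fderiv ℝ g) x z w := h.symm2 hx w z
  rw [s6, s5, s4, s1, s2, s3, pz] at e1
  simp only [star_one, mul_one, one_mul] at e1
  have three : ∀ r : ℝ, r • ((2 : ℍ[ℝ]) + 1) = (3 * r) • (1 : ℍ[ℝ]) := by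
    intro r
    rw [← one_add_one_eq_two]
    module
  have three' : ∀ (r : ℝ) (q : ℍ[ℝ]), r • (2 * q + q) = (3 * r) • q := by
    intro r q
    rw [two_mul]
    module
  rw [three, three, three'] at e1
  exact e1.symm

end LeftCircleMap

theorem eq_smul_one_of_isRealQuat {a : ℍ[ℝ]} (h : IsRealQuat a) : a = a.re • (1 : ℍ[ℝ]) := by
  obtain ⟨h1, h2, h3⟩ := h
  ext <;> simp [h1, h2, h3]

namespace LeftCircleMap

variable {g : ℍ[ℝ] → ℍ[ℝ]} {A : ℍ[ℝ] → ℍ[ℝ] →L[ℝ] ℍ[ℝ]} {Ω : Set ℍ[ℝ]}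

/-- The decomposition of `A` into a scalar form and a left multiplication. -/
theorem exists_decomposition (h : LeftCircleMap g A Ω)
    (hb : ∀ x ∈ Ω, ∃ b : ℍ[ℝ], ∀ w, IsRealQuat (A x w - b * star (fderiv ℝ g x w))) :
    ∃ (b : ℍ[ℝ] → ℍ[ℝ]) (ℓ : ℍ[ℝ] → ℍ[ℝ] →L[ℝ] ℝ), (∀ x ∈ Ω, ContDiffAt ℝ ∞ b x) ∧
      (∀ x ∈ Ω, ContDiffAt ℝ ∞ ℓ x) ∧
      ∀ x ∈ Ω, ∀ v, A x v = ℓ x v • (1 : ℍ[ℝ]) + b x * star (fderiv ℝ g x v) := by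
  set M : ℍ[ℝ] → ℍ[ℝ] → ℍ[ℝ] := fun y u => A y ((fderiv ℝ g y).inverse u) with hM
  -- M(u) − bu* is real for all u: u = 1 determines the imaginary part of b, and u = i its real part
  -- as −⟨M(i), i⟩. This formula shows that b is smooth, which the pointwise existence does not.
  set b : ℍ[ℝ] → ℍ[ℝ] := fun y => (1 / 2 : ℝ) • (M y 1 - starL (M y 1)) -
    (inner ℝ (M y (ofCoords 0 1 0 0)) (ofCoords 0 1 0 0) : ℝ) • (1 : ℍ[ℝ]) with hbdef
  set ℓ : ℍ[ℝ] → ℍ[ℝ] →L[ℝ] ℝ := fun y => interpolate fun v =>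
    (inner ℝ (A y v - b y * starL (fderiv ℝ g y v)) (1 : ℍ[ℝ]) : ℝ) with hℓ
  have sM : ∀ x ∈ Ω, ∀ u, ContDiffAt ℝ ∞ (fun y => M y u) x := by
    intro x hx u
    obtain ⟨e, he⟩ := h.exists_equiv hx
    have e1 : (e : ℍ[ℝ] →L[ℝ] ℍ[ℝ]) = fderiv ℝ g x := by
      ext1 v
      exact he v
    have h1 : ContDiffAt ℝ ∞ (fun y => (fderiv ℝ g y).inverse) x := by
      have := contDiffAt_map_inverse (n := ∞) e
      rw [e1] at this
      exact this.comp x (h.smooth1 hx)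
    exact (h.smoothA x hx).clm_apply (h1.clm_apply contDiffAt_const)
  have sb : ∀ x ∈ Ω, ContDiffAt ℝ ∞ b x := fun x hx =>
    ((contDiffAt_const (c := (1 / 2 : ℝ))).smul
      ((sM x hx 1).sub (starL.contDiff.contDiffAt.comp x (sM x hx 1)))).sub
      (((sM x hx (ofCoords 0 1 0 0)).inner ℝ (contDiffAt_const (c := ofCoords 0 1 0 0))).smul
        (contDiffAt_const (c := (1 : ℍ[ℝ]))))
  have sp : ∀ x ∈ Ω, ∀ v, ContDiffAt ℝ ∞ (fun y => starL (fderiv ℝ g y v)) x := fun x hx v =>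
    starL.contDiff.contDiffAt.comp x ((h.smooth1 hx).clm_apply contDiffAt_const)
  refine ⟨b, ℓ, sb, fun x hx => contDiffAt_interpolate fun v _ =>
    (((h.smoothA x hx).clm_apply contDiffAt_const).sub
      ((sb x hx).mul (sp x hx v))).inner ℝ contDiffAt_const, fun x hx => ?_⟩
  obtain ⟨c, hc⟩ := hb x hx
  obtain ⟨e, he⟩ := h.exists_equiv hx
  have e1 : (e : ℍ[ℝ] →L[ℝ] ℍ[ℝ]) = fderiv ℝ g x := by
    ext1 v
    exact he v
  have hM' : ∀ u, M x u = A x (e.symm u) := fun u => by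
    simp only [hM, ← e1, ContinuousLinearMap.inverse_equiv]
    rfl
  have hes : ∀ u, fderiv ℝ g x (e.symm u) = u := fun u => by rw [← he, e.apply_symm_apply]
  have hbc : b x = c := by
    obtain ⟨a1, a2, a3⟩ := hc (e.symm 1)
    obtain ⟨b1, b2, b3⟩ := hc (e.symm (ofCoords 0 1 0 0))
    simp only [← hM', hes] at a1 a2 a3 b1 b2 b3
    simp only [hbdef, ← dot_eq_inner, starL_apply]
    simp at a1 a2 a3 b1 b2 b3
    ext <;> simp [dot] <;> linarith
  have key : ∀ v, A x v - c * star (fderiv ℝ g x v) =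
      (inner ℝ (A x v - c * star (fderiv ℝ g x v)) (1 : ℍ[ℝ]) : ℝ) • (1 : ℍ[ℝ]) := by
    intro v
    conv_lhs => rw [eq_smul_one_of_isRealQuat (hc v)]
    rw [← dot_eq_inner]
    simp [dot]
  set L : ℍ[ℝ] →L[ℝ] ℝ := (innerSL ℝ (1 : ℍ[ℝ])).comp
    (A x - (ContinuousLinearMap.mul ℝ ℍ[ℝ] c).comp (starL.comp (fderiv ℝ g x))) with hL
  have hℓL : ℓ x = L := interpolate_eq fun v _ => by
    rw [hbc, real_inner_comm]
    rfl
  intro v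
  rw [hℓL, hbc]
  have h2 : L v = inner ℝ (A x v - c * star (fderiv ℝ g x v)) (1 : ℍ[ℝ]) := by
    rw [real_inner_comm]
    rfl
  rw [h2, ← key]
  abel

/-- Since bV*W + bW*V = 2⟨V, W⟩b, substituting A = ℓ + b·(Dg)* gives the second derivative of g. The
Schwarzian equation then takes the form X·Dg(u)* + (real) = 0 for all u, which forces X = 0. The two
vanishing terms are the formulas for Db and Dℓ, with k = (|b|² − σ)/2. -/
theorem exists_classical (h : LeftCircleMap g A Ω) {σ : ℍ[ℝ] → ℝ}
    (hs : ∀ x ∈ Ω, ContDiffAt ℝ ∞ σ x)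
    (hS : ∀ x ∈ Ω, ∀ w u, 2 * fderiv ℝ A x w u - A x w * A x u =
        σ x • (2 * (fderiv ℝ g x w * star (fderiv ℝ g x u)) +
          fderiv ℝ g x u * star (fderiv ℝ g x w)))
    (hne : ∀ x ∈ Ω, σ x ≠ 0) : ∃ b ℓ k, ClassicalMap g b ℓ k Ω := by
  obtain ⟨b, ℓ, sb, sl, hA⟩ := h.exists_decomposition
    fun x hx => h.exists_real_translate hs hS hx (hne x hx)
  have second : ∀ x ∈ Ω, ∀ v w, (2 : ℝ) • fderiv ℝ (fderiv ℝ g) x v w =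
      ℓ x v • fderiv ℝ g x w + ℓ x w • fderiv ℝ g x v +
        (2 * dot (fderiv ℝ g x v) (fderiv ℝ g x w)) • b x := by
    intro x hx v w
    have h1 := h.polar hx v w
    rw [hA x hx v, hA x hx w, two_mul] at h1
    rw [two_smul, h1]
    generalize fderiv ℝ g x v = V
    generalize fderiv ℝ g x w = W
    have e : b x * star V * W + b x * star W * V = (2 * dot V W) • b x := by
      ext <;> simp [dot] <;> ring
    rw [← e]
    simp only [add_mul, smul_mul_assoc, one_mul]
    abel
  have main : ∀ x ∈ Ω, ∀ w u, (fderiv ℝ b x w - dot (b x) (fderiv ℝ g x w) • b x +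
      ((1 / 2) * dot (b x) (b x) - (1 / 2) * σ x) • fderiv ℝ g x w) * star (fderiv ℝ g x u) +
      (fderiv ℝ ℓ x w u - (1 / 2) * ℓ x w * ℓ x u + 2 *
        ((1 / 2) * dot (b x) (b x) - (1 / 2) * σ x) * dot (fderiv ℝ g x w) (fderiv ℝ g x u)) •
          (1 : ℍ[ℝ]) = 0 := by
    intro x hx w u
    have d1 := h.hasDerivAt_A hx w u
    have d2 := (hasDerivAt_line_apply_zero ((sl x hx).differentiableAt (by simp)) w u).smul_const
      (1 : ℍ[ℝ])
    have d3 := (hasDerivAt_line_zero ((sb x hx).differentiableAt (by simp)) w).mul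
      (hasDerivAt_star (h.hasDerivAt_g1 hx w u))
    have d4 := (d2.add d3).congr_of_eventuallyEq (f₁ := fun t : ℝ => A (x + t • w) u) (by
      filter_upwards [eventually_line (h.eventually hx) w] with t ht
      exact hA _ ht u)
    have e1 := d1.unique d4
    simp only [zero_smul, add_zero] at e1
    have e2 := hS x hx w u
    have e3 := second x hx w u
    rw [e1, hA x hx w, hA x hx u] at e2
    have e4 : fderiv ℝ (fderiv ℝ g) x w u = (1 / 2 : ℝ) • (ℓ x w • fderiv ℝ g x u +
        ℓ x u • fderiv ℝ g x w + (2 * dot (fderiv ℝ g x w) (fderiv ℝ g x u)) • b x) := by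
      rw [← e3, smul_smul]
      norm_num
    rw [e4] at e2
    generalize fderiv ℝ g x w = W at *
    generalize fderiv ℝ g x u = V at *
    generalize fderiv ℝ b x w = B at *
    simp only [two_mul] at e2
    have c0 := congrArg (fun q : ℍ[ℝ] => q.re) e2
    have c1 := congrArg (fun q : ℍ[ℝ] => q.imI) e2
    have c2 := congrArg (fun q : ℍ[ℝ] => q.imJ) e2
    have c3 := congrArg (fun q : ℍ[ℝ] => q.imK) e2
    clear e1 e2 e3 e4 d1 d2 d3 d4
    simp [dot] at c0 c1 c2 c3
    ext
    · simp [dot]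
      linear_combination (1 / 2) * c0
    · simp [dot]
      linear_combination (1 / 2) * c1
    · simp [dot]
      linear_combination (1 / 2) * c2
    · simp [dot]
      linear_combination (1 / 2) * c3
  have db : ∀ x ∈ Ω, ∀ w, fderiv ℝ b x w - dot (b x) (fderiv ℝ g x w) • b x +
      ((1 / 2) * dot (b x) (b x) - (1 / 2) * σ x) • fderiv ℝ g x w = 0 := by
    intro x hx w
    refine eq_zero_of_mul_star_real fun U => ?_
    obtain ⟨e, he⟩ := h.exists_equiv hx
    have := main x hx w (e.symm U)
    rw [← he (e.symm U), e.apply_symm_apply] at this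
    rw [eq_neg_of_add_eq_zero_left this]
    simp [IsRealQuat]
  refine ⟨b, ℓ, fun x => (1 / 2) * dot (b x) (b x) - (1 / 2) * σ x, h.toCircleMap, sb, sl,
    fun x hx => ?_, second, fun x hx w => ?_, fun x hx w u => ?_⟩
  · simp only [dot_eq_inner]
    exact (contDiffAt_const.mul ((sb x hx).inner ℝ (sb x hx))).sub
      (contDiffAt_const.mul (hs x hx))
  · have := db x hx w
    rw [← sub_eq_zero, ← this]
    abel
  · have := main x hx w u
    rw [db x hx w, zero_mul, zero_add] at this
    have := (smul_eq_zero.1 this).resolve_right one_ne_zero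
    linear_combination this

end LeftCircleMap

/-! ### Central projections -/

/-- The derivative of `lightLift` at `q` in the direction `p`. -/
def lightLiftDeriv (q p : ℍ[ℝ]) : ℍ[ℝ] × ℝ × ℝ := (p, 2 * dot q p, 0)

/-- The center of the projection, in homogeneous coordinates. -/
def lightPole (q b : ℍ[ℝ]) (k : ℝ) : ℍ[ℝ] × ℝ × ℝ :=
  (b + k • q, 2 + 2 * dot q b + k * dot q q, k)

theorem lightPole_ne_zero (q b : ℍ[ℝ]) (k : ℝ) : lightPole q b k ≠ 0 := by
  intro h
  simp only [lightPole, Prod.mk_eq_zero] at h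
  obtain ⟨h1, h2, rfl⟩ := h
  rw [zero_smul, add_zero] at h1
  simp [h1, dot] at h2

/-- The pole is transversal to the tangent hyperplane of the light cone at the lift of q: the
summand 2 in its second coordinate is what remains after comparing the other coordinates. This makes
the central projection from it nondegenerate. -/
theorem eq_zero_of_lightPole {q p b : ℍ[ℝ]} {k c τ : ℝ}
    (h : c • lightLift q + lightLiftDeriv q p = τ • lightPole q b k) : c = 0 ∧ p = 0 ∧ τ = 0 := by
  simp only [lightLift, lightLiftDeriv, lightPole, Prod.smul_mk, Prod.mk_add_mk, Prod.mk.injEq,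
    smul_eq_mul, mul_one, add_zero] at h
  obtain ⟨h1, h2, rfl⟩ := h
  have h3 : p = τ • b := by
    rw [smul_add, smul_smul, add_comm] at h1
    exact add_right_cancel h1
  rw [h3, dot_smul_right] at h2
  have h4 : τ = 0 := by linear_combination -(1 / 2) * h2
  simp [h3, h4]

theorem hasDerivAt_lightLift {γ : ℝ → ℍ[ℝ]} {γ' : ℍ[ℝ]} {t : ℝ} (h : HasDerivAt γ γ' t) :
    HasDerivAt (fun t => lightLift (γ t)) (lightLiftDeriv (γ t) γ') t := by
  have := hasDerivAt_dot h h
  rw [dot_comm, ← two_mul] at this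
  exact h.prodMk (this.prodMk (hasDerivAt_const t 1))

namespace ClassicalMap

variable {g b : ℍ[ℝ] → ℍ[ℝ]} {ℓ : ℍ[ℝ] → ℍ[ℝ] →L[ℝ] ℝ} {k : ℍ[ℝ] → ℝ} {Ω : Set ℍ[ℝ]}

/-- The symmetry of D²b gives δ(w)Dg(z) = δ(z)Dg(w), where δ is the difference of the two sides.
Choosing Dg(z) = i·Dg(w), which is independent of Dg(w), yields δ(w) = 0. -/
theorem deriv_k (h : ClassicalMap g b ℓ k Ω) {x : ℍ[ℝ]} (hx : x ∈ Ω) (w : ℍ[ℝ]) :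
    fderiv ℝ k x w = k x * dot (b x) (fderiv ℝ g x w) := by
  rcases eq_or_ne w 0 with rfl | hw
  · simp [dot]
  have db2 : ∀ z w, fderiv ℝ (fderiv ℝ b) x z w =
      (dot (fderiv ℝ b x z) (fderiv ℝ g x w) + dot (b x) (fderiv ℝ (fderiv ℝ g) x z w)) • b x +
      dot (b x) (fderiv ℝ g x w) • fderiv ℝ b x z - (fderiv ℝ k x z • fderiv ℝ g x w +
      k x • fderiv ℝ (fderiv ℝ g) x z w) := by
    intro z w
    have d1 := hasDerivAt_line_apply_zero (((h.smoothb x hx).fderiv_right (m := ∞)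
      (by simp)).differentiableAt (by simp)) z w
    have d2 := hasDerivAt_line_zero ((h.smoothb x hx).differentiableAt (by simp)) z
    have d3 := hasDerivAt_line_zero ((h.smoothk x hx).differentiableAt (by simp)) z
    have d4 := ((hasDerivAt_dot d2 (h.hasDerivAt_g1 hx z w)).smul d2).sub
      (d3.smul (h.hasDerivAt_g1 hx z w))
    have d5 := d4.congr_of_eventuallyEq (f₁ := fun t : ℝ => fderiv ℝ b (x + t • z) w) (by
      filter_upwards [eventually_line (h.eventually hx) z] with t ht
      exact h.deriv_b _ ht w)
    have := d1.unique d5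
    simp only [zero_smul, add_zero] at this
    rw [this]
    abel
  obtain ⟨e, he⟩ := h.exists_equiv hx
  set z := e.symm (ofCoords 0 1 0 0 * fderiv ℝ g x w) with hz
  have pz : fderiv ℝ g x z = ofCoords 0 1 0 0 * fderiv ℝ g x w := by
    rw [← he, hz, e.apply_symm_apply]
  have hp := h.fderiv_ne_zero hx hw
  have e1 := db2 z w
  rw [(h.smoothb x hx).isSymmSndFDerivAt two_le_smoothness z w, db2 w z, h.symm2 hx w z,
    h.deriv_b x hx w, h.deriv_b x hx z, pz] at e1
  generalize fderiv ℝ g x w = W at *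
  generalize fderiv ℝ (fderiv ℝ g) x z w = G at *
  set i := ofCoords 0 1 0 0 with hi
  simp only [sub_eq_add_neg, dot_add_left, dot_smul_left, ← neg_smul] at e1
  rw [dot_comm (i * W) W] at e1
  have e2 : ((fderiv ℝ k x w - k x * dot (b x) W) • i -
      (fderiv ℝ k x z - k x * dot (b x) (i * W)) • (1 : ℍ[ℝ])) * W = 0 := by
    rw [sub_mul, smul_mul_assoc, smul_mul_assoc, one_mul, ← sub_eq_zero.2 e1.symm]
    module
  have e3 := congrArg (fun q : ℍ[ℝ] => q.imI) ((mul_eq_zero.1 e2).resolve_right hp)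
  simp [hi] at e3
  linear_combination e3

/-- The pole moves along its own direction, so as a point of ℝP⁵ it is the same for all points of a
segment: it is the center of projection. -/
theorem hasDerivAt_lightPole (h : ClassicalMap g b ℓ k Ω) {x v : ℍ[ℝ]} {t : ℝ}
    (hx : x + t • v ∈ Ω) :
    HasDerivAt (fun t : ℝ => lightPole (g (x + t • v)) (b (x + t • v)) (k (x + t • v)))
      (dot (b (x + t • v)) (fderiv ℝ g (x + t • v) v) •
        lightPole (g (x + t • v)) (b (x + t • v)) (k (x + t • v))) t := by
  have dg := hasDerivAt_line ((h.smooth _ hx).differentiableAt (by simp)) (z := v)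
  have db := hasDerivAt_line ((h.smoothb _ hx).differentiableAt (by simp)) (z := v)
  have dk := hasDerivAt_line ((h.smoothk _ hx).differentiableAt (by simp)) (z := v)
  rw [h.deriv_b _ hx] at db
  rw [h.deriv_k hx] at dk
  refine ((db.add (dk.smul dg)).prodMk ((((hasDerivAt_dot dg db).const_mul 2).const_add 2 |>.add
    (dk.mul (hasDerivAt_dot dg dg))).prodMk dk)).congr_deriv ?_
  generalize x + t • v = y
  simp only [lightPole, Prod.smul_mk, Prod.mk.injEq, smul_eq_mul]
  refine ⟨by module, ?_, mul_comm _ _⟩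
  simp only [sub_eq_add_neg, dot_add_right, dot_smul_right, ← neg_smul]
  rw [dot_comm (fderiv ℝ g y v) (b y), dot_comm (fderiv ℝ g y v) (g y)]
  ring

/-- A classical map is a central projection to the light cone. -/
theorem central_projection (h : ClassicalMap g b ℓ k Ω) {x v : ℍ[ℝ]}
    (hv : ∀ t ∈ Icc (0 : ℝ) 1, x + t • v ∈ Ω) :
    ∃ c τ : ℝ, lightLift (g (x + v)) = c • (lightLift (g x) + (lightLiftDeriv (g x) (fderiv ℝ g x v) -
      ((1 / 2) * ℓ x v) • lightLift (g x))) + τ • lightPole (g x) (b x) (k x) := by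
  set P : ℝ → ℍ[ℝ] × ℝ × ℝ := fun t => lightPole (g (x + t • v)) (b (x + t • v)) (k (x + t • v))
    with hP
  set Φ : ℝ → ℍ[ℝ] × ℝ × ℝ := fun t => lightLift (g (x + t • v)) with hΦ
  set a : ℝ → ℝ := fun t => (1 / 2) * ℓ (x + t • v) v with ha
  set Φ' : ℝ → ℍ[ℝ] × ℝ × ℝ := fun t => lightLiftDeriv (g (x + t • v)) (fderiv ℝ g (x + t • v) v)
    with hΦ'
  set N : ℝ → ℝ := fun t => dot (fderiv ℝ g (x + t • v) v) (fderiv ℝ g (x + t • v) v) with hN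
  have dΦ : ∀ t ∈ Icc (0 : ℝ) 1, HasDerivAt Φ (Φ' t) t := fun t ht =>
    hasDerivAt_lightLift (hasDerivAt_line ((h.smooth _ (hv t ht)).differentiableAt (by simp)))
  have da : ∀ t ∈ Icc (0 : ℝ) 1, HasDerivAt a (a t * a t - k (x + t • v) * N t) t := by
    intro t ht
    refine ((hasDerivAt_line_apply ((h.smoothl _ (hv t ht)).differentiableAt (by simp))
      v).const_mul (1 / 2)).congr_deriv ?_
    rw [h.deriv_l _ (hv t ht)]
    ring
  have dΦ' : ∀ t ∈ Icc (0 : ℝ) 1,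
      HasDerivAt Φ' ((2 * a t) • Φ' t + N t • (P t - k (x + t • v) • Φ t)) t := by
    intro t ht
    have d0 := hasDerivAt_line ((h.smooth _ (hv t ht)).differentiableAt (by simp)) (z := v)
    have d1 := hasDerivAt_line_apply ((h.smooth1 (hv t ht)).differentiableAt (by simp)) v
    have e : fderiv ℝ (fderiv ℝ g) (x + t • v) v v = (2 * a t) • fderiv ℝ g (x + t • v) v +
        N t • b (x + t • v) := by
      refine smul_right_injective _ (two_ne_zero : (2 : ℝ) ≠ 0) ?_
      simp only
      rw [h.second _ (hv t ht)]
      simp only [ha, hN]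
      module
    rw [e] at d1
    refine (d1.prodMk (((hasDerivAt_dot d0 d1).const_mul 2).prodMk
      (hasDerivAt_const t 0))).congr_deriv ?_
    simp only [hΦ', hP, hΦ, lightPole, lightLift, lightLiftDeriv, Prod.smul_mk, Prod.mk_add_mk,
      Prod.mk_sub_mk, Prod.mk.injEq, smul_eq_mul]
    refine ⟨by module, ?_, by ring⟩
    simp only [dot_add_right, dot_smul_right, hN]
    ring
  obtain ⟨φ, hφ⟩ := SeparatingDual.exists_eq_one (R := ℝ) (lightPole_ne_zero (g x) (b x) (k x))
  set π : (ℍ[ℝ] × ℝ × ℝ) →L[ℝ] (ℍ[ℝ] × ℝ × ℝ) :=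
    ContinuousLinearMap.id ℝ _ - φ.smulRight (lightPole (g x) (b x) (k x)) with hπ
  have hP0 : P 0 = lightPole (g x) (b x) (k x) := by simp [hP]
  have hπP : ∀ t ∈ Icc (0 : ℝ) 1, π (P t) = 0 := by
    intro t ht
    have hc : ContinuousOn (fun t : ℝ => dot (b (x + t • v)) (fderiv ℝ g (x + t • v) v))
        (Icc 0 1) := by
      intro t ht
      have d1 := hasDerivAt_line ((h.smoothb _ (hv t ht)).differentiableAt (by simp)) (z := v)
      have d2 := hasDerivAt_line_apply ((h.smooth1 (hv t ht)).differentiableAt (by simp)) v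
      exact (hasDerivAt_dot d1 d2).continuousAt.continuousWithinAt
    obtain ⟨μ, hμ⟩ := exists_smul_of_scalar_ode hc
      (fun t ht => h.hasDerivAt_lightPole (hv t ht)) t ht
    have : P t = μ • P 0 := hμ
    rw [this, hP0, map_smul]
    simp [hπ, hφ]
  -- Modulo the pole, Y' = aY and (Φ − tY)' = a(Φ − tY). Both are multiplied by the same scalar μ
  -- between t = 0 and t = 1, so Φ(1) is μ(Φ(0) + Y(0)) modulo the pole. The projection π along the
  -- pole expresses this reduction.
  set Y : ℝ → ℍ[ℝ] × ℝ × ℝ := fun t => Φ' t - a t • Φ t with hY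
  have dY : ∀ t ∈ Icc (0 : ℝ) 1, HasDerivAt Y (a t • Y t + N t • P t) t := by
    intro t ht
    refine ((dΦ' t ht).sub ((da t ht).smul (dΦ t ht))).congr_deriv ?_
    simp only [hY]
    module
  have dX : ∀ t ∈ Icc (0 : ℝ) 1, HasDerivAt (fun t => (π (Φ t - t • Y t), π (Y t)))
      (a t • (π (Φ t - t • Y t), π (Y t))) t := by
    intro t ht
    have d1 := π.hasFDerivAt.comp_hasDerivAt t (dY t ht)
    have d2 := π.hasFDerivAt.comp_hasDerivAt t ((dΦ t ht).sub ((hasDerivAt_id t).smul (dY t ht)))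
    refine (d2.prodMk d1).congr_deriv ?_
    simp only [Prod.smul_mk, Prod.mk.injEq, map_add, map_sub, map_smul, hπP t ht, hY, id, smul_zero]
    refine ⟨by module, by module⟩
  obtain ⟨μ, hμ⟩ := exists_smul_of_scalar_ode
    (fun t ht => (da t ht).continuousAt.continuousWithinAt) dX 1 (by simp)
  simp only [Prod.smul_mk, Prod.mk.injEq, one_smul, zero_smul, sub_zero] at hμ
  obtain ⟨h1, h2⟩ := hμ
  have h3 : π (Φ 1) = μ • π (Φ 0 + Y 0) := by
    rw [map_add, smul_add, ← h1, ← h2, ← map_add]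
    congr 1
    abel
  have h4 : Φ 1 = lightLift (g (x + v)) := by simp [hΦ]
  have h5 : Φ 0 + Y 0 = lightLift (g x) + (lightLiftDeriv (g x) (fderiv ℝ g x v) -
      ((1 / 2) * ℓ x v) • lightLift (g x)) := by simp [hΦ, hY, hΦ', ha]
  rw [h4, h5] at h3
  set I := lightLift (g x) + (lightLiftDeriv (g x) (fderiv ℝ g x v) -
      ((1 / 2) * ℓ x v) • lightLift (g x))
  refine ⟨μ, φ (lightLift (g (x + v))) - μ * φ I, ?_⟩
  have h6 : lightLift (g (x + v)) - φ (lightLift (g (x + v))) • lightPole (g x) (b x) (k x) =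
      μ • (I - φ I • lightPole (g x) (b x) (k x)) := h3
  refine (sub_eq_iff_eq_add.1 h6).trans ?_
  module

end ClassicalMap

/-! ### The local form of circle maps -/

/-- The local form of the left Hopf fibrations. -/
def HasHopfForm (g : ℍ[ℝ] → ℍ[ℝ]) (x : ℍ[ℝ]) : Prop :=
  ∃ a : ℍ[ℝ] →L[ℝ] ℍ[ℝ], ∀ᶠ v in 𝓝 (0 : ℍ[ℝ]),
    (1 - a v) * g (x + v) = g x + (fderiv ℝ g x v - a v * g x)

/-- The local form of the central projections. -/
def HasClassicalForm (g : ℍ[ℝ] → ℍ[ℝ]) (x : ℍ[ℝ]) : Prop :=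
  ∃ (b : ℍ[ℝ]) (k : ℝ) (l : ℍ[ℝ] →L[ℝ] ℝ), ∀ᶠ v in 𝓝 (0 : ℍ[ℝ]), ∃ c τ : ℝ,
    lightLift (g (x + v)) = c • (lightLift (g x) + (lightLiftDeriv (g x) (fderiv ℝ g x v) -
      l v • lightLift (g x))) + τ • lightPole (g x) b k

theorem eventually_segment {Ω : Set ℍ[ℝ]} (hΩ : IsOpen Ω) {x : ℍ[ℝ]} (hx : x ∈ Ω) :
    ∀ᶠ v in 𝓝 (0 : ℍ[ℝ]), ∀ t ∈ Icc (0 : ℝ) 1, x + t • v ∈ Ω := by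
  obtain ⟨ε, hε, hb⟩ := Metric.isOpen_iff.1 hΩ x hx
  filter_upwards [Metric.ball_mem_nhds (0 : ℍ[ℝ]) hε] with v hv t ht
  refine hb ?_
  rw [mem_ball_zero_iff] at hv
  rw [mem_ball_iff_norm, add_sub_cancel_left, norm_smul, Real.norm_of_nonneg ht.1]
  exact (mul_le_of_le_one_left (norm_nonneg v) ht.2).trans_lt hv

/-- The dichotomy between Hopf fibrations and central projections is whether σ vanishes identically;
if not, one restricts to the open set where σ ≠ 0. -/
theorem LeftCircleMap.local_form {g : ℍ[ℝ] → ℍ[ℝ]} {A : ℍ[ℝ] → ℍ[ℝ] →L[ℝ] ℍ[ℝ]} {Ω : Set ℍ[ℝ]}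
    (h : LeftCircleMap g A Ω) (hne : Ω.Nonempty) :
    ∃ x ∈ Ω, HasHopfForm g x ∨ HasClassicalForm g x := by
  obtain ⟨σ, hs, hS⟩ := h.exists_schwarzian
  by_cases hσ : ∀ x ∈ Ω, σ x = 0
  · obtain ⟨x, hx⟩ := hne
    refine ⟨x, hx, Or.inl ⟨(1 / 2 : ℝ) • A x, ?_⟩⟩
    filter_upwards [eventually_segment h.isOpen hx] with v hv
    have := h.quotient_of_affine (fun y hy w => sub_eq_zero.1 (by
      rw [hS y hy, hσ y hy, zero_smul])) hv
    simpa using this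
  · push Not at hσ
    obtain ⟨x, hx, hne⟩ := hσ
    have ho : IsOpen {y ∈ Ω | σ y ≠ 0} := isOpen_iff_mem_nhds.2 fun y hy =>
      (h.eventually hy.1).and ((hs y hy.1).continuousAt.eventually_ne hy.2)
    obtain ⟨b, ℓ, k, hc⟩ := (h.mono ho fun y hy => hy.1).exists_classical
      (fun y hy => hs y hy.1) (fun y hy => hS y hy.1) fun y hy => hy.2
    refine ⟨x, hx, Or.inr ⟨b x, k x, (1 / 2 : ℝ) • ℓ x, ?_⟩⟩
    filter_upwards [eventually_segment ho ⟨hx, hne⟩] with v hv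
    exact hc.central_projection hv

/-- Conjugation preserves the local form of the central projections. -/
theorem HasClassicalForm.of_star {g : ℍ[ℝ] → ℍ[ℝ]} {x : ℍ[ℝ]} (hg : DifferentiableAt ℝ g x)
    (h : HasClassicalForm (fun y => star (g y)) x) : HasClassicalForm g x := by
  obtain ⟨b, k, l, h⟩ := h
  refine ⟨star b, k, l, ?_⟩
  filter_upwards [h] with v ⟨c, τ, hv⟩
  refine ⟨c, τ, ?_⟩
  have hd : ∀ a b : ℍ[ℝ], dot (star a) b = dot a (star b) := by
    intro a b
    simp [dot]
  rw [CircleMap.fderiv_star_comp hg] at hv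
  simp only [lightLift, lightLiftDeriv, lightPole, Prod.smul_mk, Prod.mk_add_mk, Prod.mk_sub_mk,
    Prod.mk.injEq, ContinuousLinearMap.comp_apply, starL_apply, hd, star_star] at hv ⊢
  obtain ⟨h1, h2, h3⟩ := hv
  refine ⟨?_, h2, h3⟩
  rw [← star_star (g (x + v)), h1]
  simp only [star_add, star_sub, Quaternion.star_smul, star_star]

theorem CircleMap.local_form {g : ℍ[ℝ] → ℍ[ℝ]} {Ω : Set ℍ[ℝ]} (h : CircleMap g Ω)
    (hne : Ω.Nonempty) :
    ∃ x ∈ Ω, HasClassicalForm g x ∨ HasHopfForm g x ∨ HasHopfForm (fun y => Star.star (g y)) x := by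
  obtain ⟨Ω', hs, hne', A, hA | hA⟩ := h.left_or_right hne
  · obtain ⟨x, hx, h1 | h1⟩ := hA.local_form hne'
    · exact ⟨x, hs hx, Or.inr (Or.inl h1)⟩
    · exact ⟨x, hs hx, Or.inl h1⟩
  · obtain ⟨x, hx, h1 | h1⟩ := hA.local_form hne'
    · exact ⟨x, hs hx, Or.inr (Or.inr h1)⟩
    · exact ⟨x, hs hx, Or.inl (h1.of_star ((h.smooth x (hs hx)).differentiableAt (by simp)))⟩

/-! ### Coordinates on the sphere -/

/-- The projection of `ℝ⁵` to the equatorial hyperplane, which is identified with `ℍ`. -/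
def quatPart : E5 →L[ℝ] ℍ[ℝ] :=
  LinearMap.toContinuousLinearMap
    ⟨⟨fun X => ofCoords (X 0) (X 1) (X 2) (X 3), fun X Y => by ext <;> simp⟩,
      fun c X => by ext <;> simp⟩

@[simp] theorem quatPart_apply (X : E5) : quatPart X = ofCoords (X 0) (X 1) (X 2) (X 3) := rfl

/-- The last coordinate of a point of `ℝ⁵`. -/
def lastPart : E5 →L[ℝ] ℝ := EuclideanSpace.proj 4

@[simp] theorem lastPart_apply (X : E5) : lastPart X = X 4 := rfl

/-- The identification of the light cones over `S⁴` and over `ℍ`. -/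
def lightEquiv : (E5 × ℝ) ≃ₗ[ℝ] ℍ[ℝ] × ℝ × ℝ where
  toFun X := (quatPart X.1, X.2 + X.1 4, X.2 - X.1 4)
  invFun X := (!₂[X.1.re, X.1.imI, X.1.imJ, X.1.imK, (X.2.1 - X.2.2) / 2], (X.2.1 + X.2.2) / 2)
  map_add' X Y := by
    simp only [Prod.fst_add, Prod.snd_add, map_add, PiLp.add_apply, Prod.mk_add_mk, Prod.mk.injEq,
      true_and]
    constructor <;> ring
  map_smul' c X := by
    simp only [Prod.smul_fst, Prod.smul_snd, map_smul, PiLp.smul_apply, Prod.smul_mk,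
      Prod.mk.injEq, smul_eq_mul, RingHom.id_apply, true_and]
    constructor <;> ring
  left_inv X := by
    ext i
    · fin_cases i <;> simp
    · simp
  right_inv X := by
    ext <;> simp <;> ring

theorem lightEquiv_apply (X : E5) (t : ℝ) : lightEquiv (X, t) = (quatPart X, t + X 4, t - X 4) := rfl

/-- The stereographic projection. -/
def stereo (X : E5) : ℍ[ℝ] := (1 - lastPart X)⁻¹ • quatPart X

theorem normSq_quatPart {X : E5} (h : ‖X‖ = 1) :
    dot (quatPart X) (quatPart X) = (1 - X 4) * (1 + X 4) := by
  have h1 := EuclideanSpace.real_norm_sq_eq X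
  rw [h, Fin.sum_univ_five] at h1
  simp [dot]
  linear_combination -h1

/-- Stereographic projection is a linear change of coordinates on the light cone, up to scale. So
linear conditions on (X, 1) become linear conditions on the lift of the stereographic image. -/
theorem lightEquiv_eq_smul {X : E5} (h : ‖X‖ = 1) (h4 : X 4 ≠ 1) :
    lightEquiv (X, 1) = (1 - X 4) • lightLift (stereo X) := by
  have h5 : 1 - X 4 ≠ 0 := sub_ne_zero.2 h4.symm
  simp only [lightEquiv_apply, lightLift, stereo, lastPart_apply, dot_smul_left, dot_smul_right,
    normSq_quatPart h, Prod.smul_mk, smul_smul, mul_inv_cancel₀ h5, one_smul, Prod.mk.injEq,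
    smul_eq_mul, true_and]
  constructor <;> field_simp

theorem invStereo_stereo {X : S4} (h4 : (X : E5) 4 ≠ 1) :
    invStereo (stereo X : OnePoint ℍ[ℝ]) = X := by
  have h5 : 1 - (X : E5) 4 ≠ 0 := sub_ne_zero.2 h4.symm
  have h1 := normSq_quatPart (mem_sphere_zero_iff_norm.1 X.2)
  rw [dot_self] at h1
  have h2 : Quaternion.normSq (stereo X) = (1 - (X : E5) 4)⁻¹ * (1 + (X : E5) 4) := by
    rw [stereo, Quaternion.normSq_smul, h1, lastPart_apply]
    field_simp
  have h3 : 1 + (1 - (X : E5) 4)⁻¹ * (1 + (X : E5) 4) = 2 * (1 - (X : E5) 4)⁻¹ := by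
    field_simp
    ring
  have e : (invStereo (stereo X : OnePoint ℍ[ℝ]) : E5) = (1 + Quaternion.normSq (stereo X))⁻¹ •
      !₂[2 * (stereo X).re, 2 * (stereo X).imI, 2 * (stereo X).imJ, 2 * (stereo X).imK,
        Quaternion.normSq (stereo X) - 1] := rfl
  ext i
  rw [e, h2, h3]
  fin_cases i <;> simp [stereo] <;> field_simp
  ring

theorem quatPart_eq_zero {X : E5} (h : ‖X‖ = 1) (h4 : X 4 = 1) : quatPart X = 0 := by
  have h1 := normSq_quatPart h
  rw [h4, sub_self, zero_mul, dot_self] at h1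
  exact Quaternion.normSq_eq_zero.1 h1

theorem eq_northPole {X : S4} (h4 : (X : E5) 4 = 1) : invStereo OnePoint.infty = X := by
  have h1 := quatPart_eq_zero (mem_sphere_zero_iff_norm.1 X.2) h4
  have e : (invStereo OnePoint.infty : E5) = !₂[0, 0, 0, 0, 1] := rfl
  have e0 := congrArg (fun q : ℍ[ℝ] => q.re) h1
  have e1 := congrArg (fun q : ℍ[ℝ] => q.imI) h1
  have e2 := congrArg (fun q : ℍ[ℝ] => q.imJ) h1
  have e3 := congrArg (fun q : ℍ[ℝ] => q.imK) h1
  simp at e0 e1 e2 e3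
  ext i
  rw [e]
  fin_cases i <;> simp [e0, e1, e2, e3, h4]

/-! ### Maps of cones to the sphere -/

/-- The cone over a set of points of the projective space, without the origin. -/
def cone (U : Set RP4) : Set E5 := {v | ∃ hv : v ≠ 0, Projectivization.mk ℝ v hv ∈ U}

theorem isOpen_cone {U : Set RP4} (hU : IsOpen U) : IsOpen (cone U) := by
  have h1 : IsOpen ((Projectivization.mk' ℝ : {v : E5 // v ≠ 0} → RP4) ⁻¹' U) :=
    isOpen_coinduced.1 hU
  have h2 := (isOpen_ne (x := (0 : E5))).isOpenMap_subtype_val _ h1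
  convert h2 using 1
  ext v
  constructor
  · rintro ⟨hv, h⟩
    exact ⟨⟨v, hv⟩, h, rfl⟩
  · rintro ⟨⟨v, hv⟩, h, rfl⟩
    exact ⟨hv, h⟩

theorem mk_smul_eq {v : E5} (hv : v ≠ 0) {r : ℝ} (hr : r ≠ 0) :
    Projectivization.mk ℝ (r • v) (smul_ne_zero hr hv) = Projectivization.mk ℝ v hv :=
  (Projectivization.mk_eq_mk_iff' _ _ _ _ _).2 ⟨r, rfl⟩

theorem smul_mem_cone {U : Set RP4} {v : E5} (hv : v ∈ cone U) {r : ℝ} (hr : r ≠ 0) :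
    r • v ∈ cone U := by
  obtain ⟨h0, h⟩ := hv
  exact ⟨smul_ne_zero hr h0, by rwa [mk_smul_eq h0 hr]⟩

/-- Analytic maps of open cones to the unit sphere that are constant along the rulings, are
immersions transversally to the rulings, and take lines to plane curves. -/
structure ConeMap (F : E5 → E5) (C : Set E5) : Prop where
  isOpen : IsOpen C
  ne_zero : ∀ v ∈ C, v ≠ 0
  smul_mem : ∀ v ∈ C, ∀ r : ℝ, r ≠ 0 → r • v ∈ C
  analyticAt : ∀ v ∈ C, AnalyticAt ℝ F v
  norm_eq : ∀ v ∈ C, ‖F v‖ = 1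
  homogeneous : ∀ v ∈ C, ∀ r : ℝ, r ≠ 0 → F (r • v) = F v
  ker : ∀ v ∈ C, ∀ w, fderiv ℝ F v w = 0 → ∃ r : ℝ, w = r • v
  plane : ∀ u v : E5, LinearIndependent ℝ ![u, v] → segment ℝ u v ⊆ C →
    ∃ P : AffineSubspace ℝ E5, Module.finrank ℝ P.direction = 2 ∧ ∀ w ∈ segment ℝ u v, F w ∈ P

/-- Near v one has G(F(u)) = c(u)u with c(v) ≠ 0, and c is differentiable as a quotient of inner
products. Differentiating in the direction w gives 0 = Dc(w)v + c(v)w. -/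
theorem ker_of_local_inverse {F G : E5 → E5} {v w : E5} (hv : v ≠ 0) (hF : DifferentiableAt ℝ F v)
    (hG : DifferentiableAt ℝ G (F v))
    (h : ∀ᶠ u in 𝓝 v, G (F u) ≠ 0 ∧ ∃ a : ℝ, G (F u) = a • u) (hw : fderiv ℝ F v w = 0) :
    ∃ r : ℝ, w = r • v := by
  set H : E5 → E5 := fun u => G (F u) with hH
  set c : E5 → ℝ := fun u => inner ℝ (H u) u / inner ℝ u u with hc
  have hH' : HasFDerivAt H ((fderiv ℝ G (F v)).comp (fderiv ℝ F v)) v :=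
    hG.hasFDerivAt.comp v hF.hasFDerivAt
  have hvv : (inner ℝ v v : ℝ) ≠ 0 := by simpa using hv
  have hn : DifferentiableAt ℝ (fun u => (inner ℝ (H u) u : ℝ)) v :=
    hH'.differentiableAt.inner ℝ differentiableAt_fun_id
  have hq : DifferentiableAt ℝ (fun u : E5 => (inner ℝ u u : ℝ)) v :=
    differentiableAt_fun_id.inner ℝ differentiableAt_fun_id
  have hcd : DifferentiableAt ℝ c v := by
    simp only [hc, div_eq_mul_inv]
    exact hn.mul (hq.inv hvv)
  have key : ∀ᶠ u in 𝓝 v, H u = c u • u := by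
    filter_upwards [h, (continuousAt_id (x := v)).eventually_ne hv] with u ⟨_, a, ha⟩ hu
    have huu : (inner ℝ u u : ℝ) ≠ 0 := by simpa using hu
    have : c u = a := by
      simp only [hc, hH]
      rw [ha, real_inner_smul_left, mul_div_assoc, div_self huu, mul_one]
    rw [this]
    exact ha
  have d1 := hasDerivAt_line_zero hH'.differentiableAt w
  have hid : HasDerivAt (fun t : ℝ => v + t • w) w 0 := by
    simpa using ((hasDerivAt_id (0 : ℝ)).smul_const w).const_add v
  have d2 := ((hasDerivAt_line_zero hcd w).smul hid).congr_of_eventuallyEq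
    (f₁ := fun t : ℝ => H (v + t • w)) (eventually_line key w)
  have e := d1.unique d2
  rw [hH'.fderiv, ContinuousLinearMap.comp_apply, hw, map_zero] at e
  simp only [zero_smul, add_zero] at e
  have hc0 : c v ≠ 0 := by
    intro h0
    have := key.self_of_nhds
    rw [h0, zero_smul] at this
    exact h.self_of_nhds.1 this
  refine ⟨-((c v)⁻¹ * fderiv ℝ c v w), ?_⟩
  refine smul_right_injective _ hc0 ?_
  simp only
  rw [smul_smul, mul_neg, ← mul_assoc, mul_inv_cancel₀ hc0, one_mul, neg_smul]
  exact eq_neg_of_add_eq_zero_left e.symm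

theorem coneMap_of_diffeo {U : Set RP4} {V : Set S4} {f : RP4 → S4} (hf : IsAnalyticDiffeo f U V)
    (hl : TakesLinesToCircles f U) : ∃ F, ConeMap F (cone U) ∧
      ∀ v (hv : v ≠ 0), Projectivization.mk ℝ v hv ∈ U → F v = f (Projectivization.mk ℝ v hv) := by
  obtain ⟨F, hF⟩ := hf.analytic
  obtain ⟨g, hgm, hinv, hg⟩ := hf.exists_inverse
  refine ⟨F, ⟨isOpen_cone hf.isOpen_source, fun v hv => hv.1, fun v hv r hr => smul_mem_cone hv hr,
    fun v ⟨h0, hv⟩ => (hF v h0 hv).1, fun v ⟨h0, hv⟩ => ?_, fun v ⟨h0, hv⟩ r hr => ?_,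
    fun v ⟨h0, hv⟩ w hw => ?_, fun u v hi hs => ?_⟩, fun v h0 hv => (hF v h0 hv).2⟩
  · rw [(hF v h0 hv).2]
    exact mem_sphere_zero_iff_norm.1 (f _).2
  · rw [(hF v h0 hv).2, (hF (r • v) (smul_ne_zero hr h0) (by rwa [mk_smul_eq h0 hr])).2,
      mk_smul_eq h0 hr]
  · obtain ⟨G, hG, hGz⟩ := hg _ (hf.mapsTo hv)
    have hFv := (hF v h0 hv).2
    rw [← hFv] at hG
    refine ker_of_local_inverse h0 (hF v h0 hv).1.differentiableAt hG.differentiableAt ?_ hw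
    rw [nhds_subtype_eq_comap, eventually_comap, ← hFv] at hGz
    filter_upwards [(hF v h0 hv).1.continuousAt.eventually hGz,
      (isOpen_cone hf.isOpen_source).mem_nhds ⟨h0, hv⟩] with u hu ⟨hu0, huU⟩
    have hFu := (hF u hu0 huU).2
    obtain ⟨h1, h2⟩ := hu (f (Projectivization.mk ℝ u hu0)) hFu.symm
    rw [hinv.1 huU] at h2
    rw [hFu]
    refine ⟨h1, ?_⟩
    obtain ⟨a, ha⟩ := (Projectivization.mk_eq_mk_iff' _ _ _ _ _).1 h2.symm
    exact ⟨a, ha.symm⟩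
  · obtain ⟨-, -, C, ⟨-, P, hP, rfl⟩, hsub⟩ := hl u v hi (by
      rintro x ⟨w, hw, hw0, rfl⟩
      exact (hs hw).2)
    refine ⟨P, hP, fun w hw => ?_⟩
    obtain ⟨hw0, hwU⟩ := hs hw
    rw [(hF w hw0 hwU).2]
    exact hsub ⟨_, ⟨w, hw, hw0, rfl⟩, rfl⟩

/-! ### Affine charts -/

theorem exists_chart {v : E5} (hv : v ≠ 0) : ∃ D : (ℝ × ℍ[ℝ]) ≃L[ℝ] E5, D (1, 0) = v := by
  have hd : Module.finrank ℝ (ℝ × ℍ[ℝ]) = Module.finrank ℝ E5 := by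
    simp [Quaternion.finrank_eq_four]
  set D := ContinuousLinearEquiv.ofFinrankEq hd
  obtain ⟨A, hA⟩ := SeparatingDual.exists_continuousLinearEquiv_apply_eq (R := ℝ)
    (x := D (1, 0)) (y := v) (by simp) hv
  exact ⟨D.trans A, hA⟩

namespace ConeMap

variable {F : E5 → E5} {C : Set E5}

/-- A cone map in the affine chart given by `D`. -/
def chart (F : E5 → E5) (D : (ℝ × ℍ[ℝ]) ≃L[ℝ] E5) (x : ℍ[ℝ]) : ℍ[ℝ] := stereo (F (D (1, x)))

/-- The domain of the chart. -/
def chartDomain (F : E5 → E5) (C : Set E5) (D : (ℝ × ℍ[ℝ]) ≃L[ℝ] E5) : Set ℍ[ℝ] :=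
  {x | D (1, x) ∈ C ∧ F (D (1, x)) 4 ≠ 1}

variable (D : (ℝ × ℍ[ℝ]) ≃L[ℝ] E5)

theorem contDiff_inl : ContDiff ℝ ∞ fun x : ℍ[ℝ] => D (1, x) :=
  D.contDiff.comp (contDiff_const.prodMk contDiff_id)

theorem isOpen_chartDomain (h : ConeMap F C) : IsOpen (chartDomain F C D) := by
  refine isOpen_iff_mem_nhds.2 fun x hx => ?_
  have hc : ContinuousAt (fun x : ℍ[ℝ] => D (1, x)) x := (contDiff_inl D).continuous.continuousAt
  have h2 : ContinuousAt (fun x : ℍ[ℝ] => lastPart (F (D (1, x)))) x :=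
    lastPart.continuous.continuousAt.comp
      (ContinuousAt.comp (f := fun x : ℍ[ℝ] => D (1, x)) (h.analyticAt _ hx.1).continuousAt hc)
  exact (hc.eventually (h.isOpen.mem_nhds hx.1)).and (h2.eventually_ne hx.2)

theorem contDiffAt_chart (h : ConeMap F C) {x : ℍ[ℝ]} (hx : x ∈ chartDomain F C D) :
    ContDiffAt ℝ ∞ (chart F D) x := by
  have h1 : ContDiffAt ℝ ∞ (fun x : ℍ[ℝ] => F (D (1, x))) x :=
    ContDiffAt.comp (f := fun x : ℍ[ℝ] => D (1, x)) x (h.analyticAt _ hx.1).contDiffAt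
      (contDiff_inl D).contDiffAt
  exact ((contDiffAt_const.sub (lastPart.contDiff.contDiffAt.comp x h1)).inv
    (sub_ne_zero.2 hx.2.symm)).smul (quatPart.contDiff.contDiffAt.comp x h1)

/-- The inverse stereographic projection. -/
def unstereo (q : ℍ[ℝ]) : E5 := (lightEquiv.symm ((1 + dot q q)⁻¹ • (2 : ℝ) • lightLift q)).1

theorem unstereo_stereo {X : E5} (h : ‖X‖ = 1) (h4 : X 4 ≠ 1) : unstereo (stereo X) = X := by
  have h5 : 1 - X 4 ≠ 0 := sub_ne_zero.2 h4.symm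
  have h1 : dot (stereo X) (stereo X) = (1 - X 4)⁻¹ * (1 + X 4) := by
    simp only [stereo, dot_smul_left, dot_smul_right, lastPart_apply, normSq_quatPart h]
    field_simp
  have h2 : (1 + dot (stereo X) (stereo X))⁻¹ * 2 = 1 - X 4 := by
    rw [h1]
    field_simp
    ring
  rw [unstereo, smul_smul, h2, ← lightEquiv_eq_smul h h4, LinearEquiv.symm_apply_apply]

theorem differentiable_unstereo : Differentiable ℝ unstereo := by
  intro q
  have h0 : 1 + dot q q ≠ 0 := by
    rw [dot_self]
    have := Quaternion.normSq_nonneg (a := q)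
    positivity
  have h1 : DifferentiableAt ℝ (fun q : ℍ[ℝ] => dot q q) q := by
    simp only [dot_eq_inner]
    exact differentiableAt_id.inner ℝ differentiableAt_id
  have h2 : DifferentiableAt ℝ (fun q : ℍ[ℝ] => (1 + dot q q)⁻¹ • (2 : ℝ) • lightLift q) q :=
    ((h1.const_add 1).inv h0).smul ((differentiableAt_id.prodMk (h1.prodMk
      (differentiableAt_const _))).const_smul (2 : ℝ))
  exact (ContinuousLinearMap.fst ℝ E5 ℝ).differentiableAt.comp q
    ((LinearMap.toContinuousLinearMap (lightEquiv.symm : _ →ₗ[ℝ] E5 × ℝ)).differentiableAt.comp q h2)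

theorem injective_fderiv_chart (h : ConeMap F C) {x : ℍ[ℝ]} (hx : x ∈ chartDomain F C D) :
    Function.Injective (fderiv ℝ (chart F D) x) := by
  rw [injective_iff_map_eq_zero]
  intro w hw
  have hev : (fun y => F (D (1, y))) =ᶠ[𝓝 x] fun y => unstereo (chart F D y) := by
    filter_upwards [(isOpen_chartDomain D h).mem_nhds hx] with y hy
    exact (unstereo_stereo (h.norm_eq _ hy.1) hy.2).symm
  have h1 : HasFDerivAt (fun y => unstereo (chart F D y))
      ((fderiv ℝ unstereo (chart F D x)).comp (fderiv ℝ (chart F D) x)) x :=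
    (differentiable_unstereo _).hasFDerivAt.comp x
      ((contDiffAt_chart D h hx).differentiableAt (by simp)).hasFDerivAt
  have hin : HasFDerivAt (fun y : ℍ[ℝ] => D (1, y))
      ((D : (ℝ × ℍ[ℝ]) →L[ℝ] E5).comp (ContinuousLinearMap.inr ℝ ℝ ℍ[ℝ])) x :=
    (D : (ℝ × ℍ[ℝ]) →L[ℝ] E5).hasFDerivAt.comp x (hasFDerivAt_prodMk_right 1 x)
  have h2 : HasFDerivAt (fun y => F (D (1, y))) ((fderiv ℝ F (D (1, x))).comp
      ((D : (ℝ × ℍ[ℝ]) →L[ℝ] E5).comp (ContinuousLinearMap.inr ℝ ℝ ℍ[ℝ]))) x :=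
    HasFDerivAt.comp (f := fun y : ℍ[ℝ] => D (1, y)) x
      (h.analyticAt _ hx.1).differentiableAt.hasFDerivAt hin
  have e := congrArg (fun L : ℍ[ℝ] →L[ℝ] E5 => L w) (h2.unique (h1.congr_of_eventuallyEq hev))
  simp only [ContinuousLinearMap.comp_apply, hw, map_zero] at e
  obtain ⟨r, hr⟩ := h.ker _ hx.1 _ e
  have h3 : ((0, w) : ℝ × ℍ[ℝ]) = r • (1, x) := D.injective (by rw [map_smul]; exact hr)
  simp only [Prod.smul_mk, Prod.mk.injEq, smul_eq_mul, mul_one] at h3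
  rw [h3.2, ← h3.1, zero_smul]

/-- The lifts of the points of an affine plane span a space of dimension three. -/
theorem exists_lift_of_plane {P : AffineSubspace ℝ E5} (hP : Module.finrank ℝ P.direction = 2)
    {X₀ : E5} (h0 : X₀ ∈ P) : ∃ W : Submodule ℝ (ℍ[ℝ] × ℝ × ℝ), Module.finrank ℝ W ≤ 3 ∧
      ∀ X ∈ P, lightEquiv (X, 1) ∈ W := by
  set W₀ : Submodule ℝ (E5 × ℝ) := P.direction.map (LinearMap.inl ℝ E5 ℝ) ⊔ ℝ ∙ (X₀, (1 : ℝ)) with hW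
  refine ⟨W₀.map (lightEquiv : (E5 × ℝ) →ₗ[ℝ] ℍ[ℝ] × ℝ × ℝ), ?_, fun X hX => ?_⟩
  · refine (Submodule.finrank_map_le _ _).trans ((Submodule.finrank_add_le_finrank_add_finrank
      _ _).trans ?_)
    have h1 := Submodule.finrank_map_le (LinearMap.inl ℝ E5 ℝ) P.direction
    have h2 : Module.finrank ℝ (ℝ ∙ (X₀, (1 : ℝ))) ≤ 1 := (finrank_span_singleton (by simp)).le
    omega
  · refine Submodule.mem_map_of_mem ?_
    rw [show (X, (1 : ℝ)) = LinearMap.inl ℝ E5 ℝ (X - X₀) + (X₀, (1 : ℝ)) by simp]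
    exact Submodule.add_mem_sup
      (Submodule.mem_map_of_mem (AffineSubspace.vsub_mem_direction hX h0))
      (Submodule.mem_span_singleton_self _)

/-- The affine plane containing the image of a segment lifts to a subspace of ℝ⁶ of dimension at
most three, so `circle_equation` applies to each line of the chart. -/
theorem circleMap_chart (D : (ℝ × ℍ[ℝ]) ≃L[ℝ] E5) (h : ConeMap F C) :
    CircleMap (chart F D) (chartDomain F C D) := by
  have ho := isOpen_chartDomain D h
  have hs : ∀ x ∈ chartDomain F C D, ContDiffAt ℝ ∞ (chart F D) x := fun x hx =>
    contDiffAt_chart D h hx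
  refine ⟨ho, hs, fun x hx => injective_fderiv_chart D h hx, fun x hx w => ?_⟩
  rcases eq_or_ne w 0 with rfl | hw
  · exact ⟨0, by simp⟩
  have hs1 : ∀ x ∈ chartDomain F C D, ContDiffAt ℝ ∞ (fderiv ℝ (chart F D)) x := fun x hx =>
    (hs x hx).fderiv_right (by simp)
  have hs2 : ContDiffAt ℝ ∞ (fderiv ℝ (fderiv ℝ (chart F D))) x := (hs1 x hx).fderiv_right (by simp)
  have hev := eventually_line (ho.mem_nhds hx) w
  obtain ⟨ε, hε, hb⟩ := Metric.mem_nhds_iff.1 hev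
  -- Half of the radius keeps the closed segment inside the open ball of parameters.
  set u := D (1, x + (-(ε / 2)) • w) with hu
  set v := D (1, x + (ε / 2) • w) with hv
  have hcomb : ∀ a b : ℝ, a + b = 1 → a • u + b • v = D (1, x + ((b - a) * (ε / 2)) • w) := by
    intro a b hab
    rw [hu, hv, ← map_smul, ← map_smul, ← map_add]
    congr 1
    obtain rfl : a = 1 - b := by linarith
    simp only [Prod.smul_mk, Prod.mk_add_mk, Prod.mk.injEq, smul_eq_mul]
    exact ⟨by ring, by module⟩
  have hli : LinearIndependent ℝ ![u, v] := by
    rw [LinearIndependent.pair_iff]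
    intro a b hab
    rw [hu, hv, ← map_smul, ← map_smul, ← map_add, map_eq_zero_iff _ D.injective] at hab
    simp only [Prod.smul_mk, Prod.mk_add_mk, Prod.mk_eq_zero, smul_eq_mul, mul_one] at hab
    obtain ⟨h1, h2⟩ := hab
    obtain rfl : a = -b := by linarith
    have h3 : (b * ε) • w = 0 := by
      rw [← h2]
      module
    have h4 := (mul_eq_zero.1 ((smul_eq_zero.1 h3).resolve_right hw)).resolve_right hε.ne'
    simp [h4]
  obtain ⟨P, hP, hPF⟩ := h.plane u v hli (by
    rintro y ⟨a, b, ha, hb', hab, rfl⟩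
    rw [hcomb a b hab]
    have : (b - a) * (ε / 2) ∈ Metric.ball (0 : ℝ) ε := by
      rw [mem_ball_zero_iff, Real.norm_eq_abs, abs_lt]
      constructor <;> nlinarith
    exact (hb this).1)
  have hmem : ∀ t ∈ Metric.ball (0 : ℝ) (ε / 2), F (D (1, x + t • w)) ∈ P := by
    intro t ht
    rw [mem_ball_zero_iff, Real.norm_eq_abs, abs_lt] at ht
    refine hPF _ ⟨(1 - t / (ε / 2)) / 2, (1 + t / (ε / 2)) / 2, ?_, ?_, by ring, ?_⟩
    · have : t / (ε / 2) ≤ 1 := (div_le_one (by positivity)).2 ht.2.le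
      linarith
    · have : -1 ≤ t / (ε / 2) := by
        rw [le_div_iff₀ (by positivity)]
        linarith
      linarith
    · rw [hcomb _ _ (by ring)]
      congr 4
      field_simp
      ring
  obtain ⟨W, hW, hWm⟩ := exists_lift_of_plane hP (hmem 0 (Metric.mem_ball_self (by positivity)))
  have hd : HasDerivAt (fun t : ℝ => fderiv ℝ (fderiv ℝ (chart F D)) (x + t • w) w w)
      (fderiv ℝ (fderiv ℝ (fderiv ℝ (chart F D))) x w w w) 0 := by
    simpa using (hasDerivAt_line_apply_zero (hs2.differentiableAt (by simp)) w w).clm_apply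
      (hasDerivAt_const (0 : ℝ) w)
  obtain ⟨κ, hκ⟩ := circle_equation (γ := fun t : ℝ => chart F D (x + t • w))
    (γ1 := fun t : ℝ => fderiv ℝ (chart F D) (x + t • w) w)
    (γ2 := fun t : ℝ => fderiv ℝ (fderiv ℝ (chart F D)) (x + t • w) w w)
    (c3 := fderiv ℝ (fderiv ℝ (fderiv ℝ (chart F D))) x w w w)
    (by
      filter_upwards [hev] with t ht
      exact hasDerivAt_line ((hs _ ht).differentiableAt (by simp)))
    (by
      filter_upwards [hev] with t ht
      exact hasDerivAt_line_apply ((hs1 _ ht).differentiableAt (by simp)) w)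
    hd W hW (by
      filter_upwards [hev, Metric.ball_mem_nhds (0 : ℝ) (half_pos hε)] with t ht ht'
      have h1 := hWm _ (hmem t ht')
      rw [lightEquiv_eq_smul (h.norm_eq _ ht.1) ht.2] at h1
      exact (W.smul_mem_iff (sub_ne_zero.2 ht.2.symm)).1 h1)
  simp only [zero_smul, add_zero] at hκ
  exact ⟨κ, hκ⟩

end ConeMap

/-! ### The local forms in homogeneous coordinates -/

section Homogenize

variable (D : (ℝ × ℍ[ℝ]) ≃L[ℝ] E5)

/-- The affine coordinate in a chart. -/
def chartCoord (v : E5) : ℍ[ℝ] := (D.symm v).1⁻¹ • (D.symm v).2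

theorem smul_chartCoord {v : E5} (hv : (D.symm v).1 ≠ 0) :
    (D.symm v).1 • D (1, chartCoord D v) = v := by
  rw [← map_smul, chartCoord, Prod.smul_mk, smul_smul, mul_inv_cancel₀ hv, one_smul, smul_eq_mul,
    mul_one, Prod.mk.eta, D.apply_symm_apply]

theorem tendsto_chartCoord (x : ℍ[ℝ]) : Tendsto (chartCoord D) (𝓝 (D (1, x))) (𝓝 x) := by
  have h1 : Tendsto D.symm (𝓝 (D (1, x))) (𝓝 (1, x)) := by
    simpa using D.symm.continuous.tendsto (D (1, x))
  have h2 : Tendsto (fun v => (D.symm v).1⁻¹) (𝓝 (D (1, x))) (𝓝 1⁻¹) :=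
    ((continuous_fst.tendsto _).comp h1).inv₀ one_ne_zero
  have h3 := h2.smul ((continuous_snd.tendsto _).comp h1)
  rwa [inv_one, one_smul] at h3

theorem eventually_ne_zero (x : ℍ[ℝ]) : ∀ᶠ v in 𝓝 (D (1, x)), (D.symm v).1 ≠ 0 := by
  have h : ContinuousAt (fun v => (D.symm v).1) (D (1, x)) :=
    (continuous_fst.comp D.symm.continuous).continuousAt
  exact h.eventually_ne (by simp)

/-- The displacement from the point `x` of the chart, in homogeneous form. -/
def displacement (x : ℍ[ℝ]) : E5 →L[ℝ] ℍ[ℝ] :=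
  (ContinuousLinearMap.snd ℝ ℝ ℍ[ℝ] - (ContinuousLinearMap.fst ℝ ℝ ℍ[ℝ]).smulRight x).comp
    (D.symm : E5 →L[ℝ] ℝ × ℍ[ℝ])

/-- The scalar coordinate of the homogeneous coordinates of a chart. -/
def scale : E5 →L[ℝ] ℝ := (ContinuousLinearMap.fst ℝ ℝ ℍ[ℝ]).comp (D.symm : E5 →L[ℝ] ℝ × ℍ[ℝ])

theorem displacement_eq (x : ℍ[ℝ]) {v : E5} (hv : scale D v ≠ 0) :
    displacement D x v = scale D v • (chartCoord D v - x) := by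
  change (D.symm v).2 - (D.symm v).1 • x = (D.symm v).1 • ((D.symm v).1⁻¹ • (D.symm v).2 - x)
  rw [smul_sub, smul_smul, mul_inv_cancel₀ (show (D.symm v).1 ≠ 0 from hv), one_smul]

theorem eq_zero_of_displacement {x : ℍ[ℝ]} {v : E5} (h1 : scale D v = 0)
    (h2 : displacement D x v = 0) : v = 0 := by
  have h3 : (D.symm v).1 = 0 := h1
  have h4 : (D.symm v).2 - (D.symm v).1 • x = 0 := h2
  rw [h3, zero_smul, sub_zero] at h4
  rw [← map_eq_zero_iff _ D.symm.injective]
  exact Prod.ext h3 h4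

theorem eventually_chart {p : ℍ[ℝ] → Prop} {x : ℍ[ℝ]} (h : ∀ᶠ v in 𝓝 0, p v) :
    ∀ᶠ v in 𝓝 (D (1, x)), p (chartCoord D v - x) := by
  have := (tendsto_chartCoord D x).sub_const x
  rw [sub_self] at this
  exact this.eventually h

/-- The affine identity is multiplied by the scalar coordinate s of the chart, with d the
displacement. Then Y = s − a(d) and Z = Y·g(x) + Dg(d); a common zero has d = 0 because Dg is
injective, and then s = 0. -/
theorem HasHopfForm.homogenize {g : ℍ[ℝ] → ℍ[ℝ]} {x : ℍ[ℝ]} (h : HasHopfForm g x)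
    (hi : Function.Injective (fderiv ℝ g x)) : ∃ Y Z : E5 →L[ℝ] ℍ[ℝ],
      (∀ v, Y v = 0 → Z v = 0 → v = 0) ∧
        ∀ᶠ v in 𝓝 (D (1, x)), Y v * g (chartCoord D v) = Z v := by
  obtain ⟨a, ha⟩ := h
  refine ⟨(scale D).smulRight 1 - a.comp (displacement D x), (scale D).smulRight (g x) +
    ((fderiv ℝ g x).comp (displacement D x) -
      ((ContinuousLinearMap.mul ℝ ℍ[ℝ]).flip (g x)).comp (a.comp (displacement D x))),
      fun v h1 h2 => ?_, ?_⟩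
  · have h1' : scale D v • (1 : ℍ[ℝ]) - a (displacement D x v) = 0 := h1
    have h2' : scale D v • g x + (fderiv ℝ g x (displacement D x v) -
      a (displacement D x v) * g x) = 0 := h2
    rw [← sub_eq_zero.1 h1', smul_mul_assoc, one_mul, add_sub_cancel] at h2'
    have h3 : displacement D x v = 0 := hi (by rw [h2', map_zero])
    rw [h3, map_zero, sub_zero] at h1'
    exact eq_zero_of_displacement D ((smul_eq_zero.1 h1').resolve_right one_ne_zero) h3
  · filter_upwards [eventually_chart D ha, eventually_ne_zero D x] with v h1 hs
    have h2 := displacement_eq D x hs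
    rw [add_sub_cancel] at h1
    change (scale D v • (1 : ℍ[ℝ]) - a (displacement D x v)) * _ = scale D v • g x +
      (fderiv ℝ g x (displacement D x v) - a (displacement D x v) * g x)
    rw [h2, map_smul, map_smul, ← smul_sub, smul_mul_assoc, h1, smul_mul_assoc, ← smul_sub,
      ← smul_add]

theorem HasClassicalForm.homogenize {g : ℍ[ℝ] → ℍ[ℝ]} {x : ℍ[ℝ]} (h : HasClassicalForm g x)
    (hi : Function.Injective (fderiv ℝ g x)) :
    ∃ (i : E5 →ₗ[ℝ] ℍ[ℝ] × ℝ × ℝ) (P : ℍ[ℝ] × ℝ × ℝ), (∀ v (τ : ℝ), i v = τ • P → v = 0 ∧ τ = 0) ∧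
      ∀ᶠ v in 𝓝 (D (1, x)), ∃ c τ : ℝ, lightLift (g (chartCoord D v)) = c • i v + τ • P := by
  obtain ⟨b, k, l, hl⟩ := h
  set L : ℍ[ℝ] →ₗ[ℝ] ℍ[ℝ] × ℝ × ℝ :=
    { toFun := fun p => lightLiftDeriv (g x) p
      map_add' := fun p q => by simp [lightLiftDeriv, dot_add_right, mul_add]
      map_smul' := fun c p => by simp [lightLiftDeriv, dot_smul_right, mul_left_comm] } with hL
  refine ⟨((scale D : E5 →ₗ[ℝ] ℝ) - (l.comp (displacement D x) : E5 →ₗ[ℝ] ℝ)).smulRight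
    (lightLift (g x)) + L ∘ₗ ((fderiv ℝ g x).comp (displacement D x) : E5 →ₗ[ℝ] ℍ[ℝ]),
    lightPole (g x) b k, fun v τ h1 => ?_, ?_⟩
  · obtain ⟨h2, h3, h4⟩ := eq_zero_of_lightPole (q := g x)
      (p := fderiv ℝ g x (displacement D x v)) (b := b) (k := k)
      (c := scale D v - l (displacement D x v)) (τ := τ) h1
    have h5 : displacement D x v = 0 := hi (by rw [map_zero]; exact h3)
    have h6 : scale D v - l (displacement D x v) = 0 := h2
    rw [h5, map_zero, sub_zero] at h6
    exact ⟨eq_zero_of_displacement D h6 h5, h4⟩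
  · filter_upwards [eventually_chart D hl, eventually_ne_zero D x] with v ⟨c, τ, h1⟩ hs
    rw [add_sub_cancel] at h1
    have hs' : scale D v ≠ 0 := hs
    refine ⟨c * (scale D v)⁻¹, τ, ?_⟩
    rw [h1, mul_smul]
    congr 2
    rw [eq_inv_smul_iff₀ hs']
    change _ = (scale D v - l (displacement D x v)) • lightLift (g x) +
      L (fderiv ℝ g x (displacement D x v))
    rw [displacement_eq D x hs', map_smul, map_smul, map_smul]
    change _ = _ + scale D v • lightLiftDeriv (g x) (fderiv ℝ g x (chartCoord D v - x))
    module

end Homogenize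

namespace ConeMap

variable {F : E5 → E5} {C : Set E5}

theorem eventually_stereo (h : ConeMap F C) (D : (ℝ × ℍ[ℝ]) ≃L[ℝ] E5) {x : ℍ[ℝ]}
    (hx : x ∈ chartDomain F C D) :
    ∀ᶠ v in 𝓝 (D (1, x)), v ∈ C ∧ F v 4 ≠ 1 ∧ chart F D (chartCoord D v) = stereo (F v) := by
  filter_upwards [(tendsto_chartCoord D x).eventually ((isOpen_chartDomain D h).mem_nhds hx),
    eventually_ne_zero D x] with v hv hs
  have e := h.homogeneous _ hv.1 _ hs
  rw [smul_chartCoord D hs] at e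
  have e2 := h.smul_mem _ hv.1 _ hs
  rw [smul_chartCoord D hs] at e2
  refine ⟨e2, ?_, ?_⟩
  · rw [e]
    exact hv.2
  · rw [chart, e]

/-- The equation of the left Hopf fibrations in homogeneous coordinates. -/
def SatisfiesHopf (F : E5 → E5) (Y Z : E5 →L[ℝ] ℍ[ℝ]) (v : E5) : Prop :=
  Y v * quatPart (F v) = (1 - F v 4) • Z v ∧ (1 + F v 4) • Y v = Z v * star (quatPart (F v))

/-- The quotient form has no meaning at the north pole. The two equations are polynomial in `F`, and
together they remain nondegenerate there, so they can be continued analytically. -/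
theorem satisfiesHopf_of_stereo {Y Z : E5 →L[ℝ] ℍ[ℝ]} {v : E5} (hF : ‖F v‖ = 1) (h4 : F v 4 ≠ 1)
    (h : Y v * stereo (F v) = Z v) : SatisfiesHopf F Y Z v := by
  have h5 : 1 - F v 4 ≠ 0 := sub_ne_zero.2 h4.symm
  have h6 : Y v * quatPart (F v) = (1 - F v 4) • Z v := by
    rw [← h, stereo, mul_smul_comm, smul_smul, lastPart_apply, mul_inv_cancel₀ h5, one_smul]
  refine ⟨h6, smul_right_injective _ h5 ?_⟩
  simp only
  rw [← smul_mul_assoc, ← h6, mul_assoc, Quaternion.self_mul_star, ← dot_self,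
    normSq_quatPart hF, Quaternion.mul_coe_eq_smul, smul_smul]

/-- The equation of the right Hopf fibrations in homogeneous coordinates. -/
def SatisfiesRightHopf (F : E5 → E5) (Y Z : E5 →L[ℝ] ℍ[ℝ]) (v : E5) : Prop :=
  quatPart (F v) * Y v = (1 - F v 4) • Z v ∧ (1 + F v 4) • Y v = star (quatPart (F v)) * Z v

theorem satisfiesRightHopf_of_stereo {Y Z : E5 →L[ℝ] ℍ[ℝ]} {v : E5} (hF : ‖F v‖ = 1)
    (h4 : F v 4 ≠ 1) (h : stereo (F v) * Y v = Z v) : SatisfiesRightHopf F Y Z v := by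
  have h5 : 1 - F v 4 ≠ 0 := sub_ne_zero.2 h4.symm
  have h6 : quatPart (F v) * Y v = (1 - F v 4) • Z v := by
    rw [← h, stereo, smul_mul_assoc, smul_smul, lastPart_apply, mul_inv_cancel₀ h5, one_smul]
  refine ⟨h6, smul_right_injective _ h5 ?_⟩
  simp only
  rw [← mul_smul_comm, ← h6, ← mul_assoc, Quaternion.star_mul_self, ← dot_self,
    normSq_quatPart hF, Quaternion.coe_mul_eq_smul, smul_smul]

/-- Otherwise `F` is constant on an open set, and the kernel of its derivative is ℝ⁵ instead of a
line. -/
theorem exists_ne_northPole (h : ConeMap F C) (hC : C.Nonempty) : ∃ v ∈ C, F v 4 ≠ 1 := by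
  by_contra! hcon
  obtain ⟨v, hv⟩ := hC
  have hconst : F =ᶠ[𝓝 v] fun _ => F v := by
    filter_upwards [h.isOpen.mem_nhds hv] with u hu
    have e : lightEquiv (F u, 1) = lightEquiv (F v, 1) := by
      rw [lightEquiv_apply, lightEquiv_apply, quatPart_eq_zero (h.norm_eq u hu) (hcon u hu),
        quatPart_eq_zero (h.norm_eq v hv) (hcon v hv), hcon u hu, hcon v hv]
    exact congrArg Prod.fst (lightEquiv.injective e)
  have hd : fderiv ℝ F v = 0 := by
    rw [hconst.fderiv_eq]
    simp
  have hle : (⊤ : Submodule ℝ E5) ≤ ℝ ∙ v := by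
    intro w _
    obtain ⟨r, hr⟩ := h.ker v hv w (by rw [hd]; rfl)
    exact Submodule.mem_span_singleton.2 ⟨r, hr.symm⟩
  have h1 := Submodule.finrank_mono hle
  rw [finrank_top, finrank_span_singleton (h.ne_zero v hv)] at h1
  simp at h1

/-- The local forms of cone maps. -/
theorem exists_local_form (h : ConeMap F C) (hC : C.Nonempty) : ∃ v₁ ∈ C,
    (∃ (i : E5 →ₗ[ℝ] E5 × ℝ) (P : E5 × ℝ), (∀ v (τ : ℝ), i v = τ • P → v = 0 ∧ τ = 0) ∧
      ∀ᶠ v in 𝓝 v₁, ∃ c τ : ℝ, (F v, (1 : ℝ)) = c • i v + τ • P) ∨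
    (∃ Y Z : E5 →L[ℝ] ℍ[ℝ], (∀ v, Y v = 0 → Z v = 0 → v = 0) ∧
      ∀ᶠ v in 𝓝 v₁, SatisfiesHopf F Y Z v) ∨
    ∃ Y Z : E5 →L[ℝ] ℍ[ℝ], (∀ v, Y v = 0 → Z v = 0 → v = 0) ∧
      ∀ᶠ v in 𝓝 v₁, SatisfiesRightHopf F Y Z v := by
  obtain ⟨v₀, hv₀, h4⟩ := h.exists_ne_northPole hC
  obtain ⟨D, hD⟩ := exists_chart (h.ne_zero v₀ hv₀)
  have hg := circleMap_chart D h
  obtain ⟨x, hx, hx'⟩ := hg.local_form ⟨0, by rw [← hD] at hv₀ h4; exact ⟨hv₀, h4⟩⟩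
  refine ⟨D (1, x), hx.1, ?_⟩
  have hev := h.eventually_stereo D hx
  rcases hx' with h1 | h1 | h1
  · left
    obtain ⟨i, P, hi, hl⟩ := h1.homogenize D (hg.inj x hx)
    refine ⟨(lightEquiv.symm : (ℍ[ℝ] × ℝ × ℝ) →ₗ[ℝ] E5 × ℝ) ∘ₗ i, lightEquiv.symm P,
      fun v τ hv => hi v τ ?_, ?_⟩
    · apply lightEquiv.symm.injective
      rw [map_smul]
      exact hv
    · filter_upwards [hl, hev] with v ⟨c, τ, hv⟩ ⟨hvC, hv4, hvs⟩
      refine ⟨(1 - F v 4) * c, (1 - F v 4) * τ, ?_⟩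
      apply lightEquiv.injective
      rw [lightEquiv_eq_smul (h.norm_eq v hvC) hv4, ← hvs, hv]
      simp [smul_add, mul_smul]
  · right; left
    obtain ⟨Y, Z, hi, hl⟩ := h1.homogenize D (hg.inj x hx)
    refine ⟨Y, Z, hi, ?_⟩
    filter_upwards [hl, hev] with v hv ⟨hvC, hv4, hvs⟩
    exact satisfiesHopf_of_stereo (h.norm_eq v hvC) hv4 (by rw [← hvs, hv])
  · right; right
    obtain ⟨Y, Z, hi, hl⟩ := h1.homogenize D (hg.star.inj x hx)
    refine ⟨starL.comp Y, starL.comp Z, fun v h1 h2 => hi v (star_eq_zero.1 h1) (star_eq_zero.1 h2),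
      ?_⟩
    filter_upwards [hl, hev] with v hv ⟨hvC, hv4, hvs⟩
    refine satisfiesRightHopf_of_stereo (h.norm_eq v hvC) hv4 ?_
    simp only [ContinuousLinearMap.comp_apply, starL_apply]
    rw [← hvs, ← hv, star_mul, star_star]

end ConeMap

/-! ### Analytic continuation over cones -/

theorem isOpen_of_isOpen_cone {A : Set RP4} (hA : IsOpen (cone A)) : IsOpen A := by
  refine isOpen_coinduced.2 ?_
  convert hA.preimage (continuous_subtype_val (p := fun v : E5 => v ≠ 0)) using 1
  ext ⟨v, hv⟩
  exact ⟨fun h => ⟨hv, h⟩, fun ⟨_, h⟩ => h⟩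

/-- The cone over a connected set need not be connected, so the identity theorem is used in balls of
ℝ⁵ and connectedness in ℝP⁴. Homogeneity makes local vanishing of K independent of the
representative, and the points of `U` with and without it form two disjoint open sets. -/
theorem eq_zero_on_cone {G : Type*} [NormedAddCommGroup G] [NormedSpace ℝ G] {U : Set RP4}
    (hU : IsPreconnected U) (ho : IsOpen U) {K : E5 → G} (hK : ∀ v ∈ cone U, AnalyticAt ℝ K v)
    (hom : ∀ v ∈ cone U, ∀ r : ℝ, r ≠ 0 → K v = 0 → K (r • v) = 0) {v₁ : E5} (hv₁ : v₁ ∈ cone U)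
    (h₁ : ∀ᶠ v in 𝓝 v₁, K v = 0) : ∀ v ∈ cone U, K v = 0 := by
  have hoc := isOpen_cone ho
  have hp : ∀ v ∈ cone U, ∀ r : ℝ, r ≠ 0 → (∀ᶠ u in 𝓝 v, K u = 0) → ∀ᶠ u in 𝓝 (r • v), K u = 0 := by
    intro v hv r hr h
    have ht : Tendsto (fun u : E5 => r⁻¹ • u) (𝓝 (r • v)) (𝓝 v) := by
      have := (continuous_const_smul r⁻¹ (T := E5)).tendsto (r • v)
      rwa [smul_smul, inv_mul_cancel₀ hr, one_smul] at this
    filter_upwards [ht.eventually h, ht.eventually (hoc.mem_nhds hv)] with u h1 h2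
    have := hom _ h2 r hr h1
    rwa [smul_smul, mul_inv_cancel₀ hr, one_smul] at this
  have hrep : ∀ {v w : E5} (hv : v ≠ 0) (hw : w ≠ 0), Projectivization.mk ℝ w hw =
      Projectivization.mk ℝ v hv → v ∈ cone U → (∀ᶠ u in 𝓝 v, K u = 0) →
      ∀ᶠ u in 𝓝 w, K u = 0 := by
    intro v w hv hw he hvU h
    obtain ⟨a, rfl⟩ := (Projectivization.mk_eq_mk_iff' _ _ _ _ _).1 he
    exact hp v hvU a (by rintro rfl; simp at hw) h
  set A : Set RP4 := {x | x ∈ U ∧ ∃ (v : E5) (hv : v ≠ 0), Projectivization.mk ℝ v hv = x ∧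
    ∀ᶠ u in 𝓝 v, K u = 0} with hA
  set B : Set RP4 := {x | x ∈ U ∧ ∃ (v : E5) (hv : v ≠ 0), Projectivization.mk ℝ v hv = x ∧
    ¬ ∀ᶠ u in 𝓝 v, K u = 0} with hB
  have cA : cone A = {v | v ∈ cone U ∧ ∀ᶠ u in 𝓝 v, K u = 0} := by
    ext v
    constructor
    · rintro ⟨hv, hvU, w, hw, he, h⟩
      exact ⟨⟨hv, hvU⟩, hrep hw hv he.symm ⟨hw, by rwa [he]⟩ h⟩
    · rintro ⟨⟨hv, hvU⟩, h⟩
      exact ⟨hv, hvU, v, hv, rfl, h⟩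
  have cB : cone B = {v | v ∈ cone U ∧ ¬ ∀ᶠ u in 𝓝 v, K u = 0} := by
    ext v
    constructor
    · rintro ⟨hv, hvU, w, hw, he, h⟩
      exact ⟨⟨hv, hvU⟩, fun h' => h (hrep hv hw he ⟨hv, hvU⟩ h')⟩
    · rintro ⟨⟨hv, hvU⟩, h⟩
      exact ⟨hv, hvU, v, hv, rfl, h⟩
  have oA : IsOpen A := isOpen_of_isOpen_cone (by
    rw [cA]
    exact hoc.inter (isOpen_iff_mem_nhds.2 fun v hv => eventually_eventually_nhds.2 hv))
  have oB : IsOpen B := isOpen_of_isOpen_cone (by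
    rw [cB, Metric.isOpen_iff]
    rintro v ⟨hv, hnot⟩
    obtain ⟨ε, hε, hb⟩ := Metric.isOpen_iff.1 hoc v hv
    refine ⟨ε, hε, fun u hu => ⟨hb hu, fun h => hnot ?_⟩⟩
    have := AnalyticOnNhd.eqOn_zero_of_preconnected_of_eventuallyEq_zero
      (fun w hw => hK w (hb hw)) (convex_ball v ε).isPreconnected hu h
    filter_upwards [Metric.ball_mem_nhds v hε] with w hw using this hw)
  have hsub : U ⊆ A := by
    refine hU.subset_left_of_subset_union oA oB ?_ ?_ ?_
    · rw [Set.disjoint_left]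
      rintro x ⟨hx, v, hv, rfl, h⟩ hB'
      have : v ∈ cone B := ⟨hv, hB'⟩
      rw [cB] at this
      exact this.2 h
    · intro x hx
      induction x using Projectivization.ind with
      | h v hv =>
        by_cases h : ∀ᶠ u in 𝓝 v, K u = 0
        · exact Or.inl ⟨hx, v, hv, rfl, h⟩
        · exact Or.inr ⟨hx, v, hv, rfl, h⟩
    · exact ⟨_, hv₁.2, hv₁.2, v₁, hv₁.1, rfl, h₁⟩
  intro v hv
  have : v ∈ cone A := ⟨hv.1, hsub hv.2⟩
  rw [cA] at this
  exact this.2.self_of_nhds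

/-! ### Restrictions of Hopf fibrations -/

theorem isConformalIdentification_id : IsConformalIdentification 0 1 (id : S4 → S4) := by
  refine ⟨Function.bijective_id, id, fun x => ⟨rfl, contDiff_id.contDiffAt, 1, one_pos, fun v _ => ?_⟩⟩
  simp

theorem leftHopf_mk_zero {z : ℍ[ℝ]} (h : ((0, z) : ℍ[ℝ] × ℍ[ℝ]) ≠ 0) :
    leftHopf (Projectivization.mk ℝ (0, z) h) = invStereo OnePoint.infty :=
  congrArg invStereo (if_pos rfl)

theorem leftHopf_mk {y z : ℍ[ℝ]} (h : ((y, z) : ℍ[ℝ] × ℍ[ℝ]) ≠ 0) (hy : y ≠ 0) :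
    leftHopf (Projectivization.mk ℝ (y, z) h) = invStereo ((y⁻¹ * z : ℍ[ℝ]) : OnePoint ℍ[ℝ]) :=
  congrArg invStereo (if_neg hy)

theorem rightHopf_mk_zero {z : ℍ[ℝ]} (h : ((0, z) : ℍ[ℝ] × ℍ[ℝ]) ≠ 0) :
    rightHopf (Projectivization.mk ℝ (0, z) h) = invStereo OnePoint.infty :=
  congrArg invStereo (if_pos rfl)

theorem rightHopf_mk {y z : ℍ[ℝ]} (h : ((y, z) : ℍ[ℝ] × ℍ[ℝ]) ≠ 0) (hy : y ≠ 0) :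
    rightHopf (Projectivization.mk ℝ (y, z) h) = invStereo ((z * y⁻¹ : ℍ[ℝ]) : OnePoint ℍ[ℝ]) :=
  congrArg invStereo (if_neg hy)

/-- If y = 0, the first equation puts X at the north pole. If y ≠ 0, the second one excludes the
north pole, where it would say 2y = 0, and the first one says that the stereographic image of X is
y⁻¹z. -/
theorem eq_leftHopf_mk {y z : ℍ[ℝ]} (h : ((y, z) : ℍ[ℝ] × ℍ[ℝ]) ≠ 0) {X : S4}
    (h1 : y * quatPart X = (1 - (X : E5) 4) • z)
    (h2 : (1 + (X : E5) 4) • y = z * star (quatPart X)) :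
    X = leftHopf (Projectivization.mk ℝ (y, z) h) := by
  rcases eq_or_ne y 0 with rfl | hy
  · have hz : z ≠ 0 := by
      rintro rfl
      exact h rfl
    rw [zero_mul, eq_comm, smul_eq_zero, or_iff_left hz, sub_eq_zero] at h1
    rw [leftHopf_mk_zero, eq_northPole h1.symm]
  · have h4 : (X : E5) 4 ≠ 1 := by
      intro h4
      rw [h4, quatPart_eq_zero (mem_sphere_zero_iff_norm.1 X.2) h4, star_zero, mul_zero,
        smul_eq_zero, or_iff_left hy] at h2
      norm_num at h2
    rw [leftHopf_mk h hy, ← invStereo_stereo h4]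
    congr 2
    rw [eq_inv_mul_iff_mul_eq₀ hy, stereo, mul_smul_comm, h1, lastPart_apply,
      smul_smul, inv_mul_cancel₀ (sub_ne_zero.2 h4.symm), one_smul]

theorem eq_rightHopf_mk {y z : ℍ[ℝ]} (h : ((y, z) : ℍ[ℝ] × ℍ[ℝ]) ≠ 0) {X : S4}
    (h1 : quatPart X * y = (1 - (X : E5) 4) • z)
    (h2 : (1 + (X : E5) 4) • y = star (quatPart X) * z) :
    X = rightHopf (Projectivization.mk ℝ (y, z) h) := by
  rcases eq_or_ne y 0 with rfl | hy
  · have hz : z ≠ 0 := by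
      rintro rfl
      exact h rfl
    rw [mul_zero, eq_comm, smul_eq_zero, or_iff_left hz, sub_eq_zero] at h1
    rw [rightHopf_mk_zero, eq_northPole h1.symm]
  · have h4 : (X : E5) 4 ≠ 1 := by
      intro h4
      rw [h4, quatPart_eq_zero (mem_sphere_zero_iff_norm.1 X.2) h4, star_zero, zero_mul,
        smul_eq_zero, or_iff_left hy] at h2
      norm_num at h2
    rw [rightHopf_mk h hy, ← invStereo_stereo h4]
    congr 2
    rw [eq_mul_inv_iff_mul_eq₀ hy, stereo, smul_mul_assoc, h1, lastPart_apply,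
      smul_smul, inv_mul_cancel₀ (sub_ne_zero.2 h4.symm), one_smul]

section

variable {U : Set RP4} {f : RP4 → S4} {F : E5 → E5} {Y Z : E5 →L[ℝ] ℍ[ℝ]}

theorem injective_prod (hi : ∀ v, Y v = 0 → Z v = 0 → v = 0) :
    Function.Injective (Y.prod Z : E5 →ₗ[ℝ] ℍ[ℝ] × ℍ[ℝ]) := by
  rw [injective_iff_map_eq_zero]
  intro v hv
  exact hi v (congrArg Prod.fst hv) (congrArg Prod.snd hv)

theorem isRestriction_leftHopf
    (hF : ∀ v (hv : v ≠ 0), Projectivization.mk ℝ v hv ∈ U → F v = f (Projectivization.mk ℝ v hv))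
    (hi : ∀ v, Y v = 0 → Z v = 0 → v = 0) (h : ∀ v ∈ cone U, ConeMap.SatisfiesHopf F Y Z v) :
    IsRestrictionOfFibrationOn leftHopf f U := by
  refine ⟨(Y.prod Z : E5 →ₗ[ℝ] ℍ[ℝ] × ℍ[ℝ]), injective_prod hi, id,
    isConformalIdentification_id, fun x hx => ?_⟩
  induction x using Projectivization.ind with
  | h v hv =>
    obtain ⟨h1, h2⟩ := h v ⟨hv, hx⟩
    rw [hF v hv hx] at h1 h2
    rw [Projectivization.map_mk]
    exact eq_leftHopf_mk _ h1 h2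

theorem isRestriction_rightHopf
    (hF : ∀ v (hv : v ≠ 0), Projectivization.mk ℝ v hv ∈ U → F v = f (Projectivization.mk ℝ v hv))
    (hi : ∀ v, Y v = 0 → Z v = 0 → v = 0) (h : ∀ v ∈ cone U, ConeMap.SatisfiesRightHopf F Y Z v) :
    IsRestrictionOfFibrationOn rightHopf f U := by
  refine ⟨(Y.prod Z : E5 →ₗ[ℝ] ℍ[ℝ] × ℍ[ℝ]), injective_prod hi, id,
    isConformalIdentification_id, fun x hx => ?_⟩
  induction x using Projectivization.ind with
  | h v hv =>
    obtain ⟨h1, h2⟩ := h v ⟨hv, hx⟩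
    rw [hF v hv hx] at h1 h2
    rw [Projectivization.map_mk]
    exact eq_rightHopf_mk _ h1 h2

end

namespace ConeMap

variable {U : Set RP4} {F : E5 → E5} {Y Z : E5 →L[ℝ] ℍ[ℝ]}

theorem satisfiesHopf_of_eventually (h : ConeMap F (cone U)) (hU : IsPreconnected U) (ho : IsOpen U)
    {v₁ : E5} (hv₁ : v₁ ∈ cone U) (h₁ : ∀ᶠ v in 𝓝 v₁, SatisfiesHopf F Y Z v) :
    ∀ v ∈ cone U, SatisfiesHopf F Y Z v := by
  have key := eq_zero_on_cone hU ho (K := fun v => (Y v * quatPart (F v) - (1 - lastPart (F v)) • Z v,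
    (1 + lastPart (F v)) • Y v - Z v * starL (quatPart (F v)))) (fun v hv => by
      have hF := h.analyticAt v hv
      have hq : AnalyticAt ℝ (fun v => quatPart (F v)) v := (quatPart.analyticAt _).comp hF
      have hl : AnalyticAt ℝ (fun v => lastPart (F v)) v := (lastPart.analyticAt _).comp hF
      have hY := Y.analyticAt v
      have hZ := Z.analyticAt v
      have hs : AnalyticAt ℝ (fun v => starL (quatPart (F v))) v := (starL.analyticAt _).comp hq
      exact ((hY.mul hq).sub ((analyticAt_const.sub hl).smul hZ)).prod
        (((analyticAt_const.add hl).smul hY).sub (hZ.mul hs))) (fun v hv r hr h0 => by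
      rw [Prod.mk_eq_zero, h.homogeneous v hv r hr] at *
      simp only [map_smul, smul_mul_assoc, smul_comm _ r, ← smul_sub, h0, smul_zero, and_self])
    hv₁ (by
      filter_upwards [h₁] with v hv
      exact Prod.mk_eq_zero.2 ⟨sub_eq_zero.2 hv.1, sub_eq_zero.2 hv.2⟩)
  intro v hv
  obtain ⟨h1, h2⟩ := Prod.mk_eq_zero.1 (key v hv)
  exact ⟨sub_eq_zero.1 h1, sub_eq_zero.1 h2⟩

theorem satisfiesRightHopf_of_eventually (h : ConeMap F (cone U)) (hU : IsPreconnected U)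
    (ho : IsOpen U) {v₁ : E5} (hv₁ : v₁ ∈ cone U) (h₁ : ∀ᶠ v in 𝓝 v₁, SatisfiesRightHopf F Y Z v) :
    ∀ v ∈ cone U, SatisfiesRightHopf F Y Z v := by
  have key := eq_zero_on_cone hU ho (K := fun v => (quatPart (F v) * Y v - (1 - lastPart (F v)) • Z v,
    (1 + lastPart (F v)) • Y v - starL (quatPart (F v)) * Z v)) (fun v hv => by
      have hF := h.analyticAt v hv
      have hq : AnalyticAt ℝ (fun v => quatPart (F v)) v := (quatPart.analyticAt _).comp hF
      have hl : AnalyticAt ℝ (fun v => lastPart (F v)) v := (lastPart.analyticAt _).comp hF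
      have hY := Y.analyticAt v
      have hZ := Z.analyticAt v
      have hs : AnalyticAt ℝ (fun v => starL (quatPart (F v))) v := (starL.analyticAt _).comp hq
      exact ((hq.mul hY).sub ((analyticAt_const.sub hl).smul hZ)).prod
        (((analyticAt_const.add hl).smul hY).sub (hs.mul hZ))) (fun v hv r hr h0 => by
      rw [Prod.mk_eq_zero, h.homogeneous v hv r hr] at *
      simp only [map_smul, mul_smul_comm, smul_comm _ r, ← smul_sub, h0, smul_zero, and_self])
    hv₁ (by
      filter_upwards [h₁] with v hv
      exact Prod.mk_eq_zero.2 ⟨sub_eq_zero.2 hv.1, sub_eq_zero.2 hv.2⟩)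
  intro v hv
  obtain ⟨h1, h2⟩ := Prod.mk_eq_zero.1 (key v hv)
  exact ⟨sub_eq_zero.1 h1, sub_eq_zero.1 h2⟩

end ConeMap

theorem analyticAt_inner {a b : E5 → E5} {v : E5} (ha : AnalyticAt ℝ a v) (hb : AnalyticAt ℝ b v) :
    AnalyticAt ℝ (fun v => (inner ℝ (a v) (b v) : ℝ)) v :=
  AnalyticAt.comp (f := fun v => (a v, b v)) ((innerSL ℝ).analyticAt_bilinear (a v, b v))
    (ha.prod hb)

namespace ConeMap

variable {U : Set RP4} {F : E5 → E5}

/-- The coordinates of `ℝ⁶` given by a complementary hyperplane and line. -/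
theorem exists_coordinates {i : E5 →ₗ[ℝ] E5 × ℝ} {P : E5 × ℝ}
    (hi : ∀ v (τ : ℝ), i v = τ • P → v = 0 ∧ τ = 0) :
    ∃ S : (E5 × ℝ) ≃L[ℝ] E5 × ℝ, ∀ v τ, S (v, τ) = i v + τ • P := by
  set L : (E5 × ℝ) →ₗ[ℝ] E5 × ℝ := i.coprod (LinearMap.toSpanSingleton ℝ _ P) with hL
  have hinj : Function.Injective L := by
    rw [injective_iff_map_eq_zero]
    rintro ⟨v, τ⟩ h
    have h1 : i v + τ • P = 0 := by simpa [hL] using h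
    obtain ⟨h2, h3⟩ := hi v (-τ) (by rw [neg_smul]; exact eq_neg_of_add_eq_zero_left h1)
    simp only [neg_eq_zero] at h3
    simp [h2, h3]
  exact ⟨(LinearEquiv.ofInjectiveEndo L hinj).toContinuousLinearEquiv, fun v τ => by simp [hL]⟩

/-- Let H(v) be the component of (F v, 1) in the coordinates complementary to P. The local form says
that H(v) is parallel to v, that is |v|²H(v) = ⟨H(v), v⟩v, an analytic equation. -/
theorem classical_of_eventually (h : ConeMap F (cone U)) (hU : IsPreconnected U) (ho : IsOpen U)
    {i : E5 →ₗ[ℝ] E5 × ℝ} {P : E5 × ℝ} (hi : ∀ v (τ : ℝ), i v = τ • P → v = 0 ∧ τ = 0)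
    {v₁ : E5} (hv₁ : v₁ ∈ cone U)
    (h₁ : ∀ᶠ v in 𝓝 v₁, ∃ c τ : ℝ, (F v, (1 : ℝ)) = c • i v + τ • P) :
    ∀ v ∈ cone U, ∃ c τ : ℝ, c ≠ 0 ∧ (F v, (1 : ℝ)) = c • i v + τ • P := by
  obtain ⟨S, hS⟩ := exists_coordinates hi
  set q : (E5 × ℝ) →L[ℝ] E5 :=
    (ContinuousLinearMap.fst ℝ E5 ℝ).comp (S.symm : (E5 × ℝ) →L[ℝ] E5 × ℝ) with hq
  have hdec : ∀ X, X = i (q X) + (S.symm X).2 • P := fun X => by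
    rw [← hS]
    exact (S.apply_symm_apply X).symm
  have hqi : ∀ (c : ℝ) (v : E5) (τ : ℝ), q (c • i v + τ • P) = c • v := fun c v τ => by
    have : S.symm (c • i v + τ • P) = (c • v, τ) := by
      rw [S.symm_apply_eq, hS, map_smul]
    exact congrArg Prod.fst this
  set H : E5 → E5 := fun v => q (F v, 1) with hH
  have hHa : ∀ v ∈ cone U, AnalyticAt ℝ H v := fun v hv =>
    (q.analyticAt _).comp ((h.analyticAt v hv).prod analyticAt_const)
  have key := eq_zero_on_cone hU ho (K := fun v =>
    (inner ℝ v v : ℝ) • H v - (inner ℝ (H v) v : ℝ) • v) (fun v hv => by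
      exact ((analyticAt_inner analyticAt_id analyticAt_id).smul (hHa v hv)).sub
        ((analyticAt_inner (hHa v hv) analyticAt_id).smul analyticAt_id)) (fun v hv r hr h0 => by
      simp only [hH, h.homogeneous v hv r hr, real_inner_smul_left, real_inner_smul_right] at h0 ⊢
      rw [sub_eq_zero] at h0 ⊢
      rw [mul_smul, mul_smul, h0]
      module) hv₁ (by
      filter_upwards [h₁] with v ⟨c, τ, hv⟩
      simp only [hH]
      rw [hv, hqi, real_inner_smul_left]
      module)
  set c : E5 → ℝ := fun v => inner ℝ (H v) v / inner ℝ v v with hc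
  have hHc : ∀ v ∈ cone U, H v = c v • v := by
    intro v hv
    have hvv : (inner ℝ v v : ℝ) ≠ 0 := by simpa using h.ne_zero v hv
    have := sub_eq_zero.1 (key v hv)
    refine smul_right_injective _ hvv ?_
    simp only
    rw [this, smul_smul, mul_div_cancel₀ _ hvv]
  intro v hv
  refine ⟨c v, (S.symm (F v, 1)).2, fun hc0 => ?_, ?_⟩
  · have hvv : (inner ℝ v v : ℝ) ≠ 0 := by simpa using h.ne_zero v hv
    have hHd := (hHa v hv).differentiableAt
    have hcd : DifferentiableAt ℝ c v := by
      have hn : DifferentiableAt ℝ (fun u => (inner ℝ (H u) u : ℝ)) v :=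
        hHd.inner ℝ differentiableAt_fun_id
      have hm : DifferentiableAt ℝ (fun u : E5 => (inner ℝ u u : ℝ)) v :=
        differentiableAt_fun_id.inner ℝ differentiableAt_fun_id
      simp only [hc, div_eq_mul_inv]
      exact hn.mul (hm.inv hvv)
    have hd : ∀ w, q (fderiv ℝ F v w, 0) = fderiv ℝ c v w • v := by
      intro w
      have d1 := q.hasFDerivAt.comp_hasDerivAt (0 : ℝ) ((hasDerivAt_line_zero
        (h.analyticAt v hv).differentiableAt w).prodMk (hasDerivAt_const (0 : ℝ) (1 : ℝ)))
      have hid : HasDerivAt (fun t : ℝ => v + t • w) w 0 := by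
        simpa using ((hasDerivAt_id (0 : ℝ)).smul_const w).const_add v
      have d2 := ((hasDerivAt_line_zero hcd w).smul hid).congr_of_eventuallyEq
        (f₁ := fun t : ℝ => H (v + t • w))
        (eventually_line ((h.isOpen.eventually_mem hv).mono fun u hu => hHc u hu) w)
      have e := d1.unique d2
      simpa [hc0] using e
    -- If c(v) = 0, then H has derivative Dc(w)v, so DF(w) is determined by Dc(w) and the
    -- P-coordinate. The kernel of DF would have dimension at least 5 − 2 = 3, but it lies on a
    -- line.
    set L : E5 →L[ℝ] ℝ × ℝ := (fderiv ℝ c v).prod ((ContinuousLinearMap.snd ℝ E5 ℝ).comp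
      ((S.symm : (E5 × ℝ) →L[ℝ] E5 × ℝ).comp ((ContinuousLinearMap.inl ℝ E5 ℝ).comp
        (fderiv ℝ F v)))) with hL
    have hker : LinearMap.ker (L : E5 →ₗ[ℝ] ℝ × ℝ) ≤ ℝ ∙ v := by
      intro w hw
      have hw' : L w = 0 := hw
      have h1 : fderiv ℝ c v w = 0 := congrArg Prod.fst hw'
      have h2 : (S.symm (fderiv ℝ F v w, 0)).2 = 0 := congrArg Prod.snd hw'
      have h3 := hdec (fderiv ℝ F v w, 0)
      rw [hd, h1, h2, zero_smul, zero_smul, map_zero, add_zero] at h3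
      obtain ⟨r, hr⟩ := h.ker v hv w (congrArg Prod.fst h3)
      exact Submodule.mem_span_singleton.2 ⟨r, hr.symm⟩
    have h1 := Submodule.finrank_mono hker
    rw [finrank_span_singleton (h.ne_zero v hv)] at h1
    have h2 := (L : E5 →ₗ[ℝ] ℝ × ℝ).finrank_range_add_finrank_ker
    have h3 := Submodule.finrank_le (LinearMap.range (L : E5 →ₗ[ℝ] ℝ × ℝ))
    simp at h2 h3
    omega
  · rw [← map_smul, ← hHc v hv]
    exact hdec _

end ConeMap

/-! ### Conformal maps that move the center of projection -/

section Reflection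

variable {n : E5}

theorem norm_sub_sq_of_unit (hn : ‖n‖ = 1) {x : E5} (hx : ‖x‖ = 1) :
    ‖x - (2 : ℝ) • n‖ ^ 2 = 5 - 4 * inner ℝ n x := by
  rw [norm_sub_sq_real, real_inner_smul_right, norm_smul, hn, hx, real_inner_comm]
  norm_num
  ring

theorem inner_lt_of_unit (hn : ‖n‖ = 1) {x : E5} (hx : ‖x‖ = 1) :
    0 < 5 - 4 * (inner ℝ n x : ℝ) := by
  have := real_inner_le_norm n x
  rw [hn, hx] at this
  linarith

theorem inversion_eq_of_unit (hn : ‖n‖ = 1) {x : E5} (hx : ‖x‖ = 1) :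
    EuclideanGeometry.inversion ((2 : ℝ) • n) (Real.sqrt 3) x =
      (3 / (5 - 4 * (inner ℝ n x : ℝ))) • (x - (2 : ℝ) • n) + (2 : ℝ) • n := by
  rw [EuclideanGeometry.inversion, dist_eq_norm, div_pow, norm_sub_sq_of_unit hn hx,
    Real.sq_sqrt (by norm_num), vsub_eq_sub, vadd_eq_add]

/-- The power of the point 2n with respect to the unit sphere is 4 − 1 = 3, the square of the radius
of inversion. -/
theorem norm_inversion_of_unit (hn : ‖n‖ = 1) {x : E5} (hx : ‖x‖ = 1) :
    ‖EuclideanGeometry.inversion ((2 : ℝ) • n) (Real.sqrt 3) x‖ = 1 := by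
  have h0 := inner_lt_of_unit hn hx
  rw [← sq_eq_sq₀ (norm_nonneg _) zero_le_one, inversion_eq_of_unit hn hx, norm_add_sq_real,
    norm_smul, mul_pow, norm_sub_sq_of_unit hn hx, real_inner_smul_left, real_inner_smul_right,
    inner_sub_left, real_inner_smul_left, real_inner_self_eq_norm_sq, norm_smul, hn,
    real_inner_comm n x, Real.norm_eq_abs, sq_abs]
  norm_num
  field_simp
  ring

/-- The inversion of the unit sphere with center `2n`. -/
def sphereInversion (hn : ‖n‖ = 1) (x : S4) : S4 :=
  ⟨EuclideanGeometry.inversion ((2 : ℝ) • n) (Real.sqrt 3) x,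
    mem_sphere_zero_iff_norm.2 (norm_inversion_of_unit hn (mem_sphere_zero_iff_norm.1 x.2))⟩

theorem isConformalIdentification_sphereInversion (hn : ‖n‖ = 1) :
    IsConformalIdentification 0 1 (sphereInversion hn) := by
  have hne : Real.sqrt 3 ≠ 0 := by positivity
  have hinv : Function.Involutive (sphereInversion hn) := fun x =>
    Subtype.ext (EuclideanGeometry.inversion_inversion _ hne _)
  refine ⟨hinv.bijective, EuclideanGeometry.inversion ((2 : ℝ) • n) (Real.sqrt 3), fun x => ?_⟩
  have hx : (x : E5) ≠ (2 : ℝ) • n := by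
    intro h
    have := mem_sphere_zero_iff_norm.1 x.2
    rw [h, norm_smul, hn] at this
    norm_num at this
  refine ⟨rfl, contDiffAt_const.inversion contDiffAt_const contDiffAt_id hx,
    (Real.sqrt 3 / dist (x : E5) ((2 : ℝ) • n)) ^ 2, ?_, fun v _ => ?_⟩
  · have := dist_pos.2 hx
    positivity
  · rw [(EuclideanGeometry.hasFDerivAt_inversion hx).fderiv]
    simp [norm_smul, abs_of_nonneg (Real.sqrt_nonneg 3)]

/-- The reflection of the Lorentz space `ℝ⁶` that induces the inversion of the sphere. -/
def lorentzReflection (n : E5) : (E5 × ℝ) →ₗ[ℝ] E5 × ℝ :=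
  -- The mirror is orthogonal to (2n, 1), whose Lorentz square is 4 − 1 = 3; hence the factor 2/3.
  LinearMap.id - ((2 / 3 : ℝ) • ((2 : ℝ) • (innerₛₗ ℝ n) ∘ₗ LinearMap.fst ℝ E5 ℝ -
    LinearMap.snd ℝ E5 ℝ)).smulRight ((2 : ℝ) • n, (1 : ℝ))

theorem lorentzReflection_apply (X : E5) (t : ℝ) : lorentzReflection n (X, t) =
    (X, t) - ((2 / 3) * (2 * inner ℝ n X - t)) • ((2 : ℝ) • n, (1 : ℝ)) := by
  simp [lorentzReflection]

theorem lorentzReflection_involutive (hn : ‖n‖ = 1) :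
    Function.Involutive (lorentzReflection n) := by
  rintro ⟨X, t⟩
  rw [lorentzReflection_apply X t, Prod.smul_mk, Prod.mk_sub_mk, lorentzReflection_apply,
    inner_sub_right, real_inner_smul_right, real_inner_smul_right, real_inner_self_eq_norm_sq, hn]
  simp only [Prod.smul_mk, Prod.mk_sub_mk, Prod.mk.injEq, smul_eq_mul]
  exact ⟨by module, by ring⟩

theorem lorentzReflection_sphere (hn : ‖n‖ = 1) (x : S4) : ∃ d : ℝ, d ≠ 0 ∧
    lorentzReflection n ((x : E5), 1) = d • ((sphereInversion hn x : E5), (1 : ℝ)) := by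
  have hx := mem_sphere_zero_iff_norm.1 x.2
  have h0 := inner_lt_of_unit hn hx
  refine ⟨(5 - 4 * inner ℝ n (x : E5)) / 3, by positivity, ?_⟩
  rw [lorentzReflection_apply, show ((sphereInversion hn x : S4) : E5) = _ from
    inversion_eq_of_unit hn hx]
  simp only [Prod.smul_mk, Prod.mk_sub_mk, Prod.mk.injEq, smul_eq_mul, smul_add, smul_smul]
  constructor
  · rw [show (5 - 4 * (inner ℝ n (x : E5) : ℝ)) / 3 * (3 / (5 - 4 * inner ℝ n (x : E5))) = 1 by
      field_simp]
    module
  · ring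

end Reflection

/-- A conformal map of the sphere takes a given center of projection to a finite point. -/
theorem exists_conformal_finite {P : E5 × ℝ} (hP : P ≠ 0) :
    ∃ (T : (E5 × ℝ) →ₗ[ℝ] E5 × ℝ) (j : S4 → S4), Function.Injective T ∧
      IsConformalIdentification 0 1 j ∧
      (∀ x : S4, ∃ d : ℝ, d ≠ 0 ∧ T ((x : E5), 1) = d • ((j x : E5), (1 : ℝ))) ∧ (T P).2 ≠ 0 := by
  by_cases h : P.2 = 0
  · have hX : P.1 ≠ 0 := fun hX => hP (Prod.ext hX h)
    have hn : ‖‖P.1‖⁻¹ • P.1‖ = 1 := norm_smul_inv_norm hX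
    -- For a center (X, 0) at infinity and n = X/‖X‖, the reflected vector has last coordinate
    -- −(4/3)‖X‖.
    refine ⟨lorentzReflection (‖P.1‖⁻¹ • P.1), sphereInversion hn,
      (lorentzReflection_involutive hn).injective, isConformalIdentification_sphereInversion hn,
      lorentzReflection_sphere hn, ?_⟩
    rw [← Prod.mk.eta (p := P), lorentzReflection_apply, h, real_inner_smul_left,
      real_inner_self_eq_norm_sq]
    simpa using hX
  · exact ⟨LinearMap.id, id, Function.injective_id, isConformalIdentification_id,
      fun x => ⟨1, one_ne_zero, by simp⟩, h⟩

/-! ### Restrictions of central projections -/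

/-- A functional that does not vanish on the points of `U` if `U` misses a hyperplane. -/
theorem exists_functional (U : Set RP4) : ∃ φ : E5 →ₗ[ℝ] ℝ, φ ≠ 0 ∧
    ((∃ H : Submodule ℝ E5, Module.finrank ℝ H = 4 ∧ ∀ x ∈ U, ¬ x.submodule ≤ H) →
      ∀ v ∈ cone U, φ v ≠ 0) := by
  by_cases h : ∃ H : Submodule ℝ E5, Module.finrank ℝ H = 4 ∧ ∀ x ∈ U, ¬ x.submodule ≤ H
  · obtain ⟨H, hH, hU⟩ := h
    have hlt : H < ⊤ := lt_top_iff_ne_top.2 fun h => by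
      rw [h, finrank_top] at hH
      simp at hH
    obtain ⟨φ, hφ, hle⟩ := H.exists_le_ker_of_lt_top hlt
    refine ⟨φ, hφ, fun _ v ⟨hv, hvU⟩ h0 => hU _ hvU ?_⟩
    have hker : H = LinearMap.ker φ := by
      refine Submodule.eq_of_le_of_finrank_le hle ?_
      have hlt' : LinearMap.ker φ < ⊤ := lt_top_iff_ne_top.2 fun h => hφ (LinearMap.ker_eq_top.1 h)
      have := Submodule.finrank_lt hlt'.ne
      simp at this
      omega
    rw [Projectivization.submodule_mk, Submodule.span_singleton_le_iff_mem, hker]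
    exact h0
  · refine ⟨(lastPart : E5 →ₗ[ℝ] ℝ), fun h0 => ?_, fun h' => absurd h' h⟩
    have := congrArg (fun L : E5 →ₗ[ℝ] ℝ => L (EuclideanSpace.single 4 1)) h0
    simp at this

theorem isClassicalProjection_of_forms {U : Set RP4} {f : RP4 → S4} {F : E5 → E5}
    (hF : ∀ v (hv : v ≠ 0), Projectivization.mk ℝ v hv ∈ U → F v = f (Projectivization.mk ℝ v hv))
    {i : E5 →ₗ[ℝ] E5 × ℝ} {P : E5 × ℝ} (hi : ∀ v (τ : ℝ), i v = τ • P → v = 0 ∧ τ = 0)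
    (h : ∀ v ∈ cone U, ∃ c τ : ℝ, c ≠ 0 ∧ (F v, (1 : ℝ)) = c • i v + τ • P) :
    IsClassicalProjectionOn f U := by
  have hP : P ≠ 0 := by
    rintro rfl
    exact one_ne_zero (hi 0 1 (by simp)).2
  obtain ⟨T, j, hT, hj, hTj, hTP⟩ := exists_conformal_finite hP
  obtain ⟨φ, hφ, hφU⟩ := exists_functional U
  set Q := T P with hQ
  set p : E5 := Q.2⁻¹ • Q.1 with hp
  have hQp : Q = Q.2 • (p, (1 : ℝ)) := by
    rw [hp, Prod.smul_mk, smul_smul, mul_inv_cancel₀ hTP, one_smul, smul_eq_mul, mul_one]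
  -- Adding multiples of Q does not change the lines through the center. The multiple is chosen so
  -- that the last coordinate of I(v) is φ(v): the points sent to infinity are exactly those of the
  -- hyperplane φ = 0, which avoids `U` if some hyperplane does.
  set I : E5 →ₗ[ℝ] E5 × ℝ := T ∘ₗ i + (Q.2⁻¹ • (φ - LinearMap.snd ℝ E5 ℝ ∘ₗ T ∘ₗ i)).smulRight Q
    with hI
  have hIv : ∀ v, I v = T (i v) + (Q.2⁻¹ * (φ v - (T (i v)).2)) • Q := fun v => by simp [hI]
  have hI2 : ∀ v, (I v).2 = φ v := by
    intro v
    rw [hIv, Prod.snd_add, Prod.smul_snd, smul_eq_mul]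
    field_simp
    ring
  have hindep : ∀ v (τ : ℝ), I v = τ • Q → v = 0 := by
    intro v τ hv
    refine (hi v (τ - Q.2⁻¹ * (φ v - (T (i v)).2)) (hT ?_)).1
    rw [map_smul, sub_smul, ← hQ, ← hv, hIv]
    abel
  have hIinj : Function.Injective I := by
    rw [injective_iff_map_eq_zero]
    intro v hv
    exact hindep v 0 (by rw [hv, zero_smul])
  have haff : ∀ v (hv : v ≠ 0), φ v ≠ 0 →
      Projectivization.map I hIinj (Projectivization.mk ℝ v hv) ∈ range ofAffine := by
    intro v hv h0
    refine ⟨(φ v)⁻¹ • (I v).1, ?_⟩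
    rw [Projectivization.map_mk, ofAffine, Projectivization.mk_eq_mk_iff']
    refine ⟨(φ v)⁻¹, Prod.ext rfl ?_⟩
    rw [Prod.smul_snd, hI2, smul_eq_mul, inv_mul_cancel₀ h0]
  have hcenter : ∀ x : RP4, Projectivization.map I hIinj x ≠ ofAffine p := by
    intro x
    induction x using Projectivization.ind with
    | h v hv =>
      intro hx
      rw [Projectivization.map_mk, ofAffine, Projectivization.mk_eq_mk_iff'] at hx
      obtain ⟨a, ha⟩ := hx
      refine hv (hindep v (a * Q.2⁻¹) ?_)
      rw [hQp, smul_smul, Prod.smul_snd, smul_eq_mul, mul_one, mul_assoc, inv_mul_cancel₀ hTP,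
        mul_one, ha]
  refine ⟨I, hIinj, 0, 1, j, p, one_pos, hj, ?_, hcenter, ?_, ?_⟩
  · obtain ⟨v, hv⟩ : ∃ v, φ v ≠ 0 := by
      by_contra! hcon
      exact hφ (LinearMap.ext hcon)
    exact ⟨_, haff v (by rintro rfl; simp at hv) hv⟩
  · intro x hx
    refine ⟨hcenter x, ?_⟩
    induction x using Projectivization.ind with
    | h v hv =>
      obtain ⟨c, τ, hc, hcτ⟩ := h v ⟨hv, hx⟩
      obtain ⟨d, hd, hdj⟩ := hTj (f (Projectivization.mk ℝ v hv))
      rw [← hF v hv hx, hcτ, map_add, map_smul, map_smul, ← hQ] at hdj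
      set y : E5 := ((j (f (Projectivization.mk ℝ v hv)) : S4) : E5) with hy
      have hcomb : ∃ a b : ℝ, a ≠ 0 ∧ (y, (1 : ℝ)) = a • I v + b • (p, (1 : ℝ)) := by
        refine ⟨d⁻¹ * c, (d⁻¹ * (τ - c * (Q.2⁻¹ * (φ v - (T (i v)).2)))) * Q.2,
          mul_ne_zero (inv_ne_zero hd) hc, ?_⟩
        rw [mul_smul _ Q.2, ← hQp, hIv, ← inv_smul_smul₀ hd (y, (1 : ℝ)), ← hdj]
        module
      obtain ⟨a, b, ha, hab⟩ := hcomb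
      constructor
      -- The coefficient a ≠ 0 is essential here: if y = p, then I(v) would be a multiple of Q.
      · intro hyp
        refine hv (hindep v (a⁻¹ * (1 - b) * Q.2⁻¹) ?_)
        rw [hQp, smul_smul, Prod.smul_snd, smul_eq_mul, mul_one, mul_assoc, inv_mul_cancel₀ hTP,
          mul_one, mul_smul, sub_smul, one_smul, ← hyp, eq_inv_smul_iff₀ ha, eq_sub_iff_add_eq,
          hyp, ← hab, hyp]
      · rw [ofAffine, ofAffine, Projectivization.map_mk, Projectivization.submodule_mk,
          Projectivization.submodule_mk, Projectivization.submodule_mk,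
          Submodule.span_singleton_le_iff_mem, hab, add_comm]
        exact Submodule.add_mem_sup (Submodule.smul_mem _ _ (Submodule.mem_span_singleton_self _))
          (Submodule.smul_mem _ _ (Submodule.mem_span_singleton_self _))
  · intro hH x hx
    induction x using Projectivization.ind with
    | h v hv => exact haff v hv (hφU hH v ⟨hv, hx⟩)

end LinesToCircles

end

/-! ### From the local forms to the global alternative -/

theorem theorem1 (U : Set LinesToCircles.RP4) (V : Set LinesToCircles.S4)
    (f : LinesToCircles.RP4 → LinesToCircles.S4) (hU : IsConnected U)
    (hf : LinesToCircles.IsAnalyticDiffeo f U V)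
    (hlines : LinesToCircles.TakesLinesToCircles f U) :
    LinesToCircles.IsClassicalProjectionOn f U ∨
      LinesToCircles.IsRestrictionOfFibrationOn LinesToCircles.leftHopf f U ∨
      LinesToCircles.IsRestrictionOfFibrationOn LinesToCircles.rightHopf f U := by
  obtain ⟨F, h, hF⟩ := LinesToCircles.coneMap_of_diffeo hf hlines
  have hne : (LinesToCircles.cone U).Nonempty := by
    obtain ⟨x, hx⟩ := hU.nonempty
    refine ⟨x.rep, x.rep_nonzero, ?_⟩
    rwa [Projectivization.mk_rep]
  obtain ⟨v, hv, ⟨i, P, hi, hl⟩ | ⟨Y, Z, hi, hl⟩ | ⟨Y, Z, hi, hl⟩⟩ := h.exists_local_form hne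
  · exact Or.inl (LinesToCircles.isClassicalProjection_of_forms hF hi
      (h.classical_of_eventually hU.isPreconnected hf.isOpen_source hi hv hl))
  · exact Or.inr (Or.inl (LinesToCircles.isRestriction_leftHopf hF hi
      (h.satisfiesHopf_of_eventually hU.isPreconnected hf.isOpen_source hv hl)))
  · exact Or.inr (Or.inr (LinesToCircles.isRestriction_rightHopf hF hi
      (h.satisfiesRightHopf_of_eventually hU.isPreconnected hf.isOpen_source hv hl)))
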